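/- Let $T$ be a positive trace class integral operator on $L^2(\mathbb R^d)$ with measurable kernel function $J(x,y)$, so $(Tf)(x)=\int J(x,y)f(y)\,dy$. As usual, the version of the kernel is chosen so that every matrix $(J(x_i,x_j))_{1\le i,j\le n}$ is positive semidefinite and $\operatorname{Tr}T=\int J(x,x)\,dx<\infty$. Suppose that there is a compact set $\Delta_0\subset\mathbb R^d$ such that $J(x,y)=0$ unless $x,y\in\Delta_0$. Let $\mathcal N$ be the space of locally finite integer-valued measures $\xi$ on $\mathbb R^d$ (configurations), with the $\sigma$-algebra generated by the maps $\xi\mapsto N_\Lambda(\xi)=\xi(\Lambda)$, $\Lambda$ bounded Borel; $\xi_\Delta$ is the restriction of $\xi$ to $\Delta$, and $\zeta\eta$ is the superposition of $\zeta$ and $\eta$. A probability measure $\mu$ on $\mathcal N$ is a fermion random point field (FRPF) for a positive trace class operator with kernel $K(x,y)$ (version chosen as above) if for each $n$ its $n$-point correlation function is $\det(K(x_i,x_j))_{1\le i,j\le n}$, i.e. for pairwise disjoint bounded Borel sets $\Lambda_1,\dots,\Lambda_m$ and $k_1+\dots+k_m=n$, $$\mathbb E_\mu\prod_{i=1}^m\frac{N_{\Lambda_i}!}{(N_{\Lambda_i}-k_i)!}=\int_{\Lambda_1^{k_1}\times\cdots\times\Lambda_m^{k_m}}\det(K(x_i,x_j))_{1\le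 i,j\le n}\,dx_1\cdots dx_n .$$ For a finite configuration $\eta=\delta_{x_1}+\dots+\delta_{x_n}$ let $U(\eta)=-\log\det(J(x_i,x_j))_{i,j\le n}\in(-\infty,+\infty]$ (with $-\log 0=+\infty$), and for finite $\eta,\eta'$ let $W(\eta;\eta')=U(\eta\eta')-U(\eta)-U(\eta')$ if $U(\eta\eta')<\infty$ and $W(\eta;\eta')=+\infty$ otherwise. For $\Lambda$ bounded Borel let $\mathcal R_\Lambda$ be the set of all $\xi\in\mathcal N$ with $U(\xi_\Delta)<\infty$ for every bounded Borel $\Delta\subset\Lambda^c$. For $\zeta$ a simple configuration on $\Lambda$ and $\xi\in\mathcal R_\Lambda$ put $$H_\Lambda(\zeta;\xi)=\lim_{\Delta\uparrow\mathbb R^d}\bigl[U(\zeta)+W(\zeta;\xi_{\Delta\setminus\Lambda})\bigr],\qquad \gamma_\Lambda(\zeta;\xi)=\frac{e^{-H_\Lambda(\zeta;\xi)}}{Z_\Lambda(\xi)},\qquad Z_\Lambda(\xi)=\sum_{n\ge0}\frac1{n!}\int_{\Lambda^n}e^{-H_\Lambda(\delta_{x_1}+\dots+\delta_{x_n};\xi)}\,dx_1\cdots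 dx_n,$$ where $e^{-H_\Lambda(\zeta;\xi)}$ and $\gamma_\Lambda(\zeta;\xi)$ are set to $0$ for all other $\zeta,\xi$. The determinantal specification $\gamma^{(J)}$ is given by $$\gamma_\Lambda^{(J)}(f\,|\,\xi)=\sum_{n\ge0}\frac1{n!}\int_{\Lambda^n}\gamma_\Lambda(\delta_{x_1}+\dots+\delta_{x_n};\xi)\,f\bigl((\delta_{x_1}+\dots+\delta_{x_n})\,\xi_{\Lambda^c}\bigr)\,dx_1\cdots dx_n$$ for bounded measurable $f:\mathcal N\to\mathbb R$. Then there is exactly one FRPF $\mu^{(J)}$ for the operator $T(I+T)^{-1}$, and $\mu^{(J)}$ is a Gibbs measure for $\gamma^{(J)}$: for every bounded Borel set $\Lambda\subset\mathbb R^d$ and every bounded measurable $f:\mathcal N\to\mathbb R$, the function $\gamma^{(J)}_\Lambda(f\,|\,\cdot)$ is $\mu^{(J)}$-integrable and $$\int f\,d\mu^{(J)}=\int\gamma_\Lambda^{(J)}(f\,|\,\xi)\,d\mu^{(J)}(\xi).$$ -/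

import Mathlib

open MeasureTheory Filter Topology
open scoped ENNReal Nat ComplexOrder

noncomputable section

namespace DPP

/-- The one-particle space `ℝ^d`, with its Lebesgue measure `volume`. -/
abbrev Pt (d : ℕ) : Type := EuclideanSpace ℝ (Fin d)

/-- The complex Hilbert space `L²(ℝ^d)`. -/
abbrev L2 (d : ℕ) : Type := Lp ℂ 2 (volume : Measure (Pt d))

/-- The bounded Borel subsets of `ℝ^d`, ordered by inclusion. -/
abbrev BddBorel (d : ℕ) : Type :=
  {B : Set (Pt d) // Bornology.IsBounded B ∧ MeasurableSet B}

/-! ### Integral operators -/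

/-- The bounded operator `T` has trace `t`: the sum of its diagonal matrix elements is `t` in
every orthonormal basis. A positive operator is trace class iff it has a trace in this sense. -/
def HasTrace {d : ℕ} (T : L2 d →L[ℂ] L2 d) (t : ℂ) : Prop :=
  ∀ (ι : Type) (b : HilbertBasis ι ℂ (L2 d)), HasSum (fun i => inner ℂ (b i) (T (b i))) t

/-- `T` is a positive trace class integral operator on `L²(ℝ^d)` and `k` is its kernel function.
A kernel is determined by `T` only up to a null set of `ℝ^d × ℝ^d`, and the diagonal is such a
null set; the version is fixed, as usual, by asking that `k` be positive definite and that the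
trace of `T` be the integral of `k` over the diagonal. -/
structure IsTraceClassKernel {d : ℕ} (T : L2 d →L[ℂ] L2 d) (k : Pt d → Pt d → ℂ) : Prop where
  isPositive : T.IsPositive
  measurable : Measurable (Function.uncurry k)
  apply_ae : ∀ f : L2 d, T f =ᵐ[volume] fun x => ∫ y, k x y * f y
  posSemidef : ∀ (n : ℕ) (x : Fin n → Pt d),
    (Matrix.of fun i j => k (x i) (x j)).PosSemidef
  integrable_diag : Integrable (fun x => k x x)
  hasTrace : HasTrace T (∫ x, k x x)

/-- The operator `T (I + T)⁻¹`. -/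
def resolventOp {d : ℕ} (T : L2 d →L[ℂ] L2 d) : L2 d →L[ℂ] L2 d :=
  T * Ring.inverse (1 + T)

/-! ### Configurations -/

/-- Configurations: locally finite, integer-valued measures on `ℝ^d`. -/
structure Config (d : ℕ) where
  toMeasure : Measure (Pt d)
  natValued : ∀ B : Set (Pt d), Bornology.IsBounded B → MeasurableSet B →
    ∃ n : ℕ, toMeasure B = n

variable {d : ℕ}

/-- The number of particles `N_B(ξ)` in a bounded Borel set. -/
def Config.num (ξ : Config d) (B : BddBorel d) : ℕ := ⌊(ξ.toMeasure B.1).toReal⌋₊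

/-- The σ-algebra generated by the particle numbers in bounded Borel sets. -/
instance : MeasurableSpace (Config d) :=
  ⨆ B : BddBorel d, MeasurableSpace.comap (fun ξ => ξ.num B) ⊤

/-- The finite configuration `δ_{x_1} + ⋯ + δ_{x_n}`. -/
def Config.ofPoints {n : ℕ} (x : Fin n → Pt d) : Config d where
  toMeasure := ∑ i, Measure.dirac (x i)
  natValued := by
    classical
    intro B _ hB
    refine ⟨∑ i, if x i ∈ B then 1 else 0, ?_⟩
    simp [Measure.finsetSum_apply, Measure.dirac_apply' _ hB, Set.indicator_apply]

/-- The restriction of a configuration to a Borel set. -/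
def Config.restrict (ξ : Config d) (A : Set (Pt d)) (hA : MeasurableSet A) : Config d where
  toMeasure := ξ.toMeasure.restrict A
  natValued := by
    intro B hb hB
    rw [Measure.restrict_apply hB]
    exact ξ.natValued _ (hb.subset Set.inter_subset_left) (hB.inter hA)

/-- The superposition of two configurations. -/
def Config.add (ξ η : Config d) : Config d where
  toMeasure := ξ.toMeasure + η.toMeasure
  natValued := by
    intro B hb hB
    obtain ⟨m, hm⟩ := ξ.natValued B hb hB
    obtain ⟨n, hn⟩ := η.natValued B hb hB
    exact ⟨m + n, by simp [hm, hn]⟩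

/-- No two particles share a point. -/
def Config.IsSimple (ξ : Config d) : Prop := ∀ x, ξ.toMeasure {x} ≤ 1

/-! ### Fermion (determinantal) random point fields -/

/-- `ρ` is the `n`-point correlation function of the random point field `μ`. The map `a` tells
in which of the disjoint sets each of the `n` points is; `k_i` is the number of `j` with
`a j = i`. -/
structure IsCorrelationFunction (μ : Measure (Config d)) (n : ℕ) (ρ : (Fin n → Pt d) → ℝ) :
    Prop where
  locallyIntegrable : LocallyIntegrable ρ volume
  nonneg : ∀ x, 0 ≤ ρ x
  factorial_moment : ∀ (m : ℕ) (B : Fin m → BddBorel d),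
    (Pairwise fun i j => Disjoint (B i).1 (B j).1) → ∀ a : Fin n → Fin m,
    ∫⁻ ξ, (∏ i, (ξ.num (B i)).descFactorial (Finset.univ.filter fun j => a j = i).card : ℕ) ∂μ
      = ∫⁻ x in {x | ∀ j, x j ∈ (B (a j)).1}, ENNReal.ofReal (ρ x)

/-- `μ` is a fermion random point field for the operator `T`: its correlation functions are
`det (k (x_i, x_j))` with `k` the integral kernel of `T`. -/
def IsFermion (μ : Measure (Config d)) (T : L2 d →L[ℂ] L2 d) : Prop :=
  IsProbabilityMeasure μ ∧ ∃ k : Pt d → Pt d → ℂ, IsTraceClassKernel T k ∧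
    ∀ n : ℕ, IsCorrelationFunction μ n
      fun x => (Matrix.det (Matrix.of fun i j => k (x i) (x j))).re

/-! ### The determinantal specification -/

/-- `det J(ξ, ξ)` for a finite configuration `ξ`, with points repeated according to their
multiplicity. It does not depend on the order of the points. -/
def detConfig (J : Pt d → Pt d → ℂ) (ξ : Config d) : ℝ :=
  open Classical in
  if h : ∃ (n : ℕ) (x : Fin n → Pt d), ξ = Config.ofPoints x then
    (Matrix.det (Matrix.of fun i j => J (h.choose_spec.choose i) (h.choose_spec.choose j))).re
  else 0

/-- The potential energy `U(ξ) = - log det J(ξ, ξ)` of a finite configuration, with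
`- log 0 = +∞`. -/
def potential (J : Pt d → Pt d → ℂ) (ξ : Config d) : EReal :=
  -ENNReal.log (ENNReal.ofReal (detConfig J ξ))

/-- The mutual potential energy of two finite configurations. -/
def mutualEnergy (J : Pt d → Pt d → ℂ) (ξ η : Config d) : EReal :=
  open Classical in
  if potential J (ξ.add η) = ⊤ then ⊤
  else potential J (ξ.add η) - potential J ξ - potential J η

/-- The possible boundary conditions: `det J(ξ_Δ, ξ_Δ) ≠ 0` for all bounded Borel sets `Δ`
in the complement of `Λ`. -/
def possible (J : Pt d → Pt d → ℂ) (Λ : BddBorel d) : Set (Config d) :=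
  {ξ | ∀ Δ : BddBorel d, Δ.1 ⊆ Λ.1ᶜ → detConfig J (ξ.restrict Δ.1 Δ.2.2) ≠ 0}

/-- `ζ` is a simple configuration on `Λ` and `ξ` is a possible boundary condition. -/
def Admissible (J : Pt d → Pt d → ℂ) (Λ : BddBorel d) (ζ ξ : Config d) : Prop :=
  (ζ.IsSimple ∧ ζ.toMeasure Λ.1ᶜ = 0) ∧ ξ ∈ possible J Λ

/-- The energy `H_Λ(ζ; ξ)` of the configuration `ζ` on `Λ` with boundary condition `ξ`: the limit
of `U(ζ) + W(ζ; ξ_{Δ∖Λ})` as the bounded Borel set `Δ` increases to `ℝ^d`. -/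
def energy (J : Pt d → Pt d → ℂ) (Λ : BddBorel d) (ζ ξ : Config d) : EReal :=
  open Classical in
  if Admissible J Λ ζ ξ then
    limUnder atTop fun Δ : BddBorel d =>
      potential J ζ + mutualEnergy J ζ (ξ.restrict (Δ.1 \ Λ.1) (Δ.2.2.diff Λ.2.2))
  else ⊤

/-- The partition function `Z_Λ(ξ) = ∑ (1/n!) ∫_{Λ^n} exp(-H_Λ(x; ξ)) dx`. -/
def partitionFn (J : Pt d → Pt d → ℂ) (Λ : BddBorel d) (ξ : Config d) : ℝ≥0∞ :=
  ∑' n : ℕ, ((n ! : ℕ) : ℝ≥0∞)⁻¹ *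
    ∫⁻ x in {x : Fin n → Pt d | ∀ i, x i ∈ Λ.1}, EReal.exp (-energy J Λ (Config.ofPoints x) ξ)

/-- The density `γ_Λ(ζ; ξ)`. -/
def specDensity (J : Pt d → Pt d → ℂ) (Λ : BddBorel d) (ζ ξ : Config d) : ℝ≥0∞ :=
  open Classical in
  if Admissible J Λ ζ ξ then (partitionFn J Λ ξ)⁻¹ * EReal.exp (-energy J Λ ζ ξ) else 0

/-- `γ_Λ(f | ξ) = ∑ (1/n!) ∫_{Λ^n} γ_Λ(x; ξ) f(x ξ_{Λᶜ}) dx`. -/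
def spec (J : Pt d → Pt d → ℂ) (Λ : BddBorel d) (f : Config d → ℝ) (ξ : Config d) : ℝ :=
  ∑' n : ℕ, (n ! : ℝ)⁻¹ * ∫ x in {x : Fin n → Pt d | ∀ i, x i ∈ Λ.1},
    (specDensity J Λ (Config.ofPoints x) ξ).toReal *
      f ((Config.ofPoints x).add (ξ.restrict Λ.1ᶜ Λ.2.2.compl))

/-- `μ` is a Gibbs measure for the specification `γ^(J)`: it satisfies the DLR equations. -/
def IsGibbs (J : Pt d → Pt d → ℂ) (μ : Measure (Config d)) : Prop :=
  IsProbabilityMeasure μ ∧ ∀ (Λ : BddBorel d) (f : Config d → ℝ), Measurable f →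
    (∃ C : ℝ, ∀ ξ, |f ξ| ≤ C) →
    Integrable (spec J Λ f) μ ∧ ∫ ξ, f ξ ∂μ = ∫ ξ, spec J Λ f ξ ∂μ

end DPP

end

noncomputable section

namespace DPP

/-! ### Determinants -/

section Determinants

variable {n : Type*} [Fintype n]

/-! Write K for the kernel of T(1+T)⁻¹ and det(1+T) for Fredholm's determinant. The candidate field
has density det J(ξ,ξ) / det(1+T) with respect to the unnormalised Poisson measure Σ volumeⁿ/n! on
finite configurations. Its properties rest on Fredholm's identity (`fredholmMinor_eq_det`):
integrating det J over m points added to x₁, …, xₙ and summing over m with weights 1/m! gives det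
K(x_i,x_j) · det(1+T). The case n = 0 normalises the measure. Mecke's formula turns factorial
moments into the addition of points, so the identity for general n says that the correlation
functions are det K (`isFermion_fermionMeasure`).

The identity is needed at every point, because the version of K matters. Expansion of a minor along
one row gives the integral equation Φ = Σ J(·,y_j) c_j − ∫ J Φ, which (1+T)⁻¹ solves in L²;
inserting the solution into the equation makes the result pointwise. The same series show that every
matrix K(x_i,x_j) is positive semidefinite, and the square root of (1+T)⁻¹ gives the trace of K.
Hadamard's inequality makes all series converge.

For uniqueness, two kernels of the same operator agree almost everywhere, on the diagonal too
(`kernel_diag_ae_eq`), so the operator determines all factorial moments. By Hadamard's inequality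
these grow slowly enough to determine the law (`map_eq_of_moments`).

For the Gibbs property, the Poisson measure is the superposition of independent parts in Λ and in
its complement. A density det J against it makes the conditional law in Λ, given the outside part η,
proportional to det J(ζη). On finite configurations the limit defining the energy is eventually
constant and exp(−H) = det J(ζη) / det J(η), so the specification is this conditional law. The DLR
equations then amount to Fubini's theorem (`comp_gibbsKernel`). -/

lemma prod_le_of_sum_le (z : n → ℝ) (hz : ∀ i, 0 ≤ z i)
    (hs : ∑ i, z i ≤ (Fintype.card n : ℝ) ^ 2) :
    ∏ i, z i ≤ (Fintype.card n : ℝ) ^ Fintype.card n := by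
  rcases isEmpty_or_nonempty n with h | h
  · simp
  have hN : (0 : ℝ) < Fintype.card n := by exact_mod_cast (Fintype.card_pos : 0 < Fintype.card n)
  have h1 := Real.geom_mean_le_arith_mean Finset.univ (fun _ : n => (1 : ℝ)) z (by simp)
    (by simp [Fintype.card_pos]) (fun i _ => hz i)
  simp only [Real.rpow_one, Finset.sum_const, Finset.card_univ, nsmul_eq_mul, mul_one,
    one_mul] at h1
  have h2 : (∑ i, z i) / (Fintype.card n : ℝ) ≤ Fintype.card n := by
    rw [div_le_iff₀ hN]; nlinarith
  have h3 := h1.trans h2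
  have h0 : 0 ≤ ∏ i, z i := Finset.prod_nonneg fun i _ => hz i
  calc ∏ i, z i = ((∏ i, z i) ^ ((Fintype.card n : ℝ)⁻¹)) ^ Fintype.card n := by
        rw [Real.rpow_inv_natCast_pow h0 Fintype.card_ne_zero]
    _ ≤ _ := by gcongr

variable [DecidableEq n]

/-- Hadamard's inequality. The eigenvalues of A Aᴴ multiply to |det A|² and sum to Σ |a_ij|² ≤ N²,
so the inequality of arithmetic and geometric means gives |det A|² ≤ N^N. -/
lemma norm_det_le_of_norm_le_one (A : Matrix n n ℂ) (hA : ∀ a b, ‖A a b‖ ≤ 1) :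
    ‖A.det‖ ≤ √((Fintype.card n : ℝ) ^ Fintype.card n) := by
  have hP : (A * A.conjTranspose).PosSemidef := Matrix.posSemidef_self_mul_conjTranspose A
  have hd : ((‖A.det‖ ^ 2 : ℝ) : ℂ) = ∏ i, (hP.1.eigenvalues i : ℂ) := by
    have h := hP.isHermitian.det_eq_prod_eigenvalues
    rw [Matrix.det_mul, Matrix.det_conjTranspose] at h
    refine Eq.trans ?_ h
    push_cast
    exact (Complex.mul_conj' _).symm
  have hd' : ‖A.det‖ ^ 2 = ∏ i, hP.1.eigenvalues i := by exact_mod_cast hd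
  have ht : ((∑ i, ∑ j, ‖A i j‖ ^ 2 : ℝ) : ℂ) = ∑ i, (hP.1.eigenvalues i : ℂ) := by
    have h := hP.isHermitian.trace_eq_sum_eigenvalues
    refine Eq.trans ?_ h
    rw [Matrix.trace]
    push_cast
    refine Finset.sum_congr rfl fun i _ => ?_
    rw [Matrix.diag_apply, Matrix.mul_apply]
    refine Finset.sum_congr rfl fun j _ => ?_
    exact (Complex.mul_conj' _).symm
  have ht' : ∑ i, ∑ j, ‖A i j‖ ^ 2 = ∑ i, hP.1.eigenvalues i := by exact_mod_cast ht
  apply Real.le_sqrt_of_sq_le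
  rw [hd']
  apply prod_le_of_sum_le _ (fun i => hP.eigenvalues_nonneg i)
  rw [← ht']
  calc ∑ i, ∑ j, ‖A i j‖ ^ 2 ≤ ∑ _i : n, ∑ _j : n, (1 : ℝ) := by
        gcongr with i _ j _
        exact pow_le_one₀ (norm_nonneg _) (hA i j)
    _ = _ := by simp [sq]

/-- Dividing rows by α and columns by β reduces to entries of norm at most 1. A vanishing weight is
harmless: the entry is then 0, and so is its quotient by 0. -/
lemma norm_det_le (A : Matrix n n ℂ) (α β : n → ℝ) (hα : ∀ a, 0 ≤ α a) (hβ : ∀ b, 0 ≤ β b)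
    (hA : ∀ a b, ‖A a b‖ ≤ α a * β b) :
    ‖A.det‖ ≤ √((Fintype.card n : ℝ) ^ Fintype.card n) * (∏ a, α a) * ∏ b, β b := by
  set B : Matrix n n ℂ := Matrix.of fun a b => A a b / (α a * β b) with hB
  have hAB : A = Matrix.diagonal (fun a => (α a : ℂ)) * B * Matrix.diagonal (fun b => (β b : ℂ)) := by
    ext a b
    rw [Matrix.mul_diagonal, Matrix.diagonal_mul, hB, Matrix.of_apply]
    by_cases h : (α a : ℂ) * β b = 0
    · have h' : α a * β b = 0 := by exact_mod_cast h
      have := hA a b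
      rw [h'] at this
      have : A a b = 0 := norm_le_zero_iff.1 this
      simp [this]
    · have h1 : (α a : ℂ) ≠ 0 := left_ne_zero_of_mul h
      have h2 : (β b : ℂ) ≠ 0 := right_ne_zero_of_mul h
      field_simp
  have hB1 : ∀ a b, ‖B a b‖ ≤ 1 := by
    intro a b
    rw [hB, Matrix.of_apply, norm_div, norm_mul, Complex.norm_real, Complex.norm_real,
      Real.norm_of_nonneg (hα a), Real.norm_of_nonneg (hβ b)]
    exact div_le_one_of_le₀ (hA a b) (mul_nonneg (hα a) (hβ b))
  have := norm_det_le_of_norm_le_one B hB1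
  rw [hAB, Matrix.det_mul, Matrix.det_mul, Matrix.det_diagonal, Matrix.det_diagonal, norm_mul,
    norm_mul, norm_prod, norm_prod]
  simp only [Complex.norm_real, Real.norm_of_nonneg, hα, hβ]
  calc _ ≤ (∏ a, α a) * √((Fintype.card n : ℝ) ^ Fintype.card n) * ∏ b, β b := by
        gcongr
        · exact Finset.prod_nonneg fun i _ => hβ i
        · exact Finset.prod_nonneg fun i _ => hα i
    _ = _ := by ring

lemma measurable_det {β : Type*} [MeasurableSpace β] (A : β → Matrix n n ℂ)
    (hA : ∀ a b, Measurable fun w => A w a b) : Measurable fun w => (A w).det := by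
  simp only [Matrix.det_apply]
  refine Finset.measurable_sum _ fun σ _ => ?_
  exact (Finset.measurable_prod _ fun i _ => hA _ _).const_smul _

end Determinants

/-- From N^N / N! ≤ e^N. Up to an exponential, Hadamard's bound thus grows like √(N!), which the
1/m! of the Fredholm series absorbs. -/
lemma sqrt_pow_self_le (N : ℕ) : √((N : ℝ) ^ N) ≤ √(Real.exp N * N !) := by
  apply Real.sqrt_le_sqrt
  have := Real.pow_div_factorial_le_exp (N : ℝ) (Nat.cast_nonneg N) N
  rwa [div_le_iff₀ (by positivity)] at this

/-- The majorant of Fredholm's series converges. -/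
lemma summable_sqrt_pow_self (n : ℕ) (t : ℝ) (ht : 0 ≤ t) :
    Summable fun m : ℕ => √(((n + m : ℕ) : ℝ) ^ (n + m)) * (t ^ m / m !) := by
  -- Replacing t by t + 1 makes all terms positive, as the ratio test needs. The ratio of
  -- consecutive terms is √(e(n+m+1)) (t+1)/(m+1), which tends to 0.
  suffices h : Summable fun m : ℕ => √(Real.exp (n + m : ℕ) * (n + m)!) * ((t + 1) ^ m / m !) by
    refine Summable.of_nonneg_of_le (fun m => by positivity) (fun m => ?_) h
    have := sqrt_pow_self_le (n + m)
    gcongr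
    linarith
  set u : ℕ → ℝ := fun m => √(Real.exp (n + m : ℕ) * (n + m)!) * ((t + 1) ^ m / m !) with hu
  have hpos : ∀ m, 0 < u m := fun m => by positivity
  refine summable_of_ratio_test_tendsto_lt_one (l := 0) one_pos
    (Eventually.of_forall fun m => (hpos m).ne') ?_
  have hr : ∀ m : ℕ, ‖u (m + 1)‖ / ‖u m‖
      = √(Real.exp 1 * (n + m + 1)) * ((t + 1) / (m + 1)) := by
    intro m
    rw [Real.norm_of_nonneg (hpos _).le, Real.norm_of_nonneg (hpos _).le, div_eq_iff (hpos m).ne']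
    simp only [hu]
    have e1 : Real.exp ((n + (m + 1) : ℕ) : ℝ) * ((n + (m + 1))! : ℝ)
        = (Real.exp 1 * (n + m + 1)) * (Real.exp ((n + m : ℕ) : ℝ) * (n + m)!) := by
      rw [← add_assoc, Nat.factorial_succ]
      push_cast
      rw [Real.exp_add]
      ring
    rw [e1, Real.sqrt_mul (by positivity), Nat.factorial_succ]
    push_cast
    field_simp
    ring
  simp_rw [hr]
  have h1 : Tendsto (fun m : ℕ => √(Real.exp 1 * ((n + m + 1) / (m + 1) ^ 2)) * (t + 1)) atTop (𝓝 0) := by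
    have h2 : Tendsto (fun m : ℕ => ((n : ℝ) + m + 1) / ((m : ℝ) + 1) ^ 2) atTop (𝓝 0) := by
      have h3 : Tendsto (fun m : ℕ => 1 / ((m : ℝ) + 1)) atTop (𝓝 0) :=
        tendsto_one_div_add_atTop_nhds_zero_nat
      have h4 := ((h3.mul h3).const_mul (n : ℝ)).add h3
      simp only [mul_zero, add_zero] at h4
      refine h4.congr fun m => ?_
      field_simp
      ring
    have := ((h2.const_mul (Real.exp 1)).sqrt).mul_const (t + 1)
    simpa using this
  refine h1.congr fun m => ?_
  have : ((n : ℝ) + m + 1) / (m + 1) ^ 2 * Real.exp 1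
    = (Real.exp 1 * (n + m + 1)) / (m + 1) ^ 2 := by ring
  rw [mul_comm (Real.exp 1), this, Real.sqrt_div' _ (by positivity), Real.sqrt_sq (by positivity)]
  ring

/-! ### Fredholm minors -/

section Fredholm

variable {E : Type*} {ι : Type*} {m : ℕ}

/-- The rows of the Fredholm matrix that are indexed by `ι`. -/
abbrev Rows (ι E : Type*) : Type _ := ι → (ι → ℂ) × (E → ℂ)

/-- The row of kernel values at `x`. -/
def kerRow (J : E → E → ℂ) (y : ι → E) (x : E) : (ι → ℂ) × (E → ℂ) := (fun j => J x (y j), J x)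

/-- The matrix with the rows `R` on top, and the kernel rows at the points `z` below. -/
def bMat (J : E → E → ℂ) (R : Rows ι E) (y : ι → E) (z : Fin m → E) :
    Matrix (ι ⊕ Fin m) (ι ⊕ Fin m) ℂ :=
  Matrix.fromBlocks (Matrix.of fun i j => (R i).1 j) (Matrix.of fun i l => (R i).2 (z l))
    (Matrix.of fun l j => J (z l) (y j)) (Matrix.of fun l l' => J (z l) (z l'))

variable [DecidableEq ι]

lemma bMat_update (J : E → E → ℂ) (R : Rows ι E) (y : ι → E) (z : Fin m → E) (i : ι)
    (q : (ι → ℂ) × (E → ℂ)) :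
    bMat J (Function.update R i q) y z
      = (bMat J R y z).updateRow (Sum.inl i) (Sum.elim q.1 fun l => q.2 (z l)) := by
  ext a b
  rcases a with a | a
  · by_cases h : a = i
    · subst h
      rcases b with b | b <;> simp [bMat]
    · rcases b with b | b <;> simp [bMat, h]
  · rcases b with b | b <;> simp [bMat]

variable [Fintype ι]

/-- Exchange rows i and l. The unit vector then sits in row l, so striking out row and column l
leaves a matrix without the point `w`, whose row i has become the kernel row at `w`. The exchange
supplies the sign. -/
lemma det_bMat_single_inr (J : E → E → ℂ) (R : Rows ι E) (y : ι → E) (i : ι) (l : Fin (m + 1))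
    (w : E) (z : Fin m → E) :
    ((bMat J R y (l.insertNth w z : Fin (m + 1) → E)).updateRow (Sum.inl i)
        (Pi.single (Sum.inr l) 1)).det
      = -(bMat J (Function.update R i (kerRow J y w)) y z).det := by
  set M := (bMat J R y (l.insertNth w z : Fin (m + 1) → E)).updateRow (Sum.inl i)
        (Pi.single (Sum.inr l) 1) with hM
  set σ : Equiv.Perm (ι ⊕ Fin (m + 1)) := Equiv.swap (Sum.inl i) (Sum.inr l) with hσ
  have h1 : (M.submatrix σ id).det = -M.det := by
    rw [Matrix.det_permute, hσ, Equiv.Perm.sign_swap (by simp)]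
    simp
  set e : (ι ⊕ Fin m) ⊕ Unit ≃ ι ⊕ Fin (m + 1) :=
    (Equiv.sumAssoc ι (Fin m) Unit).trans (Equiv.sumCongr (Equiv.refl ι)
      ((Equiv.optionEquivSumPUnit (Fin m)).symm.trans (finSuccEquiv' l).symm)) with he
  have e1 : ∀ a : ι, e (Sum.inl (Sum.inl a)) = Sum.inl a := fun a => by simp [he]
  have e2 : ∀ k : Fin m, e (Sum.inl (Sum.inr k)) = Sum.inr (l.succAbove k) := fun k => by
    simp [he]
  have e3 : e (Sum.inr ()) = Sum.inr l := by simp [he]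
  have s1 : σ (Sum.inl i) = Sum.inr l := Equiv.swap_apply_left _ _
  have s2 : σ (Sum.inr l) = Sum.inl i := Equiv.swap_apply_right _ _
  have s3 : ∀ a, a ≠ i → σ (Sum.inl a) = Sum.inl a := fun a h =>
    Equiv.swap_apply_of_ne_of_ne (by simpa using h) (by simp)
  have s4 : ∀ k, σ (Sum.inr (l.succAbove k)) = Sum.inr (l.succAbove k) := fun k =>
    Equiv.swap_apply_of_ne_of_ne (by simp) (by simp [Fin.succAbove_ne])
  have h2 : (M.submatrix σ id).submatrix e e = Matrix.fromBlocks
      (bMat J (Function.update R i (kerRow J y w)) y z)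
      (Matrix.of fun a _ => M (σ (e (Sum.inl a))) (Sum.inr l)) 0 1 := by
    ext a b
    rcases a with a | a
    · rcases b with b | b
      · rw [bMat_update]
        rcases a with a | a
        · by_cases h : a = i
          · subst h
            rcases b with b | b <;>
              simp [e1, e2, s1, hM, bMat, kerRow, Matrix.updateRow_apply]
          · rcases b with b | b <;>
              simp [e1, e2, s3 a h, hM, bMat, Matrix.updateRow_apply, h]
        · rcases b with b | b <;>
            simp [e1, e2, s4, hM, bMat, Matrix.updateRow_apply]
      · simp [e3]
    · rcases b with (b | b) | b <;>
        simp [e1, e2, e3, s2, hM, Fin.succAbove_ne]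
  have h3 := congrArg Matrix.det h2
  rw [Matrix.det_submatrix_equiv_self, h1, Matrix.det_fromBlocks_zero₂₁, Matrix.det_one,
    mul_one] at h3
  rw [← h3, neg_neg]

/-- Laplace expansion along row i, with cofactors written as determinants. The columns y_j produce
constant rows; the columns z_l produce the shape treated in `det_bMat_single_inr`. -/
lemma det_bMat_expand (J : E → E → ℂ) (R : Rows ι E) (y : ι → E) (z : Fin m → E) (i : ι) :
    (bMat J R y z).det
      = ∑ j, (R i).1 j * (bMat J (Function.update R i (Pi.single j 1, 0)) y z).det
        + ∑ l, (R i).2 (z l) *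
          ((bMat J R y z).updateRow (Sum.inl i) (Pi.single (Sum.inr l) 1)).det := by
  rw [Matrix.det_eq_sum_mul_adjugate_row _ (Sum.inl i), Fintype.sum_sum_type]
  congr 1
  · refine Finset.sum_congr rfl fun j _ => ?_
    rw [Matrix.adjugate_apply, bMat_update]
    congr 3
    ext b
    rcases b with b | b <;> simp [Pi.single_apply]
  · refine Finset.sum_congr rfl fun l _ => ?_
    rw [Matrix.adjugate_apply]
    rfl

/-- The kernel `J` is dominated by the product `s ⊗ s` of a square integrable function. -/
structure IsDominated [MeasureSpace E] (J : E → E → ℂ) (s : E → ℝ) : Prop where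
  measurable_kernel : Measurable (Function.uncurry J)
  measurable_bound : Measurable s
  nonneg : ∀ x, 0 ≤ s x
  norm_le : ∀ x y, ‖J x y‖ ≤ s x * s y
  integrable_sq : Integrable fun x => s x ^ 2

/-- The rows `R` are dominated by `a`. -/
structure RowsLe [MeasureSpace E] (s : E → ℝ) (y : ι → E) (R : Rows ι E) (a : ι → ℝ) : Prop where
  measurable : ∀ i, Measurable (R i).2
  nonneg : ∀ i, 0 ≤ a i
  norm_fst_le : ∀ i j, ‖(R i).1 j‖ ≤ a i * (1 + s (y j))
  norm_snd_le : ∀ i w, ‖(R i).2 w‖ ≤ a i * s w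

variable [MeasureSpace E] {J : E → E → ℂ} {s : E → ℝ} {y : ι → E} {R : Rows ι E} {a : ι → ℝ}

omit [Fintype ι] in
lemma RowsLe.update (h : RowsLe s y R a) (i : ι) (q : (ι → ℂ) × (E → ℂ)) (c : ℝ) (hc : 0 ≤ c)
    (hm : Measurable q.2) (h1 : ∀ j, ‖q.1 j‖ ≤ c * (1 + s (y j))) (h2 : ∀ w, ‖q.2 w‖ ≤ c * s w) :
    RowsLe s y (Function.update R i q) (Function.update a i c) := by
  constructor <;> intro k <;> by_cases hk : k = i
  · subst hk; simpa using hm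
  · simpa [hk] using h.measurable k
  · subst hk; simpa using hc
  · simpa [hk] using h.nonneg k
  · subst hk; simpa using h1
  · simpa [hk] using h.norm_fst_le k
  · subst hk; simpa using h2
  · simpa [hk] using h.norm_snd_le k

omit [Fintype ι] in
lemma RowsLe.update_kerRow (hJ : IsDominated J s) (h : RowsLe s y R a) (i : ι) (x : E) :
    RowsLe s y (Function.update R i (kerRow J y x)) (Function.update a i (s x)) := by
  refine h.update i _ _ (hJ.nonneg x) ?_ (fun j => ?_) fun w => hJ.norm_le x w
  · exact hJ.measurable_kernel.comp measurable_prodMk_left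
  · refine (hJ.norm_le x (y j)).trans ?_
    have := hJ.nonneg x
    gcongr
    linarith

/-- These rows are the reason for the summand 1 in the bound `1 + s (y j)`: a constant entry need
not be dominated by `s (y j)`, which may vanish. -/
lemma RowsLe.update_const (hJ : IsDominated J s) (h : RowsLe s y R a) (i : ι) (v : ι → ℂ) :
    RowsLe s y (Function.update R i (v, 0)) (Function.update a i (∑ j, ‖v j‖)) := by
  have h0 : 0 ≤ ∑ j, ‖v j‖ := Finset.sum_nonneg fun j _ => norm_nonneg _
  refine h.update i _ _ h0 measurable_zero (fun j => ?_) fun w => ?_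
  · have h1 : ‖v j‖ ≤ ∑ j, ‖v j‖ :=
      Finset.single_le_sum (f := fun j => ‖v j‖) (fun j _ => norm_nonneg _) (Finset.mem_univ j)
    have := hJ.nonneg (y j)
    change ‖v j‖ ≤ _
    nlinarith
  · simpa using mul_nonneg h0 (hJ.nonneg w)

/-- The constant in the bound for the Fredholm minors. -/
def rowConst (s : E → ℝ) (y : ι → E) (a : ι → ℝ) : ℝ := (∏ i, a i) * ∏ j, (1 + s (y j))

/-- Hadamard's inequality with weights. Each z_l indexes one row and one column, hence the
integrable factor s(z_l)². -/
lemma norm_det_bMat_le (hJ : IsDominated J s) (h : RowsLe s y R a) (z : Fin m → E) :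
    ‖(bMat J R y z).det‖ ≤ √(((Fintype.card ι + m : ℕ) : ℝ) ^ (Fintype.card ι + m))
      * rowConst s y a * ∏ l, s (z l) ^ 2 := by
  have := norm_det_le (bMat J R y z) (Sum.elim a fun l => s (z l))
    (Sum.elim (fun j => 1 + s (y j)) fun l => s (z l)) ?_ ?_ ?_
  · refine this.trans (le_of_eq ?_)
    simp only [Fintype.card_sum, Fintype.card_fin, Fintype.prod_sum_type, Sum.elim_inl,
      Sum.elim_inr, rowConst, sq, Finset.prod_mul_distrib]
    ring
  · rintro (i | l)
    · exact h.nonneg i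
    · exact hJ.nonneg _
  · rintro (i | l)
    · have := hJ.nonneg (y i)
      simp only [Sum.elim_inl]
      linarith
    · exact hJ.nonneg _
  · rintro (i | l) (j | l')
    · exact h.norm_fst_le i j
    · exact h.norm_snd_le i _
    · refine (hJ.norm_le _ _).trans ?_
      have := hJ.nonneg (z l)
      simp only [Sum.elim_inl, Sum.elim_inr]
      gcongr
      linarith
    · exact hJ.norm_le _ _

lemma measurable_det_bMat (hJ : IsDominated J s) (h : RowsLe s y R a) :
    Measurable fun z : Fin m → E => (bMat J R y z).det := by
  refine measurable_det _ fun a b => ?_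
  rcases a with a | a <;> rcases b with b | b
  · exact measurable_const
  · exact (h.measurable a).comp (measurable_pi_apply b)
  · have h1 : Measurable fun z : Fin m → E => (z a, y b) :=
      (measurable_pi_apply a).prodMk measurable_const
    exact hJ.measurable_kernel.comp h1
  · have h1 : Measurable fun z : Fin m → E => (z a, z b) :=
      (measurable_pi_apply a).prodMk (measurable_pi_apply b)
    exact hJ.measurable_kernel.comp h1

end Fredholm

/-! ### Fredholm series and their integral equation -/

section FredholmSeries

variable {E : Type*} {ι : Type*} {m : ℕ} [DecidableEq ι] [Fintype ι] [MeasureSpace E]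
  {J : E → E → ℂ} {s : E → ℝ} {y : ι → E} {R : Rows ι E} {a : ι → ℝ}

omit [DecidableEq ι] in
lemma rowConst_nonneg (hJ : IsDominated J s) (h : RowsLe s y R a) : 0 ≤ rowConst s y a :=
  mul_nonneg (Finset.prod_nonneg fun i _ => h.nonneg i)
    (Finset.prod_nonneg fun j _ => by have := hJ.nonneg (y j); linarith)

omit [MeasureSpace E] in
-- With c = s(w) this isolates the dependence of the bound on the point w whose kernel row is
-- inserted.
lemma rowConst_update (i : ι) (c : ℝ) :
    rowConst s y (Function.update a i c) = c * rowConst s y (Function.update a i 1) := by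
  simp only [rowConst, Finset.prod_update_of_mem (Finset.mem_univ i)]
  ring

omit [DecidableEq ι] [Fintype ι] in
lemma IsDominated.measurable_comp {β : Type*} [MeasurableSpace β] (hJ : IsDominated J s)
    {f g : β → E} (hf : Measurable f) (hg : Measurable g) : Measurable fun w => J (f w) (g w) :=
  hJ.measurable_kernel.comp (hf.prodMk hg)

lemma measurable_det_bMat_kerRow (hJ : IsDominated J s) (h : RowsLe s y R a) (i : ι) :
    Measurable fun p : E × (Fin m → E) =>
      (bMat J (Function.update R i (kerRow J y p.1)) y p.2).det := by
  refine measurable_det _ fun b c => ?_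
  simp only [bMat_update]
  rcases b with b | b <;> rcases c with c | c
  · by_cases hb : b = i
    · subst hb
      simpa [kerRow] using hJ.measurable_comp measurable_fst measurable_const
    · simp [bMat, hb]
  · by_cases hb : b = i
    · subst hb
      simpa [kerRow] using hJ.measurable_comp (f := Prod.fst) (g := fun p : E × (Fin m → E) => p.2 c)
        (by fun_prop) (by fun_prop)
    · have h1 := h.measurable b
      simpa [bMat, hb] using (show Measurable fun p : E × (Fin m → E) => (R b).2 (p.2 c) by fun_prop)
  · simpa [bMat] using hJ.measurable_comp (f := fun p : E × (Fin m → E) => p.2 b)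
      (g := fun _ => y c) (by fun_prop) (by fun_prop)
  · simpa [bMat] using hJ.measurable_comp (f := fun p : E × (Fin m → E) => p.2 b)
      (g := fun p : E × (Fin m → E) => p.2 c) (by fun_prop) (by fun_prop)

variable [SigmaFinite (volume : Measure E)]

lemma integrable_prod_sq (hJ : IsDominated J s) :
    Integrable fun z : Fin m → E => ∏ l, s (z l) ^ 2 :=
  Integrable.fintype_prod fun _ => hJ.integrable_sq

lemma integrable_det_bMat (hJ : IsDominated J s) (h : RowsLe s y R a) :
    Integrable fun z : Fin m → E => (bMat J R y z).det :=
  ((integrable_prod_sq hJ).const_mul _).mono' (measurable_det_bMat hJ h).aestronglyMeasurable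
    (Eventually.of_forall fun z => norm_det_bMat_le hJ h z)

/-- A term of the Fredholm series, up to the factorial. -/
def fredholmTerm (J : E → E → ℂ) (y : ι → E) (m : ℕ) (R : Rows ι E) : ℂ :=
  ∫ z : Fin m → E, (bMat J R y z).det

/-- The Fredholm minor with the rows `R`. -/
def fredholmMinor (J : E → E → ℂ) (y : ι → E) (R : Rows ι E) : ℂ :=
  ∑' m : ℕ, (m ! : ℂ)⁻¹ * fredholmTerm J y m R

/-- The majorant of the Fredholm series. -/
def fredholmBound (s : E → ℝ) (n m : ℕ) : ℝ :=
  √(((n + m : ℕ) : ℝ) ^ (n + m)) * ((∫ x, s x ^ 2) ^ m / m !)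

omit [SigmaFinite (volume : Measure E)] in
lemma summable_fredholmBound (n : ℕ) : Summable (fredholmBound s n) :=
  summable_sqrt_pow_self n _ (integral_nonneg fun _ => sq_nonneg _)

lemma norm_fredholmTerm_le (hJ : IsDominated J s) (h : RowsLe s y R a) :
    ‖(m ! : ℂ)⁻¹ * fredholmTerm J y m R‖
      ≤ rowConst s y a * fredholmBound s (Fintype.card ι) m := by
  have h1 : ‖fredholmTerm J y m R‖ ≤ √(((Fintype.card ι + m : ℕ) : ℝ) ^ (Fintype.card ι + m))
      * rowConst s y a * (∫ x, s x ^ 2) ^ m := by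
    refine (norm_integral_le_of_norm_le ((integrable_prod_sq hJ).const_mul _)
      (Eventually.of_forall fun z => norm_det_bMat_le hJ h z)).trans (le_of_eq ?_)
    rw [integral_const_mul]
    congr 1
    rw [volume_pi, integral_fintype_prod_eq_pow (ι := Fin m) (fun x => s x ^ 2), Fintype.card_fin]
  rw [norm_mul, norm_inv, Complex.norm_natCast]
  calc _ ≤ (m ! : ℝ)⁻¹ * (√(((Fintype.card ι + m : ℕ) : ℝ) ^ (Fintype.card ι + m))
      * rowConst s y a * (∫ x, s x ^ 2) ^ m) := by gcongr
    _ = _ := by unfold fredholmBound; ring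

lemma summable_fredholmTerm (hJ : IsDominated J s) (h : RowsLe s y R a) :
    Summable fun m : ℕ => (m ! : ℂ)⁻¹ * fredholmTerm J y m R :=
  Summable.of_norm_bounded ((summable_fredholmBound _).mul_left _)
    fun _ => norm_fredholmTerm_le hJ h

lemma norm_fredholmMinor_le (hJ : IsDominated J s) (h : RowsLe s y R a) :
    ‖fredholmMinor J y R‖ ≤ rowConst s y a * ∑' m, fredholmBound s (Fintype.card ι) m := by
  rw [← tsum_mul_left]
  exact tsum_of_norm_bounded ((summable_fredholmBound _).mul_left _).hasSum
    fun _ => norm_fredholmTerm_le hJ h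

lemma measurable_fredholmTerm_kerRow (hJ : IsDominated J s) (h : RowsLe s y R a) (i : ι) :
    Measurable fun w : E => fredholmTerm J y m (Function.update R i (kerRow J y w)) :=
  ((measurable_det_bMat_kerRow hJ h i).stronglyMeasurable.integral_prod_right).measurable

lemma measurable_fredholmMinor_kerRow (hJ : IsDominated J s) (h : RowsLe s y R a) (i : ι) :
    Measurable fun w : E => fredholmMinor J y (Function.update R i (kerRow J y w)) := by
  refine measurable_of_tendsto_metrizable (f := fun (N : ℕ) (w : E) => ∑ m ∈ Finset.range N,
    (m ! : ℂ)⁻¹ * fredholmTerm J y m (Function.update R i (kerRow J y w))) (fun N => ?_) ?_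
  · exact Finset.measurable_sum _ fun m _ => (measurable_fredholmTerm_kerRow hJ h i).const_mul _
  · rw [tendsto_pi_nhds]
    exact fun w => (summable_fredholmTerm hJ (h.update_kerRow hJ i w)).hasSum.tendsto_sum_nat

/-- Integrate `det_bMat_expand`. Each of the m + 1 columns z_l contributes equally, by Fubini with
z_l separated as w; the factor m + 1 turns 1/(m+1)! into 1/m! in the series. -/
lemma fredholmTerm_succ (hJ : IsDominated J s) (h : RowsLe s y R a) (i : ι) :
    fredholmTerm J y (m + 1) R
      = ∑ j, (R i).1 j * fredholmTerm J y (m + 1) (Function.update R i (Pi.single j 1, 0))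
        - (m + 1) * ∫ w, (R i).2 w * fredholmTerm J y m (Function.update R i (kerRow J y w)) := by
  set G : E × (Fin m → E) → ℂ := fun p =>
    (R i).2 p.1 * (bMat J (Function.update R i (kerRow J y p.1)) y p.2).det with hG
  have hGi : Integrable G (volume.prod volume) := by
    have hb : Integrable (fun p : E × (Fin m → E) => (a i * (√(((Fintype.card ι + m : ℕ) : ℝ) ^
        (Fintype.card ι + m)) * rowConst s y (Function.update a i 1))) *
          (s p.1 ^ 2 * ∏ l, s (p.2 l) ^ 2)) (volume.prod volume) :=
      (hJ.integrable_sq.mul_prod (integrable_prod_sq hJ)).const_mul _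
    refine hb.mono' (((h.measurable i).comp measurable_fst).mul
      (measurable_det_bMat_kerRow hJ h i)).aestronglyMeasurable (Eventually.of_forall fun p => ?_)
    rw [hG, norm_mul]
    have h1 := h.norm_snd_le i p.1
    have h2 := norm_det_bMat_le hJ (h.update_kerRow hJ i p.1) p.2
    rw [rowConst_update] at h2
    refine (mul_le_mul h1 h2 (norm_nonneg _) (mul_nonneg (h.nonneg i) (hJ.nonneg _))).trans
      (le_of_eq ?_)
    ring
  have hF : ∀ l : Fin (m + 1), (fun z : Fin (m + 1) → E => (R i).2 (z l) *
      ((bMat J R y z).updateRow (Sum.inl i) (Pi.single (Sum.inr l) 1)).det)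
        = fun z => -G (MeasurableEquiv.piFinSuccAbove (fun _ => E) l z) := by
    intro l
    funext z
    have hz : z = (l.insertNth (z l) (l.removeNth z) : Fin (m + 1) → E) :=
      (Fin.insertNth_self_removeNth l z).symm
    have := det_bMat_single_inr J R y i l (z l) (l.removeNth z)
    rw [← hz] at this
    rw [this, mul_neg]
    rfl
  have hFi : ∀ l : Fin (m + 1), Integrable fun z : Fin (m + 1) → E => (R i).2 (z l) *
      ((bMat J R y z).updateRow (Sum.inl i) (Pi.single (Sum.inr l) 1)).det := by
    intro l
    rw [hF l]
    exact ((volume_preserving_piFinSuccAbove (fun _ => E) l).integrable_comp_emb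
      (MeasurableEquiv.measurableEmbedding _)|>.2 hGi).neg
  have hFv : ∀ l : Fin (m + 1), ∫ z : Fin (m + 1) → E, (R i).2 (z l) *
      ((bMat J R y z).updateRow (Sum.inl i) (Pi.single (Sum.inr l) 1)).det
        = -∫ w, (R i).2 w * fredholmTerm J y m (Function.update R i (kerRow J y w)) := by
    intro l
    rw [hF l, integral_neg, (volume_preserving_piFinSuccAbove (fun _ => E) l).integral_comp
      (MeasurableEquiv.measurableEmbedding _), Measure.volume_eq_prod, integral_prod _ hGi]
    simp only [hG, integral_const_mul]
    rfl
  have hRi : ∀ j, Integrable fun z : Fin (m + 1) → E =>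
      (R i).1 j * (bMat J (Function.update R i (Pi.single j 1, 0)) y z).det := fun j =>
    (integrable_det_bMat hJ (h.update_const hJ i _)).const_mul _
  unfold fredholmTerm at hFv ⊢
  rw [integral_congr_ae (Eventually.of_forall fun z => det_bMat_expand J R y z i),
    integral_add (integrable_finsetSum _ fun j _ => hRi j)
      (integrable_finsetSum _ fun l _ => hFi l),
    integral_finsetSum _ fun j _ => hRi j, integral_finsetSum _ fun l _ => hFi l]
  simp only [hFv, integral_const_mul, Finset.sum_const, Finset.card_univ, Fintype.card_fin]
  simp only [nsmul_eq_mul]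
  push_cast
  ring

lemma fredholmTerm_zero (hJ : IsDominated J s) (h : RowsLe s y R a) (i : ι) :
    fredholmTerm J y 0 R
      = ∑ j, (R i).1 j * fredholmTerm J y 0 (Function.update R i (Pi.single j 1, 0)) := by
  unfold fredholmTerm
  simp_rw [← integral_const_mul]
  rw [← integral_finsetSum _ fun j _ =>
    (integrable_det_bMat hJ (h.update_const hJ i _)).const_mul _]
  simp [det_bMat_expand J R y _ i]

/-- Fredholm's integral equation: `fredholmTerm_succ` summed over m. The majorant `fredholmBound`
allows the sum and the integral over w to be exchanged. -/
lemma fredholmMinor_expand (hJ : IsDominated J s) (h : RowsLe s y R a) (i : ι) :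
    fredholmMinor J y R
      = ∑ j, (R i).1 j * fredholmMinor J y (Function.update R i (Pi.single j 1, 0))
        - ∫ w, (R i).2 w * fredholmMinor J y (Function.update R i (kerRow J y w)) := by
  set n := Fintype.card ι
  set c := rowConst s y (Function.update a i 1)
  have hc : 0 ≤ c := rowConst_nonneg hJ (by
    have := h.update_const (R := R) hJ i 0
    exact h.update i 0 1 zero_le_one measurable_zero
      (fun j => by have := hJ.nonneg (y j); simpa using by linarith)
      (fun w => by simpa using hJ.nonneg w))
  set u : ℕ → E → ℂ := fun m w =>
    (R i).2 w * ((m ! : ℂ)⁻¹ * fredholmTerm J y m (Function.update R i (kerRow J y w))) with hu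
  have hub : ∀ m w, ‖u m w‖ ≤ a i * c * fredholmBound s n m * s w ^ 2 := by
    intro m w
    rw [hu, norm_mul]
    have h1 := h.norm_snd_le i w
    have h2 := norm_fredholmTerm_le (m := m) hJ (h.update_kerRow hJ i w)
    rw [rowConst_update] at h2
    refine (mul_le_mul h1 h2 (norm_nonneg _) (mul_nonneg (h.nonneg i) (hJ.nonneg _))).trans
      (le_of_eq ?_)
    ring
  have hui : ∀ m, Integrable (u m) := fun m =>
    (hJ.integrable_sq.const_mul _).mono' ((h.measurable i).mul
      ((measurable_fredholmTerm_kerRow hJ h i).const_mul _)).aestronglyMeasurable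
      (Eventually.of_forall (hub m))
  have hus : Summable fun m => ∫ w, ‖u m w‖ := by
    refine Summable.of_nonneg_of_le (fun m => integral_nonneg fun w => norm_nonneg _)
      (fun m => integral_mono (hui m).norm (hJ.integrable_sq.const_mul _) (hub m)) ?_
    simp_rw [integral_const_mul]
    exact ((summable_fredholmBound n).mul_left _).mul_right _
  have hsum := hasSum_integral_of_summable_integral_norm hui hus
  have hI : ∫ w, ∑' m, u m w
      = ∫ w, (R i).2 w * fredholmMinor J y (Function.update R i (kerRow J y w)) := by
    simp only [hu, tsum_mul_left, fredholmMinor]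
  rw [hI] at hsum
  have hterm : ∀ m, (((m + 1)! : ℕ) : ℂ)⁻¹ * fredholmTerm J y (m + 1) R
      = ∑ j, (R i).1 j * ((((m + 1)! : ℕ) : ℂ)⁻¹ *
          fredholmTerm J y (m + 1) (Function.update R i (Pi.single j 1, 0))) - ∫ w, u m w := by
    intro m
    rw [fredholmTerm_succ hJ h i, mul_sub, Finset.mul_sum]
    congr 1
    · exact Finset.sum_congr rfl fun j _ => by ring
    · have : u m = fun w => (m ! : ℂ)⁻¹ *
          ((R i).2 w * fredholmTerm J y m (Function.update R i (kerRow J y w))) := by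
        funext w; simp only [hu]; ring
      rw [this, integral_const_mul, Nat.factorial_succ]
      push_cast
      have h1 : ((m : ℂ) + 1) ≠ 0 := by exact_mod_cast Nat.succ_ne_zero m
      field_simp
  have hj : ∀ j, Summable fun m : ℕ => (R i).1 j * ((m ! : ℂ)⁻¹ *
      fredholmTerm J y m (Function.update R i (Pi.single j 1, 0))) := fun j =>
    (summable_fredholmTerm hJ (h.update_const hJ i _)).mul_left _
  have hS : HasSum (fun m : ℕ => (m ! : ℂ)⁻¹ * fredholmTerm J y m R)
      (∑ j, (R i).1 j * fredholmMinor J y (Function.update R i (Pi.single j 1, 0))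
        - ∫ w, (R i).2 w * fredholmMinor J y (Function.update R i (kerRow J y w))) := by
    have h1 : HasSum (fun m : ℕ => ∑ j, (R i).1 j * ((m ! : ℂ)⁻¹ *
        fredholmTerm J y m (Function.update R i (Pi.single j 1, 0))))
        (∑ j, (R i).1 j * fredholmMinor J y (Function.update R i (Pi.single j 1, 0))) := by
      refine hasSum_sum fun j _ => ?_
      exact (summable_fredholmTerm hJ (h.update_const hJ i _)).hasSum.mul_left _
    -- Shift by one: the integral with m points comes from the term with m + 1, while the term with
    -- no points has constant rows only.
    rw [← hasSum_nat_add_iff' 1] at h1 ⊢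
    simp only [hterm]
    have h2 := h1.sub hsum
    convert h2 using 1
    rw [Finset.sum_range_one, Finset.sum_range_one, fredholmTerm_zero hJ h i, Finset.mul_sum,
      sub_right_comm]
    congr 2
    exact Finset.sum_congr rfl fun j _ => by ring
  exact hS.tsum_eq

end FredholmSeries

/-! ### Positive operators -/

section Operators

variable {H : Type*} [NormedAddCommGroup H] [InnerProductSpace ℂ H] [CompleteSpace H]
  {T : H →L[ℂ] H}

omit [CompleteSpace H] in
lemma isPositive_of_inner_nonneg (h : ∀ x, 0 ≤ inner ℂ (T x) x) : T.IsPositive := by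
  rw [ContinuousLinearMap.isPositive_iff_complex]
  intro x
  have h1 := Complex.nonneg_iff.1 (h x)
  exact ⟨Complex.ext (by simp) (by simpa using h1.2), h1.1⟩

omit [CompleteSpace H] in
lemma inner_self_nonneg_complex (x : H) : 0 ≤ inner ℂ x x := by
  rw [inner_self_eq_norm_sq_to_K]
  simp

lemma isUnit_one_add (hT : T.IsPositive) : IsUnit (1 + T) := by
  have h0 : 0 ≤ T := (ContinuousLinearMap.nonneg_iff_isPositive T).2 hT
  exact CStarAlgebra.isUnit_of_le 1 (le_add_of_nonneg_right h0)

lemma one_add_mul_inverse (hT : T.IsPositive) : (1 + T) * Ring.inverse (1 + T) = 1 :=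
  Ring.mul_inverse_cancel _ (isUnit_one_add hT)

lemma inverse_mul_one_add (hT : T.IsPositive) : Ring.inverse (1 + T) * (1 + T) = 1 :=
  Ring.inverse_mul_cancel _ (isUnit_one_add hT)

lemma commute_inverse_one_add (hT : T.IsPositive) : Commute (Ring.inverse (1 + T)) T := by
  have h1 := one_add_mul_inverse hT
  have h2 := inverse_mul_one_add hT
  rw [add_mul, one_mul] at h1
  rw [mul_add, mul_one] at h2
  exact add_left_cancel (h2.trans h1.symm)

/-- With S the inverse, x = Sx + TSx, so ⟨Sx, x⟩ = ‖Sx‖² + ⟨Sx, TSx⟩. -/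
lemma isPositive_inverse_one_add (hT : T.IsPositive) : (Ring.inverse (1 + T)).IsPositive := by
  refine isPositive_of_inner_nonneg fun x => ?_
  set S := Ring.inverse (1 + T)
  have hx : x = S x + T (S x) := by
    have := congrArg (fun A : H →L[ℂ] H => A x) (one_add_mul_inverse hT)
    simpa using this.symm
  nth_rewrite 2 [hx]
  rw [inner_add_right]
  exact add_nonneg (inner_self_nonneg_complex _) (hT.inner_nonneg_right _)

/-- With S the inverse, this is TS = T − TST. It suggests the formula for `resKernel`: T has kernel
J, and TST has kernel ⟨J(·,x), S J(·,y)⟩. -/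
lemma mul_inverse_one_add (hT : T.IsPositive) :
    T * Ring.inverse (1 + T) = T - T * Ring.inverse (1 + T) * T := by
  have h2 := inverse_mul_one_add hT
  rw [mul_add, mul_one] at h2
  rw [mul_assoc, eq_sub_of_add_eq' h2, mul_sub, mul_one, sub_sub_cancel]

lemma isPositive_mul_inverse_one_add (hT : T.IsPositive) :
    (T * Ring.inverse (1 + T)).IsPositive := by
  refine isPositive_of_inner_nonneg fun x => ?_
  set S := Ring.inverse (1 + T)
  have hx : x = S x + T (S x) := by
    have := congrArg (fun A : H →L[ℂ] H => A x) (one_add_mul_inverse hT)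
    simpa using this.symm
  nth_rewrite 2 [hx]
  rw [inner_add_right]
  exact add_nonneg (hT.inner_nonneg_left _) (inner_self_nonneg_complex _)

/-- The root A lets the diagonal elements of TST be written as ‖T A b_i‖². It commutes with T
because it belongs to the functional calculus of S. -/
lemma exists_sqrt_inverse_one_add (hT : T.IsPositive) :
    ∃ A : H →L[ℂ] H, A.IsPositive ∧ A * A = Ring.inverse (1 + T) ∧ Commute A T := by
  have hS0 : 0 ≤ Ring.inverse (1 + T) :=
    (ContinuousLinearMap.nonneg_iff_isPositive _).2 (isPositive_inverse_one_add hT)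
  exact ⟨CFC.sqrt (Ring.inverse (1 + T)),
    (ContinuousLinearMap.nonneg_iff_isPositive _).1 (CFC.sqrt_nonneg _),
    CFC.sqrt_mul_sqrt_self _, (commute_inverse_one_add hT).cfcₙ_nnreal _⟩

omit [CompleteSpace H] in
-- Basis vectors lie at distance √2, so balls of radius 1/2 around them are disjoint. Countability
-- is what permits sums over a basis to be exchanged with integrals and with null sets.
lemma _root_.HilbertBasis.countable [TopologicalSpace.SeparableSpace H] {κ : Type*}
    (b : HilbertBasis κ ℂ H) : Countable κ := by
  refine Pairwise.countable_of_isOpen_disjoint (s := fun i => Metric.ball (b i) (1 / 2)) ?_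
    (fun i => Metric.isOpen_ball) fun i => ⟨b i, Metric.mem_ball_self (by norm_num)⟩
  intro i j hij
  refine Metric.ball_disjoint_ball ?_
  have h1 : ‖b i - b j‖ ^ 2 = 2 := by
    rw [@norm_sub_sq ℂ, b.orthonormal.2 hij, b.orthonormal.1, b.orthonormal.1]
    norm_num
  rw [dist_eq_norm]
  nlinarith [norm_nonneg (b i - b j)]

omit [CompleteSpace H] in
lemma hasSum_norm_inner_sq {κ : Type*} (b : HilbertBasis κ ℂ H) (x : H) :
    HasSum (fun i => ‖inner ℂ (b i) x‖ ^ 2) (‖x‖ ^ 2) := by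
  have h := b.hasSum_inner_mul_inner x x
  rw [inner_self_eq_norm_sq_to_K] at h
  have h1 : (fun i => inner ℂ x (b i) * inner ℂ (b i) x)
      = fun i => ((‖inner ℂ (b i) x‖ ^ 2 : ℝ) : ℂ) := by
    funext i
    rw [← inner_conj_symm, Complex.conj_mul']
    simp
  rw [h1] at h
  have h2 : ((‖x‖ : ℂ)) ^ 2 = ((‖x‖ ^ 2 : ℝ) : ℂ) := by simp
  exact Complex.hasSum_ofReal.1 (by simpa using h)

end Operators

/-! ### Kernel functions -/

section Kernels

variable {d : ℕ} {T : L2 d →L[ℂ] L2 d} {J : Pt d → Pt d → ℂ}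

instance : TopologicalSpace.SeparableSpace (L2 d) := by
  have : Fact ((2 : ℝ≥0∞) ≠ ∞) := ⟨by norm_num⟩
  have : SecondCountableTopology (L2 d) := inferInstance
  infer_instance

namespace IsTraceClassKernel

lemma posSemidef_of (hJ : IsTraceClassKernel T J) {κ : Type*} [Fintype κ] (x : κ → Pt d) :
    (Matrix.of fun i j => J (x i) (x j)).PosSemidef := by
  have h := (hJ.posSemidef _ (fun i => x ((Fintype.equivFin κ).symm i))).submatrix
    (Fintype.equivFin κ)
  convert h using 1
  ext i j
  simp

lemma conj_symm (hJ : IsTraceClassKernel T J) (x y : Pt d) : star (J x y) = J y x :=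
  (hJ.posSemidef_of ![x, y]).1.apply 1 0

lemma diag_nonneg (hJ : IsTraceClassKernel T J) (x : Pt d) : 0 ≤ J x x :=
  (hJ.posSemidef_of ![x]).diag_nonneg (i := 0)

lemma diag_eq (hJ : IsTraceClassKernel T J) (x : Pt d) : J x x = ((J x x).re : ℂ) :=
  Complex.ext (by simp) (by simpa using (Complex.nonneg_iff.1 (hJ.diag_nonneg x)).2.symm)

end IsTraceClassKernel

/-- The square root of the kernel on the diagonal. -/
def diagSqrt (J : Pt d → Pt d → ℂ) (x : Pt d) : ℝ := √(J x x).re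

lemma diagSqrt_sq (hJ : IsTraceClassKernel T J) (x : Pt d) : diagSqrt J x ^ 2 = (J x x).re :=
  Real.sq_sqrt (Complex.nonneg_iff.1 (hJ.diag_nonneg x)).1

/-- The 2 × 2 minors give |J(x,y)|² ≤ J(x,x) J(y,y); square integrability of the bound is
integrability of J on the diagonal. -/
lemma IsTraceClassKernel.isDominated (hJ : IsTraceClassKernel T J) :
    IsDominated J (diagSqrt J) where
  measurable_kernel := hJ.measurable
  measurable_bound := by
    have : Measurable fun x => J x x := hJ.measurable.comp (measurable_id.prodMk measurable_id)
    exact (Complex.measurable_re.comp this).sqrt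
  nonneg x := Real.sqrt_nonneg _
  norm_le x y := by
    have h := (hJ.posSemidef_of ![x, y]).det_nonneg
    rw [Matrix.det_fin_two] at h
    simp only [Matrix.of_apply, Matrix.cons_val_zero, Matrix.cons_val_one] at h
    rw [← hJ.conj_symm x y, hJ.diag_eq x, hJ.diag_eq y] at h
    have h2 : J x y * star (J x y) = ((‖J x y‖ ^ 2 : ℝ) : ℂ) := by
      rw [Complex.star_def, Complex.mul_conj']; simp
    rw [h2, ← Complex.ofReal_mul, ← Complex.ofReal_sub] at h
    have h3 : 0 ≤ (J x x).re * (J y y).re - ‖J x y‖ ^ 2 := by exact_mod_cast h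
    refine abs_le_of_sq_le_sq' ?_ (mul_nonneg (Real.sqrt_nonneg _) (Real.sqrt_nonneg _)) |>.2
    change _ ≤ (diagSqrt J x * diagSqrt J y) ^ 2
    rw [mul_pow, diagSqrt_sq hJ, diagSqrt_sq hJ]
    linarith
  integrable_sq := by
    simp_rw [diagSqrt_sq hJ]
    exact hJ.integrable_diag.re

/-! ### Columns of the kernel in L² and the pointwise resolvent kernel -/

section Columns

variable {s : Pt d → ℝ}

lemma memLp_of_norm_le (hs : Measurable s) (hi : Integrable fun x => s x ^ 2) {u : Pt d → ℂ}
    (hu : Measurable u) (c : ℝ) (h : ∀ x, ‖u x‖ ≤ c * s x) : MemLp u 2 (volume : Measure (Pt d)) := by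
  have h1 : MemLp s 2 (volume : Measure (Pt d)) :=
    (memLp_two_iff_integrable_sq hs.aestronglyMeasurable).2 hi
  refine (h1.const_mul c).mono' hu.aestronglyMeasurable (Eventually.of_forall h)

lemma memLp_col (hJ : IsTraceClassKernel T J) (y : Pt d) :
    MemLp (fun x => J x y) 2 (volume : Measure (Pt d)) :=
  memLp_of_norm_le hJ.isDominated.measurable_bound hJ.isDominated.integrable_sq
    (hJ.measurable.comp (measurable_id.prodMk measurable_const)) (diagSqrt J y)
    fun x => (hJ.isDominated.norm_le x y).trans (mul_comm _ _).le

/-- The column of the kernel at `y`, as an element of `L²`. -/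
def col (hJ : IsTraceClassKernel T J) (y : Pt d) : L2 d := (memLp_col hJ y).toLp _

lemma coeFn_col (hJ : IsTraceClassKernel T J) (y : Pt d) : col hJ y =ᵐ[volume] fun x => J x y :=
  (memLp_col hJ y).coeFn_toLp

lemma inner_col (hJ : IsTraceClassKernel T J) (x : Pt d) (g : L2 d) :
    inner ℂ (col hJ x) g = ∫ w, J x w * g w := by
  rw [L2.inner_def]
  refine integral_congr_ae ?_
  filter_upwards [coeFn_col hJ x] with w hw
  rw [hw, RCLike.inner_apply', ← hJ.conj_symm w x]
  rfl

/-- The left side is a representative of T g defined at every point; the pointwise statements about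
the resolvent kernel rest on it. -/
lemma inner_col_ae (hJ : IsTraceClassKernel T J) (g : L2 d) :
    (fun x => inner ℂ (col hJ x) g) =ᵐ[volume] T g := by
  filter_upwards [hJ.apply_ae g] with x hx
  rw [hx, inner_col]

/-- The kernel of `T (1 + T)⁻¹`. -/
def resKernel (hJ : IsTraceClassKernel T J) (x y : Pt d) : ℂ :=
  J x y - inner ℂ (col hJ x) (Ring.inverse (1 + T) (col hJ y))

/-- The solution of a Fredholm equation whose right side is a combination of columns. -/
lemma eq_sum_resKernel_of_fredholm_eq (hJ : IsTraceClassKernel T J) {ι : Type*} [Fintype ι]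
    (y : ι → Pt d) (c : ι → ℂ) (Φ : Pt d → ℂ) (hm : Measurable Φ) (C : ℝ)
    (hb : ∀ x, ‖Φ x‖ ≤ C * diagSqrt J x)
    (hΦ : ∀ x, Φ x = ∑ j, J x (y j) * c j - ∫ w, J x w * Φ w) (x : Pt d) :
    Φ x = ∑ j, resKernel hJ x (y j) * c j := by
  have hL := memLp_of_norm_le hJ.isDominated.measurable_bound hJ.isDominated.integrable_sq hm C hb
  set u : L2 d := hL.toLp Φ with hu
  have hint : ∀ x, ∫ w, J x w * Φ w = inner ℂ (col hJ x) u := by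
    intro x
    rw [inner_col]
    refine integral_congr_ae ?_
    filter_upwards [hL.coeFn_toLp] with w hw
    rw [hu, hw]
  have h1 : (1 + T) u = ∑ j, c j • col hJ (y j) := by
    refine Lp.ext ?_
    have e1 : ((1 + T) u : L2 d) = u + T u := by simp
    have e2 : ⇑(∑ j, c j • col hJ (y j)) =ᵐ[volume] fun x => ∑ j, J x (y j) * c j := by
      refine (Lp.coeFn_finsetSum _ _).trans ?_
      have : ∀ j, ⇑(c j • col hJ (y j)) =ᵐ[volume] fun x => J x (y j) * c j := by
        intro j
        filter_upwards [Lp.coeFn_smul (c j) (col hJ (y j)), coeFn_col hJ (y j)] with x h1 h2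
        rw [h1, Pi.smul_apply, h2, smul_eq_mul, mul_comm]
      filter_upwards [ae_all_iff.2 this] with x hx
      simp [hx]
    rw [e1]
    filter_upwards [Lp.coeFn_add u (T u), e2, hL.coeFn_toLp, inner_col_ae hJ u] with x h1 h2 h3 h4
    rw [h1, h2, Pi.add_apply, ← h4, hu, h3, ← hu, ← hint, hΦ x]
    ring
  have h2 : u = ∑ j, c j • Ring.inverse (1 + T) (col hJ (y j)) := by
    have := congrArg (fun v : L2 d => Ring.inverse (1 + T) v) h1
    rw [← mul_apply_eq_comp, inverse_mul_one_add hJ.isPositive] at this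
    simpa using this
  -- The L² identity determines u only up to null sets, but `hΦ` holds at every x and sees Φ under
  -- the integral only through u, so the conclusion is pointwise.
  rw [hΦ x, hint, h2, inner_sum, ← Finset.sum_sub_distrib]
  refine Finset.sum_congr rfl fun j _ => ?_
  rw [inner_smul_right, resKernel]
  ring

end Columns

/-! ### Fredholm minors as minors of the resolvent kernel -/

section Minors

variable {ι : Type*} [Fintype ι] [DecidableEq ι]

/-- Fredholm's determinant of `1 + T`. -/
def fredholmDet (J : Pt d → Pt d → ℂ) : ℂ :=
  ∑' m : ℕ, (m ! : ℂ)⁻¹ * ∫ z : Fin m → Pt d, (Matrix.of fun i j => J (z i) (z j)).det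

/-- As a function of the point in row i, the minor solves Fredholm's equation, hence equals Σ_j
K(x,y_j) c_j. The row (K(x,y_·), 0) has no integral term in `fredholmMinor_expand`, so its minor is
the same sum. -/
lemma fredholmMinor_update_kerRow (hJ : IsTraceClassKernel T J) {y : ι → Pt d}
    {R : Rows ι (Pt d)} {a : ι → ℝ} (h : RowsLe (diagSqrt J) y R a) (i : ι) (x : Pt d) :
    fredholmMinor J y (Function.update R i (kerRow J y x))
      = fredholmMinor J y (Function.update R i (fun j => resKernel hJ x (y j), 0)) := by
  have hd := hJ.isDominated
  set c : ι → ℂ := fun j => fredholmMinor J y (Function.update R i (Pi.single j 1, 0)) with hc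
  set Φ : Pt d → ℂ := fun w => fredholmMinor J y (Function.update R i (kerRow J y w)) with hΦ
  have h1 : ∀ x, Φ x = ∑ j, J x (y j) * c j - ∫ w, J x w * Φ w := by
    intro x
    have := fredholmMinor_expand hd (h.update_kerRow hd i x) i
    simp only [Function.update_self, Function.update_idem] at this
    exact this
  have h2 := eq_sum_resKernel_of_fredholm_eq hJ y c Φ (measurable_fredholmMinor_kerRow hd h i)
    (rowConst (diagSqrt J) y (Function.update a i 1) *
      ∑' m, fredholmBound (diagSqrt J) (Fintype.card ι) m) (fun w => by
        have := norm_fredholmMinor_le hd (h.update_kerRow hd i w)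
        rw [rowConst_update] at this
        refine this.trans (le_of_eq (by ring))) h1 x
  have h3 := fredholmMinor_expand hd
    (h.update_const hd i fun j => resKernel hJ x (y j)) i
  simp only [Function.update_self, Function.update_idem, Pi.zero_apply, zero_mul,
    integral_zero, sub_zero] at h3
  rw [h3]
  exact h2

/-- The rows are replaced one at a time; domination is carried along because each replacement needs
it for the mixed family of rows. -/
lemma exists_rowsLe_piecewise (hJ : IsTraceClassKernel T J) (x y : ι → Pt d) (s : Finset ι) :
    (∃ a, RowsLe (diagSqrt J) y
        (s.piecewise (fun i => (fun j => resKernel hJ (x i) (y j), 0))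
          fun i => kerRow J y (x i)) a) ∧
      fredholmMinor J y (s.piecewise (fun i => (fun j => resKernel hJ (x i) (y j), 0))
          fun i => kerRow J y (x i)) = fredholmMinor J y fun i => kerRow J y (x i) := by
  have hd := hJ.isDominated
  induction s using Finset.induction_on with
  | empty =>
    refine ⟨⟨fun i => diagSqrt J (x i), ?_⟩, by simp⟩
    rw [Finset.piecewise_empty]
    refine ⟨fun i => hd.measurable_kernel.comp measurable_prodMk_left, fun i => hd.nonneg _,
      fun i j => ?_, fun i w => hd.norm_le _ _⟩
    refine (hd.norm_le (x i) (y j)).trans ?_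
    have := hd.nonneg (x i)
    gcongr
    linarith
  | insert i s hi ih =>
    obtain ⟨⟨a, ha⟩, he⟩ := ih
    rw [Finset.piecewise_insert]
    refine ⟨⟨_, ha.update_const hd i _⟩, ?_⟩
    rw [← he, ← fredholmMinor_update_kerRow hJ ha i (x i)]
    congr 1
    rw [Function.update_eq_self_iff, Finset.piecewise_eq_of_notMem _ _ _ hi]

/-- Fredholm's minors are the minors of the resolvent kernel. -/
theorem fredholmMinor_eq_det (hJ : IsTraceClassKernel T J) (x y : ι → Pt d) :
    fredholmMinor J y (fun i => kerRow J y (x i))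
      = (Matrix.of fun i j => resKernel hJ (x i) (y j)).det * fredholmDet J := by
  -- Once all rows are replaced, the upper right block is zero, and each determinant splits into det
  -- K and the determinant of J at the points z.
  rw [← (exists_rowsLe_piecewise hJ x y Finset.univ).2, Finset.piecewise_univ, fredholmMinor,
    fredholmDet, ← tsum_mul_left]
  refine tsum_congr fun m => ?_
  rw [fredholmTerm, mul_left_comm]
  congr 1
  rw [← integral_const_mul]
  refine integral_congr_ae (Eventually.of_forall fun z => ?_)
  have : bMat J (fun i => ((fun j => resKernel hJ (x i) (y j), 0) : (ι → ℂ) × (Pt d → ℂ))) y z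
      = Matrix.fromBlocks (Matrix.of fun i j => resKernel hJ (x i) (y j)) 0
        (Matrix.of fun l j => J (z l) (y j)) (Matrix.of fun l l' => J (z l) (z l')) := rfl
  simp only [this, Matrix.det_fromBlocks_zero₁₂]

end Minors

end Kernels

/-! ### Linearity of the determinant in one row or column -/

section Multilinear

variable {n κ : Type*} [Fintype n] [DecidableEq n]

lemma det_updateRow_sum_smul (M : Matrix n n ℂ) (i : n) (s : Finset κ) (c : κ → ℂ) (v : κ → n → ℂ) :
    (M.updateRow i (∑ k ∈ s, c k • v k)).det = ∑ k ∈ s, c k * (M.updateRow i (v k)).det := by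
  classical
  induction s using Finset.induction_on with
  | empty => simpa using Matrix.det_eq_zero_of_row_eq_zero i (by simp)
  | insert k s hk ih =>
    rw [Finset.sum_insert hk, Finset.sum_insert hk, Matrix.det_updateRow_add,
      Matrix.det_updateRow_smul, ih]

lemma det_updateCol_sum_smul (M : Matrix n n ℂ) (i : n) (s : Finset κ) (c : κ → ℂ) (v : κ → n → ℂ) :
    (M.updateCol i (∑ k ∈ s, c k • v k)).det = ∑ k ∈ s, c k * (M.updateCol i (v k)).det := by
  rw [← Matrix.det_transpose, ← Matrix.updateRow_transpose, det_updateRow_sum_smul]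
  refine Finset.sum_congr rfl fun k _ => ?_
  rw [Matrix.updateRow_transpose, Matrix.det_transpose]

end Multilinear

/-! ### Positivity of Fredholm's determinant and of the resolvent kernel -/

section Kernels

variable {d : ℕ} {T : L2 d →L[ℂ] L2 d} {J : Pt d → Pt d → ℂ}

lemma bMat_kerRow {ι : Type*} {m : ℕ} (x : ι → Pt d) (z : Fin m → Pt d) :
    bMat J (fun i => kerRow J x (x i)) x z
      = Matrix.of fun a b => J (Sum.elim x z a) (Sum.elim x z b) := by
  ext a b
  rcases a with a | a <;> rcases b with b | b <;> rfl

lemma rowsLe_kerRow (hJ : IsTraceClassKernel T J) {ι : Type*} [Fintype ι] [DecidableEq ι]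
    (x y : ι → Pt d) : ∃ a, RowsLe (diagSqrt J) y (fun i => kerRow J y (x i)) a := by
  simpa using (exists_rowsLe_piecewise hJ x y ∅).1

lemma det_bMat_kerRow_nonneg (hJ : IsTraceClassKernel T J) {ι : Type*} [Fintype ι] [DecidableEq ι]
    {m : ℕ} (x : ι → Pt d) (z : Fin m → Pt d) :
    0 ≤ (bMat J (fun i => kerRow J x (x i)) x z).det := by
  rw [bMat_kerRow]
  exact (hJ.posSemidef_of _).det_nonneg

lemma hasSum_fredholmDet (hJ : IsTraceClassKernel T J) :
    HasSum (fun m : ℕ => (m ! : ℂ)⁻¹ * ∫ z : Fin m → Pt d,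
      (Matrix.of fun i j => J (z i) (z j)).det) (fredholmDet J) := by
  obtain ⟨a, ha⟩ := rowsLe_kerRow hJ (Fin.elim0 : Fin 0 → Pt d) Fin.elim0
  have h := (summable_fredholmTerm hJ.isDominated ha).hasSum
  have e : ∀ (m : ℕ) (z : Fin m → Pt d),
      (bMat J (fun i : Fin 0 => kerRow J Fin.elim0 (Fin.elim0 i)) Fin.elim0 z).det
        = (Matrix.of fun i j => J (z i) (z j)).det := by
    intro m z
    rw [← Matrix.det_submatrix_equiv_self (Equiv.emptySum (Fin 0) (Fin m)).symm]
    rfl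
  simp only [fredholmTerm, e] at h
  exact h.summable.hasSum

/-- All terms are nonnegative, and the term with m = 0 is 1. -/
lemma one_le_fredholmDet (hJ : IsTraceClassKernel T J) : 1 ≤ fredholmDet J := by
  have h := hasSum_fredholmDet hJ
  have h1 : ∀ m : ℕ, 0 ≤ (m ! : ℂ)⁻¹ * ∫ z : Fin m → Pt d,
      (Matrix.of fun i j => J (z i) (z j)).det := fun m =>
    mul_nonneg (by simp) (integral_nonneg fun z => (hJ.posSemidef_of z).det_nonneg)
  have h2 := le_hasSum h 0 fun m _ => h1 m
  simpa [volume_pi, measureReal_def, Measure.pi_univ] using h2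

lemma fredholmDet_eq (hJ : IsTraceClassKernel T J) :
    fredholmDet J = ((fredholmDet J).re : ℂ) ∧ 1 ≤ (fredholmDet J).re := by
  have h := Complex.le_def.1 (one_le_fredholmDet hJ)
  exact ⟨Complex.ext (by simp) (by simpa using h.2.symm), by simpa using h.1⟩

lemma inner_col_inverse_nonneg (hJ : IsTraceClassKernel T J) (x : Pt d) :
    0 ≤ inner ℂ (col hJ x) (Ring.inverse (1 + T) (col hJ x)) :=
  (isPositive_inverse_one_add hJ.isPositive).inner_nonneg_right _

lemma resKernel_conj_symm (hJ : IsTraceClassKernel T J) (x y : Pt d) :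
    star (resKernel hJ x y) = resKernel hJ y x := by
  rw [resKernel, resKernel, star_sub, hJ.conj_symm, Complex.star_def, inner_conj_symm,
    (isPositive_inverse_one_add hJ.isPositive).inner_left_eq_inner_right]

/-- The coefficients merge the points x into one vector. If V sends the first basis vector to c and
fixes those of the points z, the sum is det(Vᴴ M V), with M the positive semidefinite matrix of J at
x and z. -/
lemma fredholm_quadratic_nonneg (hJ : IsTraceClassKernel T J) {n m : ℕ} (x : Fin n → Pt d)
    (c : Fin n → ℂ) (z : Fin m → Pt d) :
    0 ≤ ∑ i, star (c i) * ∑ j, c j *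
      (bMat J (fun _ : Unit => kerRow J (fun _ => x j) (x i)) (fun _ => x j) z).det := by
  set V : Matrix (Fin n ⊕ Fin m) (Unit ⊕ Fin m) ℂ :=
    Matrix.fromBlocks (Matrix.of fun i _ => c i) 0 0 1 with hV
  have hp := ((hJ.posSemidef_of (Sum.elim x z)).conjTranspose_mul_mul_same V).det_nonneg
  refine hp.trans (le_of_eq ?_)
  set D : Matrix (Fin m) (Fin m) ℂ := Matrix.of fun l l' => J (z l) (z l')
  -- The sum over j enters the first column by linearity; below, the sum over i enters the first
  -- row.
  have hcol : ∀ i, ∑ j, c j *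
      (bMat J (fun _ : Unit => kerRow J (fun _ => x j) (x i)) (fun _ => x j) z).det
        = (Matrix.fromBlocks (Matrix.of fun (_ _ : Unit) => ∑ j, c j * J (x i) (x j))
            (Matrix.of fun _ l => J (x i) (z l))
            (Matrix.of fun l _ => ∑ j, c j * J (z l) (x j)) D).det := by
    intro i
    set M : Matrix (Unit ⊕ Fin m) (Unit ⊕ Fin m) ℂ :=
      Matrix.fromBlocks 0 (Matrix.of fun _ l => J (x i) (z l)) 0 D
    have h1 := det_updateCol_sum_smul M (Sum.inl ()) Finset.univ c
      fun j => Sum.elim (fun _ => J (x i) (x j)) fun l => J (z l) (x j)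
    have h2 : M.updateCol (Sum.inl ()) (∑ j, c j • Sum.elim (fun _ => J (x i) (x j))
        fun l => J (z l) (x j)) = Matrix.fromBlocks
            (Matrix.of fun (_ _ : Unit) => ∑ j, c j * J (x i) (x j))
            (Matrix.of fun _ l => J (x i) (z l))
            (Matrix.of fun l _ => ∑ j, c j * J (z l) (x j)) D := by
      ext a b
      rcases a with a | a <;> rcases b with b | b <;>
        simp [M, Finset.sum_apply]
    rw [← h2, h1]
    refine Finset.sum_congr rfl fun j _ => ?_
    congr 2
    ext a b
    rcases a with a | a <;> rcases b with b | b <;>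
      simp [M, D, bMat, kerRow]
  simp only [hcol]
  set M : Matrix (Unit ⊕ Fin m) (Unit ⊕ Fin m) ℂ :=
    Matrix.fromBlocks 0 0 (Matrix.of fun l _ => ∑ j, c j * J (z l) (x j)) D
  have h1 := det_updateRow_sum_smul M (Sum.inl ()) Finset.univ (fun i => star (c i))
    fun i => Sum.elim (fun _ => ∑ j, c j * J (x i) (x j)) fun l => J (x i) (z l)
  have h2 : ∀ i, M.updateRow (Sum.inl ()) (Sum.elim (fun _ => ∑ j, c j * J (x i) (x j))
      fun l => J (x i) (z l)) = Matrix.fromBlocks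
            (Matrix.of fun (_ _ : Unit) => ∑ j, c j * J (x i) (x j))
            (Matrix.of fun _ l => J (x i) (z l))
            (Matrix.of fun l _ => ∑ j, c j * J (z l) (x j)) D := by
    intro i
    ext a b
    rcases a with a | a <;> rcases b with b | b <;>
      simp [M, Matrix.updateRow_apply]
  simp only [← h2, ← h1]
  congr 1
  ext a b
  rcases a with a | a <;> rcases b with b | b <;>
    simp [M, D, hV, Matrix.updateRow_apply, Matrix.mul_apply, Matrix.one_apply,
      Finset.sum_apply, Finset.mul_sum, Finset.sum_mul, mul_assoc, mul_comm]
  exact Finset.sum_comm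

/-- Positivity of the operator alone does not control every tuple of points. Instead, K(x_i,x_j)
det(1+T) is a 1 × 1 Fredholm minor, so the quadratic form is a series of integrals, each nonnegative
by `fredholm_quadratic_nonneg`. -/
lemma resKernel_posSemidef (hJ : IsTraceClassKernel T J) (n : ℕ) (x : Fin n → Pt d) :
    (Matrix.of fun i j => resKernel hJ (x i) (x j)).PosSemidef := by
  refine Matrix.PosSemidef.of_dotProduct_mulVec_nonneg ?_ fun c => ?_
  · ext i j
    simp only [Matrix.conjTranspose_apply, Matrix.of_apply]
    exact resKernel_conj_symm hJ _ _
  obtain ⟨hD, hD1⟩ := fredholmDet_eq hJ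
  set D := (fredholmDet J).re
  have h0 : star c ⬝ᵥ (Matrix.of fun i j => resKernel hJ (x i) (x j)).mulVec c
      = ∑ i, star (c i) * ∑ j, c j * resKernel hJ (x i) (x j) := by
    simp only [dotProduct, Matrix.mulVec, Matrix.of_apply, Pi.star_apply]
    refine Finset.sum_congr rfl fun i _ => ?_
    congr 1
    exact Finset.sum_congr rfl fun j _ => mul_comm _ _
  have hK : ∀ i j, resKernel hJ (x i) (x j) * D = fredholmMinor J (fun _ : Unit => x j)
      fun _ => kerRow J (fun _ => x j) (x i) := by
    intro i j
    rw [fredholmMinor_eq_det hJ (fun _ : Unit => x i), hD]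
    simp
  have hs : ∀ i j, HasSum (fun m : ℕ => (m ! : ℂ)⁻¹ * fredholmTerm J (fun _ : Unit => x j) m
      fun _ => kerRow J (fun _ => x j) (x i)) (resKernel hJ (x i) (x j) * D) := by
    intro i j
    rw [hK]
    obtain ⟨a, ha⟩ := rowsLe_kerRow hJ (fun _ : Unit => x i) (fun _ : Unit => x j)
    exact (summable_fredholmTerm hJ.isDominated ha).hasSum
  have hS : HasSum (fun m : ℕ => ∑ i, star (c i) * ∑ j, c j * ((m ! : ℂ)⁻¹ *
      fredholmTerm J (fun _ : Unit => x j) m fun _ => kerRow J (fun _ => x j) (x i)))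
      (∑ i, star (c i) * ∑ j, c j * (resKernel hJ (x i) (x j) * D)) :=
    hasSum_sum fun i _ => (hasSum_sum fun j _ => (hs i j).mul_left _).mul_left _
  have hpos : 0 ≤ ∑ i, star (c i) * ∑ j, c j * (resKernel hJ (x i) (x j) * D) := by
    refine hS.nonneg fun m => ?_
    have hi : ∀ i j, Integrable fun z : Fin m → Pt d =>
        (bMat J (fun _ : Unit => kerRow J (fun _ => x j) (x i)) (fun _ => x j) z).det := by
      intro i j
      obtain ⟨a, ha⟩ := rowsLe_kerRow hJ (fun _ : Unit => x i) (fun _ : Unit => x j)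
      exact integrable_det_bMat hJ.isDominated ha
    have e : ∑ i, star (c i) * ∑ j, c j * ((m ! : ℂ)⁻¹ *
        fredholmTerm J (fun _ : Unit => x j) m fun _ => kerRow J (fun _ => x j) (x i))
        = (m ! : ℂ)⁻¹ * ∫ z : Fin m → Pt d, ∑ i, star (c i) * ∑ j, c j *
      (bMat J (fun _ : Unit => kerRow J (fun _ => x j) (x i)) (fun _ => x j) z).det := by
      rw [integral_finsetSum, Finset.mul_sum]
      swap
      · intro i _
        refine Integrable.const_mul ?_ _
        exact integrable_finsetSum _ fun j _ => (hi i j).const_mul _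
      refine Finset.sum_congr rfl fun i _ => ?_
      rw [integral_const_mul, integral_finsetSum _ fun j _ => (hi i j).const_mul _,
        mul_left_comm]
      congr 1
      rw [Finset.mul_sum]
      refine Finset.sum_congr rfl fun j _ => ?_
      rw [integral_const_mul, mul_left_comm]
      rfl
    rw [e]
    exact mul_nonneg (by simp) (integral_nonneg fun z => fredholm_quadratic_nonneg hJ x c z)
  have hD0 : (0 : ℂ) ≤ (D : ℂ)⁻¹ := by
    rw [← Complex.ofReal_inv]
    exact Complex.zero_le_real.2 (inv_nonneg.2 (zero_le_one.trans hD1))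
  have hD2 : (D : ℂ) ≠ 0 := Complex.ofReal_ne_zero.2 (zero_lt_one.trans_le hD1).ne'
  have e : ∑ i, star (c i) * ∑ j, c j * (resKernel hJ (x i) (x j) * D)
      = (star c ⬝ᵥ (Matrix.of fun i j => resKernel hJ (x i) (x j)).mulVec c) * D := by
    rw [h0, Finset.sum_mul]
    refine Finset.sum_congr rfl fun i _ => ?_
    rw [mul_assoc, Finset.sum_mul]
    congr 1
    exact Finset.sum_congr rfl fun j _ => by ring
  rw [e] at hpos
  have := mul_nonneg hpos hD0
  rwa [mul_inv_cancel_right₀ hD2] at this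

end Kernels

/-! ### The resolvent kernel: measurability, action and trace -/

section Kernels

variable {d : ℕ} {T : L2 d →L[ℂ] L2 d} {J : Pt d → Pt d → ℂ}

lemma measurable_inner_col (hJ : IsTraceClassKernel T J) (g : L2 d) :
    Measurable fun x => inner ℂ (col hJ x) g := by
  simp only [inner_col]
  refine (StronglyMeasurable.integral_prod_right (f := fun x w => J x w * g w) ?_).measurable
  exact (hJ.measurable.mul ((Lp.stronglyMeasurable g).measurable.comp
    measurable_snd)).stronglyMeasurable

/-- Expansion in a countable orthonormal basis presents the inner product as a limit of finite sums
of products of a function of x and a function of y. -/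
lemma measurable_resKernel (hJ : IsTraceClassKernel T J) :
    Measurable (Function.uncurry (resKernel hJ)) := by
  obtain ⟨w, b, -⟩ := exists_hilbertBasis ℂ (L2 d)
  have : Countable w := b.countable
  refine Measurable.sub hJ.measurable ?_
  refine measurable_of_tendsto_metrizable' (atTop : Filter (Finset w))
    (f := fun s p => ∑ i ∈ s, inner ℂ (col hJ p.1) (b i) *
      star (inner ℂ (col hJ p.2) (Ring.inverse (1 + T) (b i)))) (fun s => ?_) ?_
  · refine Finset.measurable_sum _ fun i _ => ?_
    refine ((measurable_inner_col hJ _).comp measurable_fst).mul ?_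
    exact Complex.continuous_conj.measurable.comp
      ((measurable_inner_col hJ _).comp measurable_snd)
  · rw [tendsto_pi_nhds]
    intro p
    have h := b.hasSum_inner_mul_inner (col hJ p.1) (Ring.inverse (1 + T) (col hJ p.2))
    refine Tendsto.congr (fun s => ?_) h
    refine Finset.sum_congr rfl fun i _ => ?_
    rw [Complex.star_def, inner_conj_symm,
      (isPositive_inverse_one_add hJ.isPositive).inner_left_eq_inner_right]

lemma integrable_kernel_mul (hJ : IsTraceClassKernel T J) (x : Pt d) (f : L2 d) :
    Integrable fun y => J x y * f y := by
  refine (L2.integrable_inner (𝕜 := ℂ) (col hJ x) f).congr ?_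
  filter_upwards [coeFn_col hJ x] with w hw
  rw [hw, RCLike.inner_apply', ← hJ.conj_symm w x]
  rfl

/-- The second term of TS = T − TST: ∫ ⟨J(·,x), S J(·,y)⟩ f(y) dy = ⟨T S J(·,x), f⟩ = ⟨J(·,x), S T
f⟩. -/
lemma resKernel_apply_ae (hJ : IsTraceClassKernel T J) (f : L2 d) :
    resolventOp T f =ᵐ[volume] fun x => ∫ y, resKernel hJ x y * f y := by
  set S := Ring.inverse (1 + T) with hS
  have hSp := isPositive_inverse_one_add hJ.isPositive
  have h1 : resolventOp T f = T f - T (S (T f)) := by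
    rw [resolventOp, mul_inverse_one_add hJ.isPositive]
    simp [hS]
  rw [h1]
  filter_upwards [Lp.coeFn_sub (T f) (T (S (T f))), hJ.apply_ae f,
    inner_col_ae hJ (S (T f))] with x e1 e2 e3
  rw [e1, Pi.sub_apply, e2, ← e3]
  have h2 : (fun y => inner ℂ (col hJ x) (S (col hJ y)) * f y)
      =ᵐ[volume] fun y => inner ℂ (T (S (col hJ x)) y) (f y) := by
    filter_upwards [inner_col_ae hJ (S (col hJ x))] with y hy
    rw [← hy, RCLike.inner_apply', inner_conj_symm, hSp.inner_left_eq_inner_right]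
  have h3 : Integrable fun y => inner ℂ (col hJ x) (S (col hJ y)) * f y :=
    (L2.integrable_inner (𝕜 := ℂ) (T (S (col hJ x))) f).congr h2.symm
  have h4 : ∫ y, inner ℂ (col hJ x) (S (col hJ y)) * f y = inner ℂ (col hJ x) (S (T f)) := by
    rw [integral_congr_ae h2, ← L2.inner_def, hJ.isPositive.inner_left_eq_inner_right,
      hSp.inner_left_eq_inner_right]
  rw [← h4, ← integral_sub (integrable_kernel_mul hJ x f) h3]
  refine integral_congr_ae (Eventually.of_forall fun y => ?_)
  simp only [resKernel, sub_mul, hS]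

lemma resKernel_diag_nonneg (hJ : IsTraceClassKernel T J) (x : Pt d) : 0 ≤ resKernel hJ x x :=
  (resKernel_posSemidef hJ 1 ![x]).diag_nonneg (i := 0)

/-- Since K(x,x) ≥ 0, this term lies between 0 and J(x,x). -/
lemma integrable_inner_col_inverse (hJ : IsTraceClassKernel T J) :
    Integrable fun x => inner ℂ (col hJ x) (Ring.inverse (1 + T) (col hJ x)) := by
  have hm : Measurable fun x => inner ℂ (col hJ x) (Ring.inverse (1 + T) (col hJ x)) := by
    have h1 : Measurable fun x => J x x - resKernel hJ x x :=
      (hJ.measurable.comp (measurable_id.prodMk measurable_id)).sub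
        ((measurable_resKernel hJ).comp (measurable_id.prodMk measurable_id))
    simpa [resKernel] using h1
  refine hJ.integrable_diag.mono hm.aestronglyMeasurable (Eventually.of_forall fun x => ?_)
  refine CStarAlgebra.norm_le_norm_of_nonneg_of_le (inner_col_inverse_nonneg hJ x) ?_
  exact sub_nonneg.1 (resKernel_diag_nonneg hJ x)

/-- With A the root of S, Parseval gives ⟨J(·,x), S J(·,x)⟩ = Σ_i |⟨J(·,x), A b_i⟩|². Integration
over x gives Σ_i ‖T A b_i‖² = Σ_i ⟨b_i, T S T b_i⟩, which is subtracted from the trace of T. -/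
lemma hasTrace_resKernel (hJ : IsTraceClassKernel T J) :
    HasTrace (resolventOp T) (∫ x, resKernel hJ x x) := by
  intro κ b
  have : Countable κ := b.countable
  set S := Ring.inverse (1 + T) with hS
  have hSp := isPositive_inverse_one_add hJ.isPositive
  obtain ⟨A, hAp, hAS, hAT⟩ := exists_sqrt_inverse_one_add hJ.isPositive
  rw [← hS] at hAS
  have hq : ∀ x, inner ℂ (col hJ x) (S (col hJ x)) = ((‖A (col hJ x)‖ ^ 2 : ℝ) : ℂ) := by
    intro x
    rw [← hAS, mul_apply_eq_comp, ← hAp.inner_left_eq_inner_right,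
      inner_self_eq_norm_sq_to_K]
    simp
  have hc : ∀ i, inner ℂ (b i) (T (S (T (b i)))) = ((‖T (A (b i))‖ ^ 2 : ℝ) : ℂ) := by
    intro i
    have h1 : T (A (b i)) = A (T (b i)) := by
      have := congrArg (fun B : L2 d →L[ℂ] L2 d => B (b i)) hAT.eq
      simpa using this.symm
    rw [← hAS, mul_apply_eq_comp, ← hJ.isPositive.inner_left_eq_inner_right,
      ← hAp.inner_left_eq_inner_right, h1, inner_self_eq_norm_sq_to_K]
    simp
  have hqi : Integrable fun x => ‖A (col hJ x)‖ ^ 2 := by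
    have := (integrable_inner_col_inverse hJ).re
    rw [← hS] at this
    simpa only [hq, RCLike.ofReal_re, RCLike.re_to_complex, Complex.ofReal_re] using this
  have hl : ∫⁻ x, ENNReal.ofReal (‖A (col hJ x)‖ ^ 2)
      = ∑' i, ENNReal.ofReal (‖T (A (b i))‖ ^ 2) := by
    have h1 : ∀ x, ENNReal.ofReal (‖A (col hJ x)‖ ^ 2)
        = ∑' i, ENNReal.ofReal (‖inner ℂ (col hJ x) (A (b i))‖ ^ 2) := by
      intro x
      have h := hasSum_norm_inner_sq b (A (col hJ x))
      have e : ∀ i, ‖inner ℂ (b i) (A (col hJ x))‖ = ‖inner ℂ (col hJ x) (A (b i))‖ := fun i => by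
        rw [← hAp.inner_left_eq_inner_right, norm_inner_symm]
      simp only [e] at h
      rw [← h.tsum_eq, ENNReal.ofReal_tsum_of_nonneg (fun i => sq_nonneg _) h.summable]
    simp only [h1]
    rw [lintegral_tsum fun i =>
      ((measurable_inner_col hJ _).norm.pow_const 2).ennreal_ofReal.aemeasurable]
    refine tsum_congr fun i => ?_
    have h2 : ∫⁻ x, ENNReal.ofReal (‖inner ℂ (col hJ x) (A (b i))‖ ^ 2)
        = ∫⁻ x, ENNReal.ofReal (‖T (A (b i)) x‖ ^ 2) := by
      refine lintegral_congr_ae ?_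
      filter_upwards [inner_col_ae hJ (A (b i))] with x hx
      rw [hx]
    have h3 : Integrable fun x => ‖T (A (b i)) x‖ ^ 2 :=
      (memLp_two_iff_integrable_sq_norm (Lp.aestronglyMeasurable _)).1 (Lp.memLp _)
    rw [h2, ← ofReal_integral_eq_lintegral_ofReal h3 (Eventually.of_forall fun x => sq_nonneg _)]
    congr 1
    have h4 : inner ℂ (T (A (b i))) (T (A (b i))) = ((‖T (A (b i))‖ ^ 2 : ℝ) : ℂ) := by
      rw [inner_self_eq_norm_sq_to_K]; simp
    rw [L2.inner_def] at h4
    have h5 : ∀ x, inner ℂ (T (A (b i)) x) (T (A (b i)) x)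
        = ((‖T (A (b i)) x‖ ^ 2 : ℝ) : ℂ) := fun x => by
      rw [inner_self_eq_norm_sq_to_K]; simp
    simp only [h5] at h4
    rw [integral_complex_ofReal] at h4
    exact_mod_cast h4
  have hsumS : HasSum (fun i => ‖T (A (b i))‖ ^ 2) (∫ x, ‖A (col hJ x)‖ ^ 2) := by
    rw [integral_eq_lintegral_of_nonneg_ae (Eventually.of_forall fun x => sq_nonneg _)
      hqi.aestronglyMeasurable, hl]
    have hfin : ∑' i, ENNReal.ofReal (‖T (A (b i))‖ ^ 2) ≠ ∞ := by
      rw [← hl]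
      exact hqi.lintegral_lt_top.ne
    have := ENNReal.hasSum_toReal hfin
    rw [ENNReal.tsum_toReal_eq fun i => ENNReal.ofReal_ne_top]
    simpa only [ENNReal.toReal_ofReal (sq_nonneg _)] using this
  have hfinal := (hJ.hasTrace κ b).sub (Complex.hasSum_ofReal.2 hsumS)
  have e1 : ∫ x, resKernel hJ x x = (∫ x, J x x) - ((∫ x, ‖A (col hJ x)‖ ^ 2 : ℝ) : ℂ) := by
    have hqc : Integrable fun x => ((‖A (col hJ x)‖ ^ 2 : ℝ) : ℂ) := hqi.ofReal
    rw [← integral_complex_ofReal, ← integral_sub hJ.integrable_diag hqc]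
    refine integral_congr_ae (Eventually.of_forall fun x => ?_)
    simp only [resKernel]
    rw [← hS, hq]
  rw [e1]
  have e2 : (fun i => inner ℂ (b i) (resolventOp T (b i)))
      = fun i => inner ℂ (b i) (T (b i)) - ((‖T (A (b i))‖ ^ 2 : ℝ) : ℂ) := by
    funext i
    rw [resolventOp, mul_inverse_one_add hJ.isPositive, ← hc]
    simp [hS, inner_sub_right]
  rw [e2]
  exact hfinal

/-- The resolvent kernel is the kernel of `T (1 + T)⁻¹`. -/
theorem isTraceClassKernel_resKernel (hJ : IsTraceClassKernel T J) :
    IsTraceClassKernel (resolventOp T) (resKernel hJ) where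
  isPositive := isPositive_mul_inverse_one_add hJ.isPositive
  measurable := measurable_resKernel hJ
  apply_ae := resKernel_apply_ae hJ
  posSemidef := resKernel_posSemidef hJ
  integrable_diag := hJ.integrable_diag.sub (integrable_inner_col_inverse hJ)
  hasTrace := hasTrace_resKernel hJ

end Kernels

/-! ### The kernel is determined by the operator -/

section Uniqueness

variable {d : ℕ} {T : L2 d →L[ℂ] L2 d} {J k k' : Pt d → Pt d → ℂ}

/-- For each basis vector b_i, both inner products represent T b_i; countably many null sets
suffice. -/
lemma col_ae_eq (hk : IsTraceClassKernel T k) (hk' : IsTraceClassKernel T k') :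
    ∀ᵐ x, col hk x = col hk' x := by
  obtain ⟨w, b, -⟩ := exists_hilbertBasis ℂ (L2 d)
  have : Countable w := b.countable
  have h : ∀ i, ∀ᵐ x, inner ℂ (col hk x) (b i) = inner ℂ (col hk' x) (b i) := fun i =>
    (inner_col_ae hk (b i)).trans (inner_col_ae hk' (b i)).symm
  filter_upwards [ae_all_iff.2 h] with x hx
  refine b.repr.injective (lp.ext (funext fun i => ?_))
  rw [b.repr_apply_apply, b.repr_apply_apply, ← inner_conj_symm, hx, inner_conj_symm]

lemma kernel_ae_eq (hk : IsTraceClassKernel T k) (hk' : IsTraceClassKernel T k') :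
    ∀ᵐ x, ∀ᵐ y, k x y = k' x y := by
  filter_upwards [col_ae_eq hk hk'] with x hx
  filter_upwards [coeFn_col hk x, coeFn_col hk' x] with y h1 h2
  rw [← hk.conj_symm, ← hk'.conj_symm, ← h1, ← h2, hx]

lemma IsTraceClassKernel.smul (hk : IsTraceClassKernel T k) {s : ℝ} (hs : 0 ≤ s) :
    IsTraceClassKernel ((s : ℂ) • T) fun x y => s * k x y where
  isPositive := hk.isPositive.smul_of_nonneg (Complex.zero_le_real.2 hs)
  measurable := hk.measurable.const_mul _
  apply_ae f := by
    filter_upwards [Lp.coeFn_smul (s : ℂ) (T f), hk.apply_ae f] with x h1 h2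
    rw [_root_.smul_apply, h1, Pi.smul_apply, h2, smul_eq_mul, ← integral_const_mul]
    simp only [mul_assoc]
  posSemidef n x := (hk.posSemidef n x).smul (Complex.zero_le_real.2 hs)
  integrable_diag := hk.integrable_diag.const_mul _
  hasTrace κ b := by
    rw [integral_const_mul]
    have h := (hk.hasTrace κ b).mul_left (s : ℂ)
    simpa only [_root_.smul_apply, inner_smul_right] using h

lemma re_inner_resolventOp_le (hT : T.IsPositive) (x : L2 d) :
    (inner ℂ x (resolventOp T x)).re ≤ (inner ℂ x (T x)).re ∧
      (inner ℂ x (resolventOp T x)).re ≤ ‖x‖ ^ 2 ∧ 0 ≤ (inner ℂ x (resolventOp T x)).re := by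
  have hS := isPositive_inverse_one_add hT
  refine ⟨?_, ?_, (Complex.nonneg_iff.1
    ((isPositive_mul_inverse_one_add hT).inner_nonneg_right x)).1⟩
  · rw [resolventOp, mul_inverse_one_add hT]
    have h := (Complex.nonneg_iff.1 (hS.inner_nonneg_right (T x))).1
    rw [hT.inner_left_eq_inner_right] at h
    simpa [inner_sub_right] using h
  · have h1 : T * Ring.inverse (1 + T) = 1 - Ring.inverse (1 + T) := by
      have := one_add_mul_inverse hT
      rw [add_mul, one_mul] at this
      exact eq_sub_of_add_eq' this
    rw [resolventOp, h1]
    have h := (Complex.nonneg_iff.1 (hS.inner_nonneg_right x)).1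
    have h2 : (inner ℂ x x).re = ‖x‖ ^ 2 := by
      rw [inner_self_eq_norm_sq_to_K]; norm_cast
    rw [sub_apply, inner_sub_right, Complex.sub_re, one_apply_eq_self, h2]
    linarith

/-- Dominated convergence over a basis: the diagonal elements of s⁻¹ · sT(1+sT)⁻¹ are at most those
of T, which are summable, and at most 1/s. -/
lemma tendsto_trace_resolventOp_div (hk : IsTraceClassKernel T k) :
    Tendsto (fun n : ℕ => ((n : ℝ) + 1)⁻¹ *
      (∫ x, resKernel (hk.smul (s := (n : ℝ) + 1) (by positivity)) x x).re) atTop (𝓝 0) := by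
  obtain ⟨w, b, -⟩ := exists_hilbertBasis ℂ (L2 d)
  set R : ℕ → L2 d →L[ℂ] L2 d := fun n => resolventOp ((((n : ℝ) + 1 : ℝ) : ℂ) • T) with hR
  have h0 : ∀ n : ℕ, (0 : ℝ) < (n : ℝ) + 1 := fun n => by positivity
  have h1 : ∀ n : ℕ, ((n : ℝ) + 1)⁻¹ *
      (∫ x, resKernel (hk.smul (s := (n : ℝ) + 1) (by positivity)) x x).re
        = ∑' i, ((n : ℝ) + 1)⁻¹ * (inner ℂ (b i) (R n (b i))).re := by
    intro n
    have h := Complex.hasSum_re (hasTrace_resKernel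
      (hk.smul (s := (n : ℝ) + 1) (by positivity)) w b)
    rw [← h.tsum_eq, tsum_mul_left]
  simp only [h1]
  have h2 : ∀ n i, (inner ℂ (b i) (R n (b i))).re ≤ ((n : ℝ) + 1) * (inner ℂ (b i) (T (b i))).re ∧
      (inner ℂ (b i) (R n (b i))).re ≤ 1 ∧ 0 ≤ (inner ℂ (b i) (R n (b i))).re := by
    intro n i
    obtain ⟨e1, e2, e3⟩ := re_inner_resolventOp_le
      (hk.smul (s := (n : ℝ) + 1) (by positivity)).isPositive (b i)
    refine ⟨e1.trans (le_of_eq ?_), e2.trans (le_of_eq ?_), e3⟩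
    · simp only [_root_.smul_apply, inner_smul_right, Complex.re_ofReal_mul]
    · simp [b.orthonormal.1 i]
  have h3 : Tendsto (fun n : ℕ => ∑' i, ((n : ℝ) + 1)⁻¹ * (inner ℂ (b i) (R n (b i))).re) atTop
      (𝓝 (∑' _ : w, (0 : ℝ))) := by
    refine tendsto_tsum_of_dominated_convergence
      (bound := fun i => (inner ℂ (b i) (T (b i))).re)
      (Complex.hasSum_re (hk.hasTrace w b)).summable (fun i => ?_)
      (Eventually.of_forall fun n i => ?_)
    · refine squeeze_zero (g := fun n : ℕ => 1 / ((n : ℝ) + 1)) (fun n => ?_) (fun n => ?_)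
        tendsto_one_div_add_atTop_nhds_zero_nat
      · exact mul_nonneg (inv_nonneg.2 (h0 n).le) (h2 n i).2.2
      · rw [one_div]
        exact mul_le_of_le_one_right (inv_nonneg.2 (h0 n).le) (h2 n i).2.1
    · rw [Real.norm_of_nonneg (mul_nonneg (inv_nonneg.2 (h0 n).le) (h2 n i).2.2),
        inv_mul_le_iff₀ (h0 n)]
      exact (h2 n i).1
  simpa using h3

/-- Equality of the kernels off a null set does not control the diagonal. But where the columns
agree, k(x,x) − k'(x,x) is s⁻¹ times the difference of the diagonal resolvent kernels of sT, for s =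
n + 1. Its L¹ norm is at most s⁻¹ times the sum of two traces, which tends to 0. -/
lemma kernel_diag_ae_eq (hk : IsTraceClassKernel T k) (hk' : IsTraceClassKernel T k') :
    ∀ᵐ x, k x x = k' x x := by
  have hi : Integrable fun x => k x x - k' x x := hk.integrable_diag.sub hk'.integrable_diag
  have hle : ∀ n : ℕ, ∫ x, ‖k x x - k' x x‖ ≤ ((n : ℝ) + 1)⁻¹ *
      (∫ x, resKernel (hk.smul (s := (n : ℝ) + 1) (by positivity)) x x).re
      + ((n : ℝ) + 1)⁻¹ *
      (∫ x, resKernel (hk'.smul (s := (n : ℝ) + 1) (by positivity)) x x).re := by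
    intro n
    have h0 : (0 : ℝ) < (n : ℝ) + 1 := by positivity
    set h := hk.smul h0.le
    set h' := hk'.smul h0.le
    have i1 := (isTraceClassKernel_resKernel h).integrable_diag
    have i2 := (isTraceClassKernel_resKernel h').integrable_diag
    have e1 : (∫ x, resKernel h x x).re = ∫ x, ‖resKernel h x x‖ := by
      rw [← RCLike.re_to_complex, ← integral_re i1]
      refine integral_congr_ae (Eventually.of_forall fun x => ?_)
      have := congrArg Complex.re (Complex.norm_of_nonneg' (resKernel_diag_nonneg h x))
      simpa using this.symm
    have e2 : (∫ x, resKernel h' x x).re = ∫ x, ‖resKernel h' x x‖ := by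
      rw [← RCLike.re_to_complex, ← integral_re i2]
      refine integral_congr_ae (Eventually.of_forall fun x => ?_)
      have := congrArg Complex.re (Complex.norm_of_nonneg' (resKernel_diag_nonneg h' x))
      simpa using this.symm
    rw [e1, e2, ← mul_add, ← integral_add i1.norm i2.norm, ← integral_const_mul]
    refine integral_mono_ae hi.norm ((i1.norm.add i2.norm).const_mul _) ?_
    filter_upwards [col_ae_eq h h'] with x hx
    have e3 : resKernel h x x - resKernel h' x x = (((n : ℝ) + 1 : ℝ) : ℂ) * (k x x - k' x x) := by
      rw [resKernel, resKernel, hx]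
      ring
    have e4 : ‖k x x - k' x x‖ = ((n : ℝ) + 1)⁻¹ * ‖resKernel h x x - resKernel h' x x‖ := by
      rw [e3, norm_mul, Complex.norm_real, Real.norm_of_nonneg h0.le, inv_mul_cancel_left₀ h0.ne']
    simp only [e4]
    gcongr
    exact norm_sub_le _ _
  have hz : ∫ x, ‖k x x - k' x x‖ = 0 := by
    refine le_antisymm ?_ (integral_nonneg fun x => norm_nonneg _)
    have := (tendsto_trace_resolventOp_div hk).add (tendsto_trace_resolventOp_div hk')
    rw [add_zero] at this
    exact ge_of_tendsto' this hle
  rw [integral_eq_zero_iff_of_nonneg (fun x => norm_nonneg _) hi.norm] at hz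
  filter_upwards [hz] with x hx
  exact sub_eq_zero.1 (norm_eq_zero.1 hx)

/-- Distinct indices are handled by Fubini, equal ones by `kernel_diag_ae_eq`. -/
lemma kernel_pi_ae_eq (hk : IsTraceClassKernel T k) (hk' : IsTraceClassKernel T k') (n : ℕ) :
    ∀ᵐ x : Fin n → Pt d, ∀ i j, k (x i) (x j) = k' (x i) (x j) := by
  rw [ae_all_iff]; intro i
  rw [ae_all_iff]; intro j
  rcases n with _ | n
  · exact i.elim0
  by_cases hij : j = i
  · subst hij
    exact (Measure.quasiMeasurePreserving_eval (fun _ : Fin (n + 1) => (volume : Measure (Pt d))) j).ae (kernel_diag_ae_eq hk hk')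
  obtain ⟨l, rfl⟩ := Fin.exists_succAbove_eq hij
  have h1 : ∀ᵐ a, ∀ᵐ z : Fin n → Pt d, k a (z l) = k' a (z l) := by
    filter_upwards [kernel_ae_eq hk hk'] with a ha
    exact (Measure.quasiMeasurePreserving_eval (fun _ : Fin n => (volume : Measure (Pt d))) l).ae ha
  have hm : MeasurableSet {p : Pt d × (Fin n → Pt d) | k p.1 (p.2 l) = k' p.1 (p.2 l)} := by
    refine measurableSet_eq_fun (hk.measurable.comp (f := fun p : Pt d × (Fin n → Pt d) =>
      (p.1, p.2 l)) (by fun_prop)) (hk'.measurable.comp (f := fun p : Pt d × (Fin n → Pt d) =>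
      (p.1, p.2 l)) (by fun_prop))
  have h2 := (Measure.ae_prod_iff_ae_ae hm).2 h1
  exact (volume_preserving_piFinSuccAbove (fun _ => Pt d) i).quasiMeasurePreserving.ae h2

/-- The correlation functions that belong to two kernels of the same operator agree a.e. -/
lemma det_kernel_ae_eq (hk : IsTraceClassKernel T k) (hk' : IsTraceClassKernel T k') (n : ℕ) :
    ∀ᵐ x : Fin n → Pt d, (Matrix.of fun i j => k (x i) (x j)).det
      = (Matrix.of fun i j => k' (x i) (x j)).det := by
  filter_upwards [kernel_pi_ae_eq hk hk' n] with x hx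
  simp only [hx]

end Uniqueness

/-! ### Configurations -/

section Configurations

variable {d : ℕ}

namespace Config

@[ext] lemma ext {ξ η : Config d} (h : ξ.toMeasure = η.toMeasure) : ξ = η := by
  cases ξ; cases η; simpa using h

lemma coe_num (ξ : Config d) (B : BddBorel d) : (ξ.num B : ℝ≥0∞) = ξ.toMeasure B.1 := by
  obtain ⟨n, hn⟩ := ξ.natValued B.1 B.2.1 B.2.2
  simp [num, hn]

instance : Zero (Config d) := ⟨⟨0, fun _ _ _ => ⟨0, by simp⟩⟩⟩

instance : Add (Config d) := ⟨Config.add⟩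

instance : AddCommMonoid (Config d) where
  add_assoc _ _ _ := ext (add_assoc _ _ _)
  zero_add _ := ext (zero_add _)
  add_zero _ := ext (add_zero _)
  add_comm _ _ := ext (add_comm _ _)
  nsmul := nsmulRec

lemma add_eq (ξ η : Config d) : ξ.add η = ξ + η := rfl

@[simp] lemma toMeasure_add (ξ η : Config d) : (ξ + η).toMeasure = ξ.toMeasure + η.toMeasure := rfl

@[simp] lemma toMeasure_zero : (0 : Config d).toMeasure = 0 := rfl

lemma num_add (ξ η : Config d) (B : BddBorel d) : (ξ + η).num B = ξ.num B + η.num B := by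
  have h : (((ξ + η).num B : ℕ) : ℝ≥0∞) = ((ξ.num B + η.num B : ℕ) : ℝ≥0∞) := by
    push_cast
    simp [coe_num]
  exact_mod_cast h

lemma measurable_num (B : BddBorel d) : Measurable fun ξ : Config d => ξ.num B := by
  refine Measurable.of_comap_le ?_
  exact le_iSup (fun B : BddBorel d => MeasurableSpace.comap (fun ξ : Config d => ξ.num B) ⊤) B

lemma measurable_of_measurable_num {α : Type*} [MeasurableSpace α] {f : α → Config d}
    (h : ∀ B, Measurable fun a => (f a).num B) : Measurable f := by
  refine Measurable.of_le_map (iSup_le fun B => ?_)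
  rw [MeasurableSpace.comap_le_iff_le_map]
  intro s hs
  exact h B hs

lemma measurable_of_measurable_apply {α : Type*} [MeasurableSpace α] {f : α → Config d}
    (h : ∀ B : BddBorel d, Measurable fun a => (f a).toMeasure B.1) : Measurable f :=
  measurable_of_measurable_num fun B => Nat.measurable_floor.comp (h B).ennreal_toReal

lemma measurable_toMeasure : Measurable (toMeasure : Config d → Measure (Pt d)) := by
  refine Measure.measurable_of_measurable_coe _ fun s hs => ?_
  set B : ℕ → BddBorel d := fun n => ⟨s ∩ Metric.ball 0 n,
    Metric.isBounded_ball.subset Set.inter_subset_right, hs.inter measurableSet_ball⟩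
  have hB : ⋃ n, (B n).1 = s := by
    rw [← Set.inter_iUnion, Metric.iUnion_ball_nat, Set.inter_univ]
  have hmono : Monotone fun n => (B n).1 := fun m n hmn =>
    Set.inter_subset_inter_right _ (Metric.ball_subset_ball (by exact_mod_cast hmn))
  have h : ∀ ξ : Config d, ξ.toMeasure s = ⨆ n, (ξ.num (B n) : ℝ≥0∞) := fun ξ => by
    simp only [coe_num]
    rw [← hmono.measure_iUnion, hB]
  simp only [h]
  exact Measurable.iSup fun n => measurable_from_top.comp (measurable_num (B n))

lemma measurable_apply {s : Set (Pt d)} (hs : MeasurableSet s) :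
    Measurable fun ξ : Config d => ξ.toMeasure s :=
  (Measure.measurable_coe hs).comp measurable_toMeasure

instance : MeasurableAdd₂ (Config d) where
  measurable_add := measurable_of_measurable_apply fun B => by
    simp only [toMeasure_add, Measure.add_apply]
    exact ((measurable_apply B.2.2).comp measurable_fst).add
      ((measurable_apply B.2.2).comp measurable_snd)

lemma measurable_restrict {A : Set (Pt d)} (hA : MeasurableSet A) :
    Measurable fun ξ : Config d => ξ.restrict A hA := by
  refine measurable_of_measurable_apply fun B => ?_
  simp only [restrict, Measure.restrict_apply B.2.2]
  exact measurable_apply (B.2.2.inter hA)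

lemma restrict_add (ξ η : Config d) {A : Set (Pt d)} (hA : MeasurableSet A) :
    (ξ + η).restrict A hA = ξ.restrict A hA + η.restrict A hA :=
  ext (Measure.restrict_add _ _ _)

lemma restrict_add_restrict_compl (ξ : Config d) {A : Set (Pt d)} (hA : MeasurableSet A) :
    ξ.restrict A hA + ξ.restrict Aᶜ hA.compl = ξ :=
  ext (Measure.restrict_add_restrict_compl hA)

lemma ofPoints_apply {n : ℕ} (x : Fin n → Pt d) {s : Set (Pt d)} (hs : MeasurableSet s) :
    (ofPoints x).toMeasure s = ∑ i, s.indicator 1 (x i) := by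
  simp [ofPoints, Measure.finsetSum_apply, Measure.dirac_apply' _ hs]

lemma measurable_ofPoints (n : ℕ) : Measurable (ofPoints : (Fin n → Pt d) → Config d) := by
  refine measurable_of_measurable_apply fun B => ?_
  simp only [ofPoints_apply _ B.2.2]
  exact Finset.measurable_sum _ fun i _ =>
    (measurable_one.indicator B.2.2).comp (measurable_pi_apply i)

/-- The configuration with one particle. -/
def single (x : Pt d) : Config d := ofPoints fun _ : Fin 1 => x

lemma toMeasure_single (x : Pt d) : (single x).toMeasure = Measure.dirac x := by
  simp [single, ofPoints]

lemma measurable_single : Measurable (single : Pt d → Config d) :=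
  (measurable_ofPoints 1).comp (measurable_pi_lambda _ fun _ => measurable_id)

lemma ofPoints_fin_zero (x : Fin 0 → Pt d) : ofPoints x = 0 := ext (by simp [ofPoints])

lemma ofPoints_cons {n : ℕ} (x : Pt d) (w : Fin n → Pt d) :
    ofPoints (Fin.cons x w : Fin (n + 1) → Pt d) = single x + ofPoints w := by
  ext1
  rw [toMeasure_add, toMeasure_single]
  simp [ofPoints, Fin.sum_univ_succ]

lemma ofPoints_append {n m : ℕ} (x : Fin n → Pt d) (y : Fin m → Pt d) :
    ofPoints (Fin.append x y) = ofPoints x + ofPoints y := by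
  ext1
  rw [toMeasure_add]
  simp [ofPoints, Fin.sum_univ_add]

lemma ofPoints_univ {n : ℕ} (x : Fin n → Pt d) : (ofPoints x).toMeasure Set.univ = n := by
  simp [ofPoints_apply]

/-- A nonzero finite configuration has an atom. -/
lemma exists_atom (ξ : Config d) (h0 : ξ.toMeasure ≠ 0) :
    ∃ x, 1 ≤ ξ.toMeasure {x} := by
  -- Closed balls around a point of the support have positive integer mass, hence mass at least 1,
  -- and they shrink to the point.
  obtain ⟨x, hx⟩ := Measure.nonempty_support h0
  refine ⟨x, ?_⟩
  have h1 : ∀ n : ℕ, 1 ≤ ξ.toMeasure (Metric.closedBall x (1 / ((n : ℝ) + 1))) := by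
    intro n
    have hp : 0 < ξ.toMeasure (Metric.closedBall x (1 / ((n : ℝ) + 1))) :=
      (Measure.mem_support_iff_forall x).1 hx _
        (Metric.closedBall_mem_nhds x Nat.one_div_pos_of_nat)
    obtain ⟨m, hm⟩ := ξ.natValued _ (Metric.isBounded_closedBall (x := x) (r := 1 / ((n : ℝ) + 1)))
      Metric.isClosed_closedBall.measurableSet
    rw [hm] at hp ⊢
    exact_mod_cast hp
  have h2 : ⋂ n : ℕ, Metric.closedBall x (1 / ((n : ℝ) + 1)) = {x} := by
    ext y
    simp only [Set.mem_iInter, Metric.mem_closedBall, Set.mem_singleton_iff]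
    refine ⟨fun h => ?_, fun h n => by rw [h, dist_self]; positivity⟩
    refine dist_le_zero.1 (ge_of_tendsto' tendsto_one_div_add_atTop_nhds_zero_nat h)
  rw [← h2]
  have h3 := tendsto_measure_iInter_atTop (μ := ξ.toMeasure)
    (s := fun n : ℕ => Metric.closedBall x (1 / ((n : ℝ) + 1)))
    (fun n => Metric.isClosed_closedBall.measurableSet.nullMeasurableSet)
    (fun m n hmn => Metric.closedBall_subset_closedBall (by gcongr)) ?_
  · exact ge_of_tendsto' h3 h1
  · obtain ⟨m, hm⟩ := ξ.natValued _ (Metric.isBounded_closedBall (x := x) (r := 1 / (((0 : ℕ) : ℝ) + 1)))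
      Metric.isClosed_closedBall.measurableSet
    exact ⟨0, by rw [hm]; exact ENNReal.natCast_ne_top m⟩

/-- A finite configuration consists of finitely many points. -/
lemma exists_eq_ofPoints (n : ℕ) (ξ : Config d) (h : ξ.toMeasure Set.univ = n) :
    ∃ (m : ℕ) (x : Fin m → Pt d), ξ = ofPoints x := by
  induction n using Nat.strong_induction_on generalizing ξ with
  | _ n ih =>
    by_cases h0 : ξ.toMeasure = 0
    · exact ⟨0, Fin.elim0, by rw [ofPoints_fin_zero]; exact ext h0⟩
    -- Split off one atom with its whole multiplicity k ≥ 1, so that strong induction applies to the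
    -- rest.
    obtain ⟨x, hx⟩ := exists_atom ξ h0
    have hs : MeasurableSet ({x} : Set (Pt d)) := measurableSet_singleton x
    obtain ⟨k, hk⟩ := ξ.natValued {x} Bornology.isBounded_singleton hs
    have hk1 : 1 ≤ k := by rw [hk] at hx; exact_mod_cast hx
    have hsum : ξ.toMeasure {x} + ξ.toMeasure {x}ᶜ = n := by rw [measure_add_measure_compl hs, h]
    have hkn : k ≤ n := by
      have : (k : ℝ≥0∞) ≤ n := by rw [← hk, ← hsum]; exact le_self_add
      exact_mod_cast this
    have hc : ξ.toMeasure {x}ᶜ = ((n - k : ℕ) : ℝ≥0∞) := by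
      have : (k : ℝ≥0∞) + ξ.toMeasure {x}ᶜ = (k : ℝ≥0∞) + ((n - k : ℕ) : ℝ≥0∞) := by
        rw [← hk, hsum, hk]
        exact_mod_cast (Nat.add_sub_cancel' hkn).symm
      exact (ENNReal.add_right_inj (ENNReal.natCast_ne_top k)).1 this
    obtain ⟨m, y, hy⟩ := ih (n - k) (by omega) (ξ.restrict {x}ᶜ hs.compl) (by
      simp [restrict, hc])
    refine ⟨k + m, Fin.append (fun _ => x) y, ?_⟩
    rw [ofPoints_append, ← hy, ← restrict_add_restrict_compl ξ hs]
    congr 1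
    · ext1
      simp [restrict, Measure.restrict_singleton, hk, ofPoints, Nat.cast_smul_eq_nsmul]
    · rw [restrict_add_restrict_compl]

end Config

end Configurations

/-! ### Independent particles -/

section Poisson

variable {d : ℕ}

open Config

/-- The image of `ν ^ n` in the space of configurations. -/
def powConfig (ν : Measure (Pt d)) (n : ℕ) : Measure (Config d) :=
  (Measure.pi fun _ : Fin n => ν).map ofPoints

/-- The measure `∑ ν ^ n / n!` on the space of finite configurations. -/
def poisson (ν : Measure (Pt d)) : Measure (Config d) :=
  Measure.sum fun n : ℕ => ((n ! : ℕ) : ℝ≥0∞)⁻¹ • powConfig ν n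

lemma lintegral_poisson (ν : Measure (Pt d)) (F : Config d → ℝ≥0∞) :
    ∫⁻ ξ, F ξ ∂poisson ν = ∑' n : ℕ, ((n ! : ℕ) : ℝ≥0∞)⁻¹ * ∫⁻ ξ, F ξ ∂powConfig ν n := by
  simp [poisson, lintegral_sum_measure]

lemma lintegral_powConfig (ν : Measure (Pt d)) (n : ℕ) {F : Config d → ℝ≥0∞} (hF : Measurable F) :
    ∫⁻ ξ, F ξ ∂powConfig ν n = ∫⁻ x, F (ofPoints x) ∂Measure.pi fun _ : Fin n => ν :=
  lintegral_map hF (measurable_ofPoints n)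

lemma lintegral_powConfig_zero (ν : Measure (Pt d)) {F : Config d → ℝ≥0∞} (hF : Measurable F) :
    ∫⁻ ξ, F ξ ∂powConfig ν 0 = F 0 := by
  rw [lintegral_powConfig _ _ hF]
  simp [ofPoints_fin_zero]

variable (ν : Measure (Pt d)) [SigmaFinite ν]

instance (n : ℕ) : SFinite (powConfig ν n) := by
  unfold powConfig
  infer_instance

instance : SFinite (poisson ν) := by
  unfold poisson
  infer_instance

lemma lintegral_powConfig_succ (n : ℕ) {F : Config d → ℝ≥0∞} (hF : Measurable F) :
    ∫⁻ ξ, F ξ ∂powConfig ν (n + 1)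
      = ∫⁻ x, ∫⁻ ξ, F (single x + ξ) ∂powConfig ν n ∂ν := by
  have h1 := (measurePreserving_piFinSuccAbove (fun _ : Fin (n + 1) => ν) 0).symm
  have hm : Measurable fun w : Fin (n + 1) → Pt d => F (ofPoints w) :=
    hF.comp (measurable_ofPoints _)
  rw [lintegral_powConfig _ _ hF, ← h1.lintegral_comp hm,
    lintegral_prod (fun z => F (ofPoints ((MeasurableEquiv.piFinSuccAbove (fun _ => Pt d) 0).symm z)))
      (hm.comp h1.measurable).aemeasurable]
  refine lintegral_congr fun x => ?_
  have hm' : Measurable fun ξ => F (single x + ξ) := hF.comp (measurable_const_add _)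
  rw [lintegral_powConfig _ _ hm']
  refine lintegral_congr fun w => ?_
  rw [← ofPoints_cons, ← Fin.insertNth_zero']
  rfl

lemma measurable_lintegral_single {F : Config d → ℝ≥0∞} (hF : Measurable F)
    (P : Measure (Config d)) [SFinite P] : Measurable fun x => ∫⁻ ξ, F (single x + ξ) ∂P := by
  refine Measurable.lintegral_prod_right' (f := fun q : Pt d × Config d => F (single q.1 + q.2)) ?_
  exact hF.comp ((measurable_single.comp measurable_fst).add measurable_snd)

/-- Mecke's formula for `n + 1` particles. -/
lemma lintegral_powConfig_mul_apply (n : ℕ) {F : Config d → ℝ≥0∞} (hF : Measurable F)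
    {B : Set (Pt d)} (hB : MeasurableSet B) :
    ∫⁻ ξ, ξ.toMeasure B * F ξ ∂powConfig ν (n + 1)
      = (n + 1) * ∫⁻ x in B, ∫⁻ ξ, F (single x + ξ) ∂powConfig ν n ∂ν := by
  have hsingle : ∀ x, (single x).toMeasure B = B.indicator 1 x := fun x => by
    rw [toMeasure_single, Measure.dirac_apply' _ hB]
  have hmul : ∀ {G : Config d → ℝ≥0∞}, Measurable G → Measurable fun ξ => ξ.toMeasure B * G ξ :=
    fun hG => (measurable_apply hB).mul hG
  induction n generalizing F with
  | zero =>
    rw [lintegral_powConfig_succ ν 0 (hmul hF), ← lintegral_indicator hB, Nat.cast_zero, zero_add,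
      one_mul]
    refine lintegral_congr fun x => ?_
    have hm : Measurable fun ξ => F (single x + ξ) := hF.comp (measurable_const_add _)
    have hm2 : Measurable fun ξ => (single x + ξ).toMeasure B * F (single x + ξ) :=
      (hmul hF).comp (measurable_const_add _)
    rw [lintegral_powConfig_zero _ hm2]
    by_cases hx : x ∈ B <;> simp [hx, hsingle, lintegral_powConfig_zero _ hm]
  | succ n ih =>
    have hF' : ∀ x, Measurable fun ξ => F (single x + ξ) := fun x =>
      hF.comp (measurable_const_add _)
    have hS : Measurable fun p : Pt d × Pt d =>
        ∫⁻ ξ, F (single p.1 + (single p.2 + ξ)) ∂powConfig ν n := by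
      refine Measurable.lintegral_prod_right'
        (f := fun q : (Pt d × Pt d) × Config d => F (single q.1.1 + (single q.1.2 + q.2))) ?_
      exact hF.comp ((measurable_single.comp (measurable_fst.comp measurable_fst)).add
        ((measurable_single.comp (measurable_snd.comp measurable_fst)).add measurable_snd))
    -- The particle counted in B is one of the n + 1 others, covered by induction, or x itself.
    have h3 : ∀ x, ∫⁻ ξ, (single x + ξ).toMeasure B * F (single x + ξ) ∂powConfig ν (n + 1)
        = (n + 1) * ∫⁻ y in B, ∫⁻ ξ, F (single x + (single y + ξ)) ∂powConfig ν n ∂ν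
          + B.indicator (fun x => ∫⁻ ξ, F (single x + ξ) ∂powConfig ν (n + 1)) x := by
      intro x
      simp only [toMeasure_add, Measure.add_apply, hsingle]
      rw [lintegral_congr fun ξ => add_mul _ _ _, lintegral_add_left ((hF' x).const_mul _),
        lintegral_const_mul _ (hF' x), ih (hF' x), add_comm (B.indicator 1 x * _)]
      congr 1
      by_cases hx : x ∈ B <;> simp [hx]
    rw [lintegral_powConfig_succ ν (n + 1) (hmul hF)]
    simp only [h3]
    rw [lintegral_add_right _ ((measurable_lintegral_single hF _).indicator hB),
      lintegral_indicator hB, add_mul, one_mul]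
    push_cast
    congr 1
    rw [lintegral_const_mul _ (Measurable.lintegral_prod_right' hS)]
    congr 1
    rw [lintegral_lintegral_swap hS.aemeasurable]
    refine lintegral_congr fun x => ?_
    rw [lintegral_powConfig_succ ν n (hF' x)]
    simp only [add_left_comm]

/-- Mecke's formula. -/
lemma lintegral_poisson_mul_apply {F : Config d → ℝ≥0∞} (hF : Measurable F)
    {B : Set (Pt d)} (hB : MeasurableSet B) :
    ∫⁻ ξ, ξ.toMeasure B * F ξ ∂poisson ν
      = ∫⁻ x in B, ∫⁻ ξ, F (single x + ξ) ∂poisson ν ∂ν := by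
  have hS1 : ∀ m, Measurable fun x => ∫⁻ ξ, F (single x + ξ) ∂powConfig ν m := fun m =>
    measurable_lintegral_single hF _
  have hm : Measurable fun ξ => ξ.toMeasure B * F ξ := (measurable_apply hB).mul hF
  simp only [lintegral_poisson]
  rw [lintegral_tsum fun n => ((hS1 n).const_mul _).aemeasurable, tsum_eq_zero_add'
    ENNReal.summable, lintegral_powConfig_zero ν hm]
  simp only [toMeasure_zero, Measure.coe_zero, Pi.zero_apply, zero_mul, mul_zero, zero_add]
  refine tsum_congr fun n => ?_
  rw [lintegral_powConfig_mul_apply ν n hF hB, lintegral_const_mul _ (hS1 n), ← mul_assoc]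
  congr 1
  rw [Nat.factorial_succ]
  push_cast
  rw [ENNReal.mul_inv (by simp) (by simp), mul_right_comm,
    ENNReal.inv_mul_cancel (by simp) (by simp [ENNReal.add_eq_top]), one_mul]

variable (ν' : Measure (Pt d)) [SigmaFinite ν']

lemma measurable_lintegral_add {F : Config d → ℝ≥0∞} (hF : Measurable F) (P : Measure (Config d))
    [SFinite P] : Measurable fun η => ∫⁻ ξ, F (ξ + η) ∂P := by
  refine Measurable.lintegral_prod_right' (f := fun q : Config d × Config d => F (q.2 + q.1)) ?_
  exact hF.comp (measurable_snd.add measurable_fst)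

/-- The binomial theorem for configurations: the first particle comes from ν or from ν', and
Pascal's rule adds the two cases. -/
lemma lintegral_powConfig_add (N : ℕ) {F : Config d → ℝ≥0∞} (hF : Measurable F) :
    ∫⁻ ξ, F ξ ∂powConfig (ν + ν') N = ∑ p ∈ Finset.HasAntidiagonal.antidiagonal N, (N.choose p.1 : ℝ≥0∞) *
      ∫⁻ η, ∫⁻ ζ, F (ζ + η) ∂powConfig ν p.1 ∂powConfig ν' p.2 := by
  induction N generalizing F with
  | zero =>
    simp only [Finset.Nat.antidiagonal_zero, Finset.sum_singleton, Nat.choose_self, Nat.cast_one,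
      one_mul]
    have hm : Measurable fun ζ => F (ζ + 0) := hF.comp (measurable_add_const _)
    rw [lintegral_powConfig_zero _ hF, lintegral_powConfig_zero _ (measurable_lintegral_add hF _),
      lintegral_powConfig_zero _ hm, add_zero]
  | succ N ih =>
    have hF' : ∀ x, Measurable fun ξ => F (single x + ξ) := fun x =>
      hF.comp (measurable_const_add _)
    have hm : ∀ n, Measurable fun q : Pt d × Config d =>
        ∫⁻ ζ, F (single q.1 + (ζ + q.2)) ∂powConfig ν n := fun n => by
      refine Measurable.lintegral_prod_right'
        (f := fun q : (Pt d × Config d) × Config d => F (single q.1.1 + (q.2 + q.1.2))) ?_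
      exact hF.comp ((measurable_single.comp (measurable_fst.comp measurable_fst)).add
        (measurable_snd.add (measurable_snd.comp measurable_fst)))
    have hm2 : ∀ n m, Measurable fun x =>
        ∫⁻ η, ∫⁻ ζ, F (single x + (ζ + η)) ∂powConfig ν n ∂powConfig ν' m := fun n m =>
      (hm n).lintegral_prod_right'
    set Q : ℕ → ℕ → ℝ≥0∞ := fun n m => ∫⁻ η, ∫⁻ ζ, F (ζ + η) ∂powConfig ν n ∂powConfig ν' m with hQ
    have h1 : ∀ n m, ∫⁻ x, ∫⁻ η, ∫⁻ ζ, F (single x + (ζ + η)) ∂powConfig ν n ∂powConfig ν' m ∂ν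
        = Q (n + 1) m := by
      intro n m
      rw [lintegral_lintegral_swap (hm n).aemeasurable]
      refine lintegral_congr fun η => ?_
      have hm3 : Measurable fun ζ => F (ζ + η) := hF.comp (measurable_add_const _)
      rw [lintegral_powConfig_succ ν n hm3]
      simp only [add_assoc]
    have h2 : ∀ n m, ∫⁻ x, ∫⁻ η, ∫⁻ ζ, F (single x + (ζ + η)) ∂powConfig ν n ∂powConfig ν' m ∂ν'
        = Q n (m + 1) := by
      intro n m
      simp only [hQ]
      rw [lintegral_powConfig_succ ν' m (measurable_lintegral_add hF _)]
      simp only [add_left_comm]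
    have h3 := Finset.sum_antidiagonal_choose_succ_mul Q N
    rw [lintegral_powConfig_succ _ N hF, h3, lintegral_add_measure]
    simp only [ih (hF' _)]
    rw [lintegral_finsetSum _ fun p _ => (hm2 _ _).const_mul _,
      lintegral_finsetSum _ fun p _ => (hm2 _ _).const_mul _, add_comm]
    congr 1
    · refine Finset.sum_congr rfl fun p _ => ?_
      rw [lintegral_const_mul _ (hm2 _ _), h2]
    · refine Finset.sum_congr rfl fun p hp => ?_
      rw [lintegral_const_mul _ (hm2 _ _), h1]
      congr 2
      rw [← Finset.HasAntidiagonal.mem_antidiagonal.1 hp, Nat.choose_symm_add]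

/-- Particles that are distributed by `ν + ν'` are those distributed by `ν` and by `ν'`. -/
lemma lintegral_poisson_add {F : Config d → ℝ≥0∞} (hF : Measurable F) :
    ∫⁻ ξ, F ξ ∂poisson (ν + ν') = ∫⁻ η, ∫⁻ ζ, F (ζ + η) ∂poisson ν ∂poisson ν' := by
  have hm : ∀ n, Measurable fun η => ∫⁻ ζ, F (ζ + η) ∂powConfig ν n := fun n =>
    measurable_lintegral_add hF _
  simp only [lintegral_poisson]
  have h1 : ∀ m, ∫⁻ η, ∑' n : ℕ, ((n ! : ℕ) : ℝ≥0∞)⁻¹ * ∫⁻ ζ, F (ζ + η) ∂powConfig ν n ∂powConfig ν' m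
      = ∑' n : ℕ, ((n ! : ℕ) : ℝ≥0∞)⁻¹ * ∫⁻ η, ∫⁻ ζ, F (ζ + η) ∂powConfig ν n ∂powConfig ν' m := by
    intro m
    rw [lintegral_tsum fun n => ((hm n).const_mul _).aemeasurable]
    simp only [lintegral_const_mul _ (hm _)]
  simp only [h1, lintegral_powConfig_add ν ν' _ hF, ← ENNReal.tsum_mul_left]
  rw [ENNReal.tsum_comm, ← ENNReal.tsum_prod (f := fun n m : ℕ => ((m ! : ℕ) : ℝ≥0∞)⁻¹ *
    (((n ! : ℕ) : ℝ≥0∞)⁻¹ * ∫⁻ η, ∫⁻ ζ, F (ζ + η) ∂powConfig ν n ∂powConfig ν' m)),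
    ← Finset.HasAntidiagonal.sigmaAntidiagonalEquivProd.tsum_eq, ENNReal.tsum_sigma']
  refine tsum_congr fun N => ?_
  rw [tsum_fintype, Finset.mul_sum, ← Finset.sum_coe_sort]
  refine Finset.sum_congr rfl fun p _ => ?_
  obtain ⟨⟨n, m⟩, hp⟩ := p
  obtain rfl : n + m = N := Finset.HasAntidiagonal.mem_antidiagonal.1 hp
  simp only [Finset.HasAntidiagonal.sigmaAntidiagonalEquivProd_apply]
  rw [← mul_assoc, ← mul_assoc]
  congr 1
  -- The binomial coefficient divided by N! is 1/(n! m!).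
  have h := Nat.add_choose_mul_factorial_mul_factorial n m
  rw [← Nat.choose_symm_add] at h
  rw [← h]
  push_cast
  have hc : ((n + m).choose n : ℝ≥0∞) ≠ 0 := by
    exact_mod_cast (Nat.choose_pos (Nat.le_add_right n m)).ne'
  rw [ENNReal.mul_inv (Or.inr (by simp)) (Or.inr (by simp [Nat.factorial_ne_zero])),
    ENNReal.mul_inv (Or.inr (by simp)) (Or.inr (by simp [Nat.factorial_ne_zero])), mul_comm,
    ← mul_assoc, ← mul_assoc, ENNReal.mul_inv_cancel hc (by simp), one_mul, mul_comm]

end Poisson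

/-! ### The determinant as a function of the configuration -/

section ConfigDet

variable {d : ℕ}

open Config ProbabilityTheory

/-- The iterated integral of `G` with respect to `ν ^ N`. -/
def tupleIntegral : (N : ℕ) → ((Fin N → Pt d) → ℝ≥0∞) → Measure (Pt d) → ℝ≥0∞
  | 0, G, _ => G Fin.elim0
  | N + 1, G, ν => ∫⁻ x, tupleIntegral N (fun w => G (Fin.cons x w)) ν ∂ν

/-- Because the integral is iterated, one variable can be treated at a time; the parameter space β
absorbs the points already chosen. -/
lemma measurable_tupleIntegral {Ω : Type} [MeasurableSpace Ω] (κ : Kernel Ω (Pt d))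
    [IsSFiniteKernel κ] (N : ℕ) {β : Type} [MeasurableSpace β] (G : β → (Fin N → Pt d) → ℝ≥0∞)
    (hG : Measurable (Function.uncurry G)) (f : β → Ω) (hf : Measurable f) :
    Measurable fun b => tupleIntegral N (G b) (κ (f b)) := by
  induction N generalizing β with
  | zero => exact hG.comp (measurable_id.prodMk measurable_const)
  | succ N ih =>
    have h := ih (β := β × Pt d) (fun p w => G p.1 (Fin.cons p.2 w)) (by
      refine hG.comp (f := fun q : (β × Pt d) × (Fin N → Pt d) =>
        (q.1.1, (Fin.cons q.1.2 q.2 : Fin (N + 1) → Pt d))) ?_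
      refine (measurable_fst.comp measurable_fst).prodMk (measurable_pi_lambda _ fun i => ?_)
      refine Fin.cases ?_ (fun j => ?_) i
      · simp only [Fin.cons_zero]
        fun_prop
      · simp only [Fin.cons_succ]
        fun_prop) (fun p => f p.1)
      (hf.comp measurable_fst)
    exact Measurable.lintegral_kernel_prod_right (κ := κ.comap f hf)
      (f := fun b x => tupleIntegral N (fun w => G b (Fin.cons x w)) (κ (f b))) h

lemma tupleIntegral_ofPoints {M : ℕ} (w : Fin M → Pt d) (N : ℕ) (G : (Fin N → Pt d) → ℝ≥0∞) :
    tupleIntegral N G (ofPoints w).toMeasure = ∑ τ : Fin N → Fin M, G (w ∘ τ) := by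
  induction N with
  | zero =>
    rw [tupleIntegral, Fintype.sum_unique]
    congr 1
    exact Subsingleton.elim _ _
  | succ N ih =>
    rw [tupleIntegral]
    simp only [ih]
    simp only [ofPoints, lintegral_finsetSum_measure, lintegral_dirac]
    rw [← (Fin.consEquiv fun _ : Fin (N + 1) => Fin M).sum_comp, Fintype.sum_prod_type]
    refine Finset.sum_congr rfl fun i _ => Finset.sum_congr rfl fun τ _ => ?_
    congr 1
    funext j
    refine Fin.cases ?_ (fun k => ?_) j <;> simp [Fin.consEquiv]

/-- The restriction of the kernel `ξ ↦ ξ` to the configurations with at most `N` particles. -/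
def boundedKernel (d N : ℕ) : Kernel (Config d) (Pt d) where
  toFun ξ := open Classical in if ξ.toMeasure Set.univ ≤ N then ξ.toMeasure else 0
  measurable' := Measurable.ite (measurableSet_le (measurable_apply MeasurableSet.univ)
    measurable_const) measurable_toMeasure measurable_const

instance (N : ℕ) : IsFiniteKernel (boundedKernel d N) := by
  refine ⟨⟨N, ENNReal.natCast_lt_top N, fun ξ => ?_⟩⟩
  change (if ξ.toMeasure Set.univ ≤ N then ξ.toMeasure else 0) Set.univ ≤ N
  split_ifs with h
  · exact h
  · simp

/-- The determinant of `J` on a finite configuration, as a measurable function. -/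
def configDet (J : Pt d → Pt d → ℂ) (ξ : Config d) : ℝ≥0∞ :=
  ∑' N : ℕ, {ξ : Config d | ξ.toMeasure Set.univ = N}.indicator (fun ξ => ((N ! : ℕ) : ℝ≥0∞)⁻¹ *
    tupleIntegral N (fun x => ENNReal.ofReal (Matrix.of fun i j => J (x i) (x j)).det.re)
      ξ.toMeasure) ξ

/-- `detConfig` rests on a choice of enumeration. `configDet` averages over all tuples of particles
instead, which makes measurability accessible. -/
lemma measurable_configDet {J : Pt d → Pt d → ℂ} (hJ : Measurable (Function.uncurry J)) :
    Measurable (configDet J) := by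
  refine Measurable.tsum fun N => ?_
  have hs : MeasurableSet {ξ : Config d | ξ.toMeasure Set.univ = N} :=
    measurableSet_eq_fun (measurable_apply MeasurableSet.univ) measurable_const
  have hd : Measurable fun x : Fin N → Pt d =>
      ENNReal.ofReal (Matrix.of fun i j => J (x i) (x j)).det.re := by
    refine (Complex.measurable_re.comp (measurable_det _ fun a b => ?_)).ennreal_ofReal
    exact hJ.comp (f := fun x : Fin N → Pt d => (x a, x b)) (by fun_prop)
  -- An s-finite kernel is required here; on configurations with N particles, ξ ↦ ξ coincides with
  -- the finite kernel `boundedKernel d N`.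
  have h := measurable_tupleIntegral (boundedKernel d N) N (β := Config d)
    (fun _ x => ENNReal.ofReal (Matrix.of fun i j => J (x i) (x j)).det.re)
    (hd.comp measurable_snd) id measurable_id
  have e : {ξ : Config d | ξ.toMeasure Set.univ = N}.indicator (fun ξ => ((N ! : ℕ) : ℝ≥0∞)⁻¹ *
    tupleIntegral N (fun x => ENNReal.ofReal (Matrix.of fun i j => J (x i) (x j)).det.re)
      ξ.toMeasure) = {ξ : Config d | ξ.toMeasure Set.univ = N}.indicator
      (fun ξ => ((N ! : ℕ) : ℝ≥0∞)⁻¹ * tupleIntegral N (fun x =>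
        ENNReal.ofReal (Matrix.of fun i j => J (x i) (x j)).det.re) (boundedKernel d N ξ)) := by
    refine Set.indicator_congr fun ξ hξ => ?_
    have : boundedKernel d N ξ = ξ.toMeasure := if_pos (le_of_eq hξ)
    rw [this]
  rw [e]
  exact (h.const_mul _).indicator hs

/-- Among the nⁿ tuples of indices, those with a repetition have determinant 0, and the n!
permutations share one determinant; the factor 1/n! compensates. -/
lemma configDet_ofPoints (J : Pt d → Pt d → ℂ) {n : ℕ} (x : Fin n → Pt d) :
    configDet J (ofPoints x)
      = ENNReal.ofReal (Matrix.of fun i j => J (x i) (x j)).det.re := by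
  rw [configDet, tsum_eq_single n]
  · rw [Set.indicator_of_mem (by simp [ofPoints_univ]), tupleIntegral_ofPoints]
    have h : ∑ τ : Fin n → Fin n, ENNReal.ofReal
        (Matrix.of fun i j => J ((x ∘ τ) i) ((x ∘ τ) j)).det.re
        = ∑ _σ : Equiv.Perm (Fin n), ENNReal.ofReal (Matrix.of fun i j => J (x i) (x j)).det.re := by
      symm
      refine Finset.sum_of_injOn (fun σ i => σ i) (fun σ _ τ _ h => Equiv.ext (congrFun h))
        (fun _ _ => by simp) (fun τ _ hτ => ?_) fun σ _ => ?_
      · have hni : ¬ Function.Injective τ := fun hi =>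
          hτ ⟨Equiv.ofBijective τ (Finite.injective_iff_bijective.1 hi), by simp, rfl⟩
        simp only [Function.Injective, not_forall] at hni
        obtain ⟨i, j, hij, hne⟩ := hni
        rw [Matrix.det_zero_of_row_eq hne]
        · simp
        · funext k
          simp [hij]
      · congr 2
        exact (Matrix.det_submatrix_equiv_self σ (Matrix.of fun i j => J (x i) (x j))).symm
    rw [h, Finset.sum_const, Finset.card_univ, Fintype.card_perm, Fintype.card_fin, nsmul_eq_mul,
      ← mul_assoc, ENNReal.inv_mul_cancel (by simp [Nat.factorial_ne_zero]) (by simp), one_mul]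
  · intro N hN
    refine Set.indicator_of_notMem ?_ _
    simp only [Set.mem_ofPred_eq, ofPoints_univ]
    exact_mod_cast hN.symm

variable {T : L2 d →L[ℂ] L2 d} {J : Pt d → Pt d → ℂ}

lemma det_nonneg_re (hJ : IsTraceClassKernel T J) {n : ℕ} (x : Fin n → Pt d) :
    0 ≤ (Matrix.of fun i j => J (x i) (x j)).det.re :=
  (Complex.nonneg_iff.1 (hJ.posSemidef_of x).det_nonneg).1

lemma ofReal_detConfig (hJ : IsTraceClassKernel T J) {n : ℕ} (x : Fin n → Pt d) :
    ENNReal.ofReal (detConfig J (ofPoints x)) = configDet J (ofPoints x) ∧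
      0 ≤ detConfig J (ofPoints x) := by
  have h : ∃ (m : ℕ) (y : Fin m → Pt d), ofPoints x = ofPoints y := ⟨n, x, rfl⟩
  rw [detConfig, dif_pos h]
  refine ⟨?_, det_nonneg_re hJ _⟩
  rw [← configDet_ofPoints]
  exact congrArg _ h.choose_spec.choose_spec.symm

/-- A positive semidefinite matrix with nonzero determinant is positive definite, and so are its
principal submatrices. -/
lemma configDet_ne_zero_of_add (hJ : IsTraceClassKernel T J) {n m : ℕ} (x : Fin n → Pt d)
    (y : Fin m → Pt d) (h : configDet J (ofPoints x + ofPoints y) ≠ 0) :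
    configDet J (ofPoints y) ≠ 0 := by
  rw [← ofPoints_append, configDet_ofPoints] at h
  rw [configDet_ofPoints]
  have hp := hJ.posSemidef_of (Fin.append x y)
  have hd : (Matrix.of fun i j => J (Fin.append x y i) (Fin.append x y j)).det ≠ 0 := by
    intro h0
    rw [h0] at h
    simp at h
  have hpd := hp.posDef_iff_det_ne_zero.2 hd
  have h2 := (hpd.submatrix (Fin.natAdd_injective m n)).det_pos
  have e : (Matrix.of fun i j => J (Fin.append x y i) (Fin.append x y j)).submatrix
      (Fin.natAdd n) (Fin.natAdd n) = Matrix.of fun i j => J (y i) (y j) := by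
    ext i j
    simp
  rw [e] at h2
  exact (ENNReal.ofReal_pos.2 (Complex.pos_iff.1 h2).1).ne'

lemma injective_of_configDet_ne_zero {n : ℕ} (x : Fin n → Pt d)
    (h : configDet J (ofPoints x) ≠ 0) : Function.Injective x := by
  by_contra hni
  simp only [Function.Injective, not_forall] at hni
  obtain ⟨i, j, hij, hne⟩ := hni
  refine h ?_
  rw [configDet_ofPoints, Matrix.det_zero_of_row_eq hne]
  · simp
  · funext k
    simp [hij]

/-- Fredholm's identity read as an integral over the configurations added to x. -/
lemma lintegral_poisson_configDet_add (hJ : IsTraceClassKernel T J) {n : ℕ} (x : Fin n → Pt d) :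
    ∫⁻ ζ, configDet J (ofPoints x + ζ) ∂poisson volume
      = ENNReal.ofReal ((Matrix.of fun i j => resKernel hJ (x i) (x j)).det.re
        * (fredholmDet J).re) := by
  obtain ⟨a, ha⟩ := rowsLe_kerRow hJ x x
  have hm : Measurable fun ζ => configDet J (ofPoints x + ζ) :=
    (measurable_configDet hJ.measurable).comp (measurable_const_add _)
  set D : (m : ℕ) → (Fin m → Pt d) → ℂ := fun m z =>
    (bMat J (fun i => kerRow J x (x i)) x z).det with hD
  have h0 : ∀ m (z : Fin m → Pt d), 0 ≤ (D m z).re := fun m z =>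
    (Complex.nonneg_iff.1 (det_bMat_kerRow_nonneg hJ x z)).1
  have h1 : ∀ m (z : Fin m → Pt d), configDet J (ofPoints x + ofPoints z)
      = ENNReal.ofReal (D m z).re := by
    intro m z
    rw [← ofPoints_append, configDet_ofPoints, hD]
    simp only [bMat_kerRow]
    rw [← Matrix.det_submatrix_equiv_self finSumFinEquiv]
    congr 3
    ext a b
    rcases a with a | a <;> rcases b with b | b <;> simp
  have h2 : ∀ m, ∫⁻ ζ, configDet J (ofPoints x + ζ) ∂powConfig volume m
      = ENNReal.ofReal (∫ z, D m z).re := by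
    intro m
    have hi := integrable_det_bMat (m := m) hJ.isDominated ha
    rw [lintegral_powConfig _ _ hm, lintegral_congr (h1 m), ← RCLike.re_to_complex,
      ← integral_re hi, ofReal_integral_eq_lintegral_ofReal hi.re (Eventually.of_forall (h0 m))]
    rfl
  rw [lintegral_poisson]
  simp only [h2]
  have h3 := Complex.hasSum_re (summable_fredholmTerm hJ.isDominated ha).hasSum
  have h4 : ∀ m : ℕ, ((m ! : ℂ)⁻¹ * fredholmTerm J x m fun i => kerRow J x (x i)).re
      = (m ! : ℝ)⁻¹ * (∫ z, D m z).re := by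
    intro m
    rw [← Complex.re_ofReal_mul]
    simp [fredholmTerm, hD]
  simp only [h4] at h3
  have h5 : ∀ m : ℕ, ((m ! : ℕ) : ℝ≥0∞)⁻¹ * ENNReal.ofReal (∫ z, D m z).re
      = ENNReal.ofReal ((m ! : ℝ)⁻¹ * (∫ z, D m z).re) := by
    intro m
    rw [ENNReal.ofReal_mul (by positivity), ENNReal.ofReal_inv_of_pos (by positivity),
      ENNReal.ofReal_natCast]
  have h6 : ∀ m : ℕ, 0 ≤ (m ! : ℝ)⁻¹ * (∫ z, D m z).re := fun m => by
    have hi := integrable_det_bMat (m := m) hJ.isDominated ha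
    rw [← RCLike.re_to_complex, ← integral_re hi]
    exact mul_nonneg (by positivity) (integral_nonneg (h0 m))
  simp only [h5]
  rw [← ENNReal.ofReal_tsum_of_nonneg h6 h3.summable, h3.tsum_eq]
  congr 1
  have h7 := fredholmMinor_eq_det hJ x x
  rw [fredholmMinor] at h7
  rw [h7, (fredholmDet_eq hJ).1, mul_comm, Complex.re_ofReal_mul, mul_comm, Complex.ofReal_re]

end ConfigDet

/-! ### Existence of the fermion random point field -/

section Fermion

variable {d : ℕ}

open Config

/-- The product of falling factorials of the particle numbers. -/
def factorialProd {n m : ℕ} (B : Fin m → BddBorel d) (a : Fin n → Fin m) (ξ : Config d) : ℕ :=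
  ∏ i, (ξ.num (B i)).descFactorial (Finset.univ.filter fun j => a j = i).card

lemma measurable_prod_descFactorial {m : ℕ} (B : Fin m → BddBorel d) (c k : Fin m → ℕ) :
    Measurable fun ξ : Config d =>
      ((∏ i, (ξ.num (B i) - c i).descFactorial (k i) : ℕ) : ℝ≥0∞) := by
  have h : Measurable fun ξ : Config d => ∏ i, (ξ.num (B i) - c i).descFactorial (k i) :=
    Finset.measurable_prod _ fun i _ =>
      (measurable_from_top (f := fun N : ℕ => (N - c i).descFactorial (k i))).comp
        (measurable_num (B i))
  exact (measurable_from_top (f := fun N : ℕ => (N : ℝ≥0∞))).comp h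

lemma measurable_factorialProd {n m : ℕ} (B : Fin m → BddBorel d) (a : Fin n → Fin m) :
    Measurable fun ξ : Config d => (factorialProd B a ξ : ℝ≥0∞) := by
  simpa [factorialProd] using measurable_prod_descFactorial B (fun _ => 0)
    fun i => (Finset.univ.filter fun j => a j = i).card

lemma card_filter_eq_succ {n m : ℕ} (a : Fin (n + 1) → Fin m) (i : Fin m) :
    (Finset.univ.filter fun j => a j = i).card
      = (if a 0 = i then 1 else 0) + (Finset.univ.filter fun j : Fin n => a j.succ = i).card := by
  simp only [Finset.card_filter, Fin.sum_univ_succ]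

/-- The identity (N)_(k+1) = N (N−1)_k for the set containing the first point, in the shape needed
for one application of Mecke's formula. -/
lemma factorialProd_succ {n m : ℕ} (B : Fin m → BddBorel d) (a : Fin (n + 1) → Fin m)
    (ξ : Config d) :
    factorialProd B a ξ = ξ.num (B (a 0)) * ∏ i, (ξ.num (B i) - if a 0 = i then 1 else 0).descFactorial
      (Finset.univ.filter fun j : Fin n => a j.succ = i).card := by
  rw [factorialProd, ← Finset.mul_prod_erase _ _ (Finset.mem_univ (a 0)),
    ← Finset.mul_prod_erase _ _ (Finset.mem_univ (a 0)), ← mul_assoc]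
  congr 1
  · simp only [card_filter_eq_succ, ↓reduceIte]
    rw [Nat.add_comm 1]
    rcases ξ.num (B (a 0)) with _ | N
    · simp
    · rw [Nat.succ_descFactorial_succ, Nat.add_sub_cancel]
  · refine Finset.prod_congr rfl fun i hi => ?_
    have hi' : ¬ a 0 = i := fun h => (Finset.mem_erase.1 hi).1 h.symm
    simp only [card_filter_eq_succ, if_neg hi', zero_add, Nat.sub_zero]

lemma num_single_add {m : ℕ} {B : Fin m → BddBorel d}
    (hB : Pairwise fun i j => Disjoint (B i).1 (B j).1) {i₀ : Fin m} {x : Pt d}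
    (hx : x ∈ (B i₀).1) (ξ : Config d) (i : Fin m) :
    (single x + ξ).num (B i) - (if i₀ = i then 1 else 0) = ξ.num (B i) := by
  have h : ((single x).num (B i) : ℝ≥0∞) = ((if i₀ = i then 1 else 0 : ℕ) : ℝ≥0∞) := by
    rw [coe_num, toMeasure_single, Measure.dirac_apply' _ (B i).2.2]
    split_ifs with hi
    · subst hi
      simp [hx]
    · have : x ∉ (B i).1 := Set.disjoint_left.1 (hB hi) hx
      simp [this]
  have h' : (single x).num (B i) = if i₀ = i then 1 else 0 := by exact_mod_cast h
  rw [num_add, h', Nat.add_sub_cancel_left]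

/-- Mecke's formula iterated: each counted particle becomes an integration variable. Since the sets
are disjoint, lowering one count by 1 gives the counts of the remaining configuration. -/
lemma lintegral_poisson_mul_factorialProd (ν : Measure (Pt d)) [SigmaFinite ν] {n m : ℕ}
    {B : Fin m → BddBorel d} (hB : Pairwise fun i j => Disjoint (B i).1 (B j).1)
    (a : Fin n → Fin m) {G : Config d → ℝ≥0∞} (hG : Measurable G) :
    ∫⁻ ξ, G ξ * factorialProd B a ξ ∂poisson ν
      = ∫⁻ x, ∫⁻ ζ, G (ofPoints x + ζ) ∂poisson ν
        ∂Measure.pi fun j => ν.restrict (B (a j)).1 := by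
  induction n generalizing G with
  | zero =>
    simp [factorialProd, ofPoints_fin_zero]
  | succ n ih =>
    set P : Config d → ℝ≥0∞ := fun ξ =>
      ((∏ i, (ξ.num (B i) - if a 0 = i then 1 else 0).descFactorial
        (Finset.univ.filter fun j : Fin n => a j.succ = i).card : ℕ) : ℝ≥0∞) with hP
    have hPm : Measurable P := measurable_prod_descFactorial B (fun i => if a 0 = i then 1 else 0) _
    have h1 : ∀ ξ, G ξ * factorialProd B a ξ = ξ.toMeasure (B (a 0)).1 * (G ξ * P ξ) := by
      intro ξ
      rw [factorialProd_succ, Nat.cast_mul, coe_num]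
      ring
    simp only [h1]
    rw [lintegral_poisson_mul_apply ν (F := fun ξ => G ξ * P ξ) (hG.mul hPm) (B (a 0)).2.2]
    have h2 : ∀ x ∈ (B (a 0)).1, ∫⁻ ξ, G (single x + ξ) * P (single x + ξ) ∂poisson ν
        = ∫⁻ w, ∫⁻ ζ, G (ofPoints (Fin.cons x w : Fin (n + 1) → Pt d) + ζ) ∂poisson ν
          ∂Measure.pi fun j : Fin n => ν.restrict (B (a j.succ)).1 := by
      intro x hx
      have hGx : Measurable fun ξ => G (single x + ξ) := hG.comp (measurable_const_add _)
      have h3 := ih (fun j => a j.succ) hGx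
      simp only [← add_assoc, ← ofPoints_cons] at h3
      rw [← h3]
      refine lintegral_congr fun ξ => ?_
      congr 1
      simp only [hP, num_single_add hB hx, factorialProd]
    rw [setLIntegral_congr_fun (B (a 0)).2.2 h2]
    have h4 := (measurePreserving_piFinSuccAbove
      (fun j : Fin (n + 1) => ν.restrict (B (a j)).1) 0).symm
    have hm : Measurable fun w : Fin (n + 1) → Pt d => ∫⁻ ζ, G (ofPoints w + ζ) ∂poisson ν := by
      refine Measurable.lintegral_prod_right'
        (f := fun q : (Fin (n + 1) → Pt d) × Config d => G (ofPoints q.1 + q.2)) ?_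
      exact hG.comp (((measurable_ofPoints _).comp measurable_fst).add measurable_snd)
    rw [← h4.lintegral_comp hm]
    refine Eq.trans ?_ (lintegral_prod _ (hm.comp h4.measurable).aemeasurable).symm
    refine lintegral_congr fun x => lintegral_congr fun w => ?_
    rw [← Fin.insertNth_zero']
    rfl

variable {T : L2 d →L[ℂ] L2 d} {J : Pt d → Pt d → ℂ}

/-- The probability measure with density proportional to `det J(ξ, ξ)`. -/
def fermionMeasure (J : Pt d → Pt d → ℂ) : Measure (Config d) :=
  (ENNReal.ofReal (fredholmDet J).re)⁻¹ • (poisson volume).withDensity (configDet J)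

lemma lintegral_fermionMeasure (hJ : IsTraceClassKernel T J) {F : Config d → ℝ≥0∞}
    (hF : Measurable F) :
    ∫⁻ ξ, F ξ ∂fermionMeasure J = (ENNReal.ofReal (fredholmDet J).re)⁻¹ *
      ∫⁻ ξ, configDet J ξ * F ξ ∂poisson volume := by
  rw [fermionMeasure, lintegral_smul_measure,
    lintegral_withDensity_eq_lintegral_mul _ (measurable_configDet hJ.measurable) hF]
  rfl

lemma ofReal_fredholmDet_ne_zero (hJ : IsTraceClassKernel T J) :
    ENNReal.ofReal (fredholmDet J).re ≠ 0 :=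
  (ENNReal.ofReal_pos.2 (zero_lt_one.trans_le (fredholmDet_eq hJ).2)).ne'

lemma lintegral_poisson_configDet (hJ : IsTraceClassKernel T J) :
    ∫⁻ ξ, configDet J ξ ∂poisson volume = ENNReal.ofReal (fredholmDet J).re := by
  have h := lintegral_poisson_configDet_add hJ (Fin.elim0 : Fin 0 → Pt d)
  simpa [ofPoints_fin_zero] using h

lemma isProbabilityMeasure_fermionMeasure (hJ : IsTraceClassKernel T J) :
    IsProbabilityMeasure (fermionMeasure J) := by
  refine ⟨?_⟩
  rw [← lintegral_one, lintegral_fermionMeasure hJ (F := fun _ => 1) measurable_const]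
  simp only [mul_one]
  rw [lintegral_poisson_configDet hJ]
  exact ENNReal.inv_mul_cancel (ofReal_fredholmDet_ne_zero hJ) ENNReal.ofReal_ne_top

lemma det_re_le {S : L2 d →L[ℂ] L2 d} {k : Pt d → Pt d → ℂ} (hk : IsTraceClassKernel S k)
    {n : ℕ} (x : Fin n → Pt d) : (Matrix.of fun i j => k (x i) (x j)).det.re
      ≤ √((n : ℝ) ^ n) * ∏ i, diagSqrt k (x i) ^ 2 := by
  have h := norm_det_le (Matrix.of fun i j => k (x i) (x j)) (fun i => diagSqrt k (x i))
    (fun i => diagSqrt k (x i)) (fun i => hk.isDominated.nonneg _)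
    (fun i => hk.isDominated.nonneg _) fun i j => hk.isDominated.norm_le _ _
  rw [mul_assoc, ← Finset.prod_mul_distrib, Fintype.card_fin] at h
  simp only [sq]
  exact (Complex.re_le_norm _).trans h

lemma integrable_det {S : L2 d →L[ℂ] L2 d} {k : Pt d → Pt d → ℂ} (hk : IsTraceClassKernel S k)
    (n : ℕ) : Integrable fun x : Fin n → Pt d =>
      (Matrix.of fun i j => k (x i) (x j)).det.re := by
  have hm : Measurable fun x : Fin n → Pt d => (Matrix.of fun i j => k (x i) (x j)).det :=
    measurable_det _ fun a b => hk.measurable.comp (f := fun x : Fin n → Pt d => (x a, x b))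
      (by fun_prop)
  refine ((integrable_prod_sq hk.isDominated).const_mul (√((n : ℝ) ^ n))).mono'
    (Complex.measurable_re.comp hm).aestronglyMeasurable (Eventually.of_forall fun x => ?_)
  rw [Real.norm_of_nonneg (det_nonneg_re hk x)]
  exact det_re_le hk x

/-- Mecke's formula reduces a factorial moment to integrals of `configDet` with the points x added;
these are det K · det(1+T), and the normalisation removes det(1+T). -/
theorem isFermion_fermionMeasure (hJ : IsTraceClassKernel T J) :
    IsFermion (fermionMeasure J) (resolventOp T) := by
  have hK := isTraceClassKernel_resKernel hJ
  refine ⟨isProbabilityMeasure_fermionMeasure hJ, resKernel hJ, hK, fun n => ⟨?_, ?_, ?_⟩⟩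
  · exact (integrable_det hK n).locallyIntegrable
  · exact fun x => det_nonneg_re hK x
  · intro m B hB a
    have h1 := lintegral_fermionMeasure hJ (measurable_factorialProd B a)
    have h2 := lintegral_poisson_mul_factorialProd volume hB a (measurable_configDet hJ.measurable)
    rw [h2] at h1
    change ∫⁻ ξ, (factorialProd B a ξ : ℝ≥0∞) ∂fermionMeasure J = _
    rw [h1]
    simp only [lintegral_poisson_configDet_add hJ]
    have h3 : (Measure.pi fun j => (volume : Measure (Pt d)).restrict (B (a j)).1)
        = (volume : Measure (Fin n → Pt d)).restrict {x | ∀ j, x j ∈ (B (a j)).1} := by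
      rw [← Measure.restrict_pi_pi, volume_pi]
      congr 1
      ext x
      simp
    rw [h3]
    simp only [ENNReal.ofReal_mul (det_nonneg_re hK _)]
    rw [lintegral_mul_const', mul_comm, mul_assoc, ENNReal.mul_inv_cancel
      (ofReal_fredholmDet_ne_zero hJ) ENNReal.ofReal_ne_top, mul_one]
    exact ENNReal.ofReal_ne_top

end Fermion

/-! ### Factorial moments determine the law -/

section FactorialMoments

/-- Binomial inversion: C(k,c) C(n,k) = C(n,c) C(n−c,k−c), and the alternating sum of the last
factor vanishes unless n = c. -/
lemma sum_neg_one_pow_choose_mul_choose (n c : ℕ) :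
    ∑ k ∈ Finset.range (n + 1), (-1 : ℤ) ^ (k + c) * (k.choose c * n.choose k)
      = if n = c then 1 else 0 := by
  rcases lt_or_ge n c with h | h
  · rw [if_neg h.ne]
    refine Finset.sum_eq_zero fun k hk => ?_
    rw [Nat.choose_eq_zero_of_lt (by have := Finset.mem_range.1 hk; omega)]
    simp
  · obtain ⟨l, rfl⟩ := Nat.exists_eq_add_of_le h
    rw [add_assoc, Finset.sum_range_add]
    have h1 : ∑ k ∈ Finset.range c, (-1 : ℤ) ^ (k + c) * (k.choose c * (c + l).choose k) = 0 :=
      Finset.sum_eq_zero fun k hk => by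
        rw [Nat.choose_eq_zero_of_lt (Finset.mem_range.1 hk)]
        simp
    have h2 : ∀ j ∈ Finset.range (l + 1), (-1 : ℤ) ^ (c + j + c) * ((c + j).choose c *
        (c + l).choose (c + j)) = (c + l).choose c * ((-1) ^ j * l.choose j) := by
      intro j hj
      have hj' : j ≤ l := by have := Finset.mem_range.1 hj; omega
      have h3 := Nat.choose_mul (n := c + l) (k := c + j) (s := c) (by omega)
      rw [Nat.add_sub_cancel_left, Nat.add_sub_cancel_left] at h3
      have h4 : (-1 : ℤ) ^ (c + j + c) = (-1) ^ j := by
        rw [show c + j + c = 2 * c + j by ring, pow_add, pow_mul]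
        simp
      have h5 : ((c + j).choose c * (c + l).choose (c + j) : ℤ)
          = (c + l).choose c * l.choose j := by
        rw [mul_comm]
        exact_mod_cast h3
      rw [h4, h5]
      ring
    rw [h1, zero_add, Finset.sum_congr rfl h2, ← Finset.mul_sum, Int.alternating_sum_range_choose]
    by_cases hl : l = 0
    · simp [hl]
    · simp [hl]

/-- The parity-filtered coefficients in the expansion of an indicator in falling factorials. -/
def parityCoeff (b : Bool) (c k : ℕ) : ℝ≥0∞ :=
  if decide (Even (k + c)) = b then ((k ! : ℕ) : ℝ≥0∞)⁻¹ * k.choose c else 0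

/-- The expansion of an indicator in falling factorials alternates in sign; the negative terms are
moved to the left so that it makes sense in `ℝ≥0∞`. -/
lemma ite_add_tsum_parityCoeff (n c : ℕ) :
    (if n = c then 1 else 0) + ∑' k, parityCoeff false c k * n.descFactorial k
      = ∑' k, parityCoeff true c k * n.descFactorial k := by
  have h1 : ∀ b k, parityCoeff b c k * n.descFactorial k
      = ((if decide (Even (k + c)) = b then k.choose c * n.choose k else 0 : ℕ) : ℝ≥0∞) := by
    intro b k
    rw [parityCoeff]
    split_ifs
    · rw [Nat.descFactorial_eq_factorial_mul_choose, Nat.cast_mul, Nat.cast_mul,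
        mul_right_comm, ← mul_assoc, ENNReal.inv_mul_cancel
        (by simp [Nat.factorial_ne_zero]) (by simp), one_mul, mul_comm]
    · simp
  have h2 : ∀ b, ∑' k, parityCoeff b c k * n.descFactorial k
      = ((∑ k ∈ Finset.range (n + 1),
        if decide (Even (k + c)) = b then k.choose c * n.choose k else 0 : ℕ) : ℝ≥0∞) := by
    intro b
    rw [tsum_eq_sum (s := Finset.range (n + 1)), Nat.cast_sum]
    · exact Finset.sum_congr rfl fun k _ => h1 b k
    · intro k hk
      rw [Nat.descFactorial_eq_zero_iff_lt.2 (by simpa using hk)]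
      simp
  rw [h2, h2]
  have h3 := sum_neg_one_pow_choose_mul_choose n c
  have h4 : ∀ k, (-1 : ℤ) ^ (k + c) * (k.choose c * n.choose k)
      = ((if decide (Even (k + c)) = true then k.choose c * n.choose k else 0 : ℕ) : ℤ)
        - ((if decide (Even (k + c)) = false then k.choose c * n.choose k else 0 : ℕ) : ℤ) := by
    intro k
    by_cases he : Even (k + c)
    · simp [he]
    · simp [he, (Nat.not_even_iff_odd.1 he).neg_one_pow]
  simp only [h4, Finset.sum_sub_distrib] at h3
  have h5 : (if n = c then 1 else 0) + (∑ k ∈ Finset.range (n + 1),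
        if decide (Even (k + c)) = false then k.choose c * n.choose k else 0)
      = ∑ k ∈ Finset.range (n + 1),
        if decide (Even (k + c)) = true then k.choose c * n.choose k else 0 := by
    refine Nat.cast_injective (R := ℤ) ?_
    push_cast at h3 ⊢
    linarith
  rw [← h5]
  push_cast
  rfl

variable {Ω : Type*} [MeasurableSpace Ω]

lemma measurable_cast_descFactorial {N : Ω → ℕ} (hN : Measurable N) (k : ℕ) :
    Measurable fun ω => ((N ω).descFactorial k : ℝ≥0∞) :=
  (measurable_from_top (f := fun n : ℕ => (n.descFactorial k : ℝ≥0∞))).comp hN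

lemma lintegral_ite_add_tsum (μ : Measure Ω) {N : Ω → ℕ} (hN : Measurable N) {W : Ω → ℝ≥0∞}
    (hW : Measurable W) (c : ℕ) :
    ∫⁻ ω, (if N ω = c then 1 else 0) * W ω ∂μ
        + ∑' k, parityCoeff false c k * ∫⁻ ω, (N ω).descFactorial k * W ω ∂μ
      = ∑' k, parityCoeff true c k * ∫⁻ ω, (N ω).descFactorial k * W ω ∂μ := by
  have hm : ∀ k, Measurable fun ω => ((N ω).descFactorial k : ℝ≥0∞) * W ω := fun k =>
    (measurable_cast_descFactorial hN k).mul hW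
  have h1 : ∀ b, ∑' k, parityCoeff b c k * ∫⁻ ω, (N ω).descFactorial k * W ω ∂μ
      = ∫⁻ ω, (∑' k, parityCoeff b c k * (N ω).descFactorial k) * W ω ∂μ := by
    intro b
    simp only [← ENNReal.tsum_mul_right, mul_assoc]
    rw [lintegral_tsum fun k => ((hm k).const_mul _).aemeasurable]
    simp only [lintegral_const_mul _ (hm _)]
  have h2 : Measurable fun ω => (∑' k, parityCoeff false c k * (N ω).descFactorial k) * W ω :=
    (Measurable.tsum fun k => (measurable_cast_descFactorial hN k).const_mul _).mul hW
  rw [h1, h1, ← lintegral_add_right _ h2]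
  refine lintegral_congr fun ω => ?_
  rw [← add_mul, ite_add_tsum_parityCoeff]

/-- Both measures have the same moment series, and the one on the left is finite, so it cancels. The
factor 2^k in `hs` bounds the binomial coefficient C(k,c). -/
lemma lintegral_ite_eq_of_moments (μ μ' : Measure Ω) {N : Ω → ℕ} (hN : Measurable N)
    {W : Ω → ℝ≥0∞} (hW : Measurable W)
    (h : ∀ k, ∫⁻ ω, (N ω).descFactorial k * W ω ∂μ = ∫⁻ ω, (N ω).descFactorial k * W ω ∂μ')
    (hs : ∑' k, ((k ! : ℕ) : ℝ≥0∞)⁻¹ * 2 ^ k * ∫⁻ ω, (N ω).descFactorial k * W ω ∂μ ≠ ∞) (c : ℕ) :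
    ∫⁻ ω, (if N ω = c then 1 else 0) * W ω ∂μ = ∫⁻ ω, (if N ω = c then 1 else 0) * W ω ∂μ' := by
  have h1 := lintegral_ite_add_tsum μ hN hW c
  have h2 := lintegral_ite_add_tsum μ' hN hW c
  simp only [← h] at h2
  rw [← h2] at h1
  refine (ENNReal.add_left_inj (ne_top_of_le_ne_top hs ?_)).1 h1
  refine ENNReal.tsum_le_tsum fun k => mul_le_mul_left ?_ _
  rw [parityCoeff]
  split_ifs
  · refine mul_le_mul_right ?_ _
    exact_mod_cast Nat.choose_le_two_pow k c
  · exact zero_le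

variable {m : ℕ}

/-- A product of indicators (for the indices in `S`) and falling factorials. -/
def mixedProd (S : Finset (Fin m)) (c k N : Fin m → ℕ) : ℝ≥0∞ :=
  ∏ i, if i ∈ S then (if N i = c i then 1 else 0) else ((N i).descFactorial (k i) : ℝ≥0∞)

lemma measurable_mixedFactor {N : Ω → Fin m → ℕ} (hN : Measurable N) (S : Finset (Fin m))
    (c k : Fin m → ℕ) (i : Fin m) : Measurable fun ω => (if i ∈ S then
      (if N ω i = c i then 1 else 0) else ((N ω i).descFactorial (k i) : ℝ≥0∞)) :=
  (measurable_from_top (f := fun n : ℕ => if i ∈ S then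
    (if n = c i then 1 else 0) else (n.descFactorial (k i) : ℝ≥0∞))).comp
    ((measurable_pi_apply i).comp hN)

/-- One falling factorial at a time is exchanged for an indicator. -/
lemma lintegral_mixedProd_eq (μ μ' : Measure Ω) {N : Ω → Fin m → ℕ} (hN : Measurable N)
    (h : ∀ k : Fin m → ℕ, ∫⁻ ω, ∏ i, ((N ω i).descFactorial (k i) : ℝ≥0∞) ∂μ
      = ∫⁻ ω, ∏ i, ((N ω i).descFactorial (k i) : ℝ≥0∞) ∂μ')
    (hs : ∀ (k : Fin m → ℕ) (i : Fin m), ∑' l : ℕ, ((l ! : ℕ) : ℝ≥0∞)⁻¹ * 2 ^ l *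
      ∫⁻ ω, ∏ j, ((N ω j).descFactorial (Function.update k i l j) : ℝ≥0∞) ∂μ ≠ ∞)
    (S : Finset (Fin m)) (c k : Fin m → ℕ) :
    ∫⁻ ω, mixedProd S c k (N ω) ∂μ = ∫⁻ ω, mixedProd S c k (N ω) ∂μ' := by
  induction S using Finset.induction_on generalizing k with
  | empty => simpa [mixedProd] using h k
  | insert i S hi ih =>
    set W : Ω → ℝ≥0∞ := fun ω => ∏ j ∈ Finset.univ.erase i, if j ∈ S then
      (if N ω j = c j then 1 else 0) else ((N ω j).descFactorial (k j) : ℝ≥0∞) with hWdef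
    have hW : Measurable W := Finset.measurable_fun_prod _ fun j _ =>
      measurable_mixedFactor hN S c k j
    have hNi : Measurable fun ω => N ω i := (measurable_pi_apply i).comp hN
    have h1 : ∀ ω, mixedProd (insert i S) c k (N ω) = (if N ω i = c i then 1 else 0) * W ω := by
      intro ω
      rw [mixedProd, ← Finset.mul_prod_erase _ _ (Finset.mem_univ i)]
      congr 1
      · simp
      · refine Finset.prod_congr rfl fun j hj => ?_
        simp [Finset.ne_of_mem_erase hj]
    have h2 : ∀ l ω, mixedProd S c (Function.update k i l) (N ω)
        = (N ω i).descFactorial l * W ω := by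
      intro l ω
      rw [mixedProd, ← Finset.mul_prod_erase _ _ (Finset.mem_univ i)]
      congr 1
      · simp [hi]
      · refine Finset.prod_congr rfl fun j hj => ?_
        simp [Finset.ne_of_mem_erase hj]
    simp only [h1]
    refine lintegral_ite_eq_of_moments μ μ' hNi hW (fun l => ?_) ?_ (c i)
    · simpa only [h2] using ih (Function.update k i l)
    -- Indicators already present are at most 1, the falling factorial of order 0, so `hs` applies
    -- with those orders set to 0.
    · refine ne_top_of_le_ne_top (hs (fun j => if j ∈ S then 0 else k j) i) ?_
      refine ENNReal.tsum_le_tsum fun l => mul_le_mul_right (lintegral_mono fun ω => ?_) _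
      simp only [← h2, mixedProd]
      refine Finset.prod_le_prod' fun j _ => ?_
      by_cases hj : j = i
      · subst hj
        simp [hi]
      · by_cases hjS : j ∈ S
        · simp only [hjS, if_true, Function.update_of_ne hj, Nat.descFactorial_zero]
          split_ifs <;> simp
        · simp [hjS, hj]

/-- Two measures with the same factorial moments, of moderate growth, are equal. -/
lemma map_eq_of_moments (μ μ' : Measure Ω) {N : Ω → Fin m → ℕ} (hN : Measurable N)
    (h : ∀ k : Fin m → ℕ, ∫⁻ ω, ∏ i, ((N ω i).descFactorial (k i) : ℝ≥0∞) ∂μ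
      = ∫⁻ ω, ∏ i, ((N ω i).descFactorial (k i) : ℝ≥0∞) ∂μ')
    (hs : ∀ (k : Fin m → ℕ) (i : Fin m), ∑' l : ℕ, ((l ! : ℕ) : ℝ≥0∞)⁻¹ * 2 ^ l *
      ∫⁻ ω, ∏ j, ((N ω j).descFactorial (Function.update k i l j) : ℝ≥0∞) ∂μ ≠ ∞) :
    μ.map N = μ'.map N := by
  refine Measure.ext_of_singleton fun c => ?_
  rw [Measure.map_apply hN (measurableSet_singleton c),
    Measure.map_apply hN (measurableSet_singleton c)]
  have h1 := lintegral_mixedProd_eq μ μ' hN h hs Finset.univ c 0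
  have h2 : ∀ ω, mixedProd Finset.univ c 0 (N ω) = (N ⁻¹' {c}).indicator 1 ω := by
    intro ω
    by_cases hc : N ω = c
    · simp [mixedProd, hc]
    · rw [Set.indicator_of_notMem (by simpa using hc)]
      obtain ⟨i, hi⟩ := Function.ne_iff.1 hc
      exact Finset.prod_eq_zero (Finset.mem_univ i) (by simp [hi])
  simpa only [h2, lintegral_indicator_one (hN (measurableSet_singleton c))] using h1

end FactorialMoments

/-! ### Uniqueness of the fermion random point field -/

section Uniqueness

variable {d : ℕ}

open Config

lemma measurable_num_family {ι : Type*} (B : ι → BddBorel d) :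
    Measurable fun (ξ : Config d) i => ξ.num (B i) :=
  measurable_pi_lambda _ fun i => measurable_num (B i)

/-- The atom of the family `B` with signature `s`. -/
def atom {ι : Type*} [Finite ι] (B : ι → BddBorel d) (s : ι → Bool) : BddBorel d :=
  ⟨(⋃ i, (B i).1) ∩ ⋂ i, (if s i then (B i).1 else (B i).1ᶜ),
    (Bornology.isBounded_iUnion.2 fun i => (B i).2.1).subset Set.inter_subset_left, by
      refine (MeasurableSet.iUnion fun i => (B i).2.2).inter (MeasurableSet.iInter fun i => ?_)
      split_ifs
      · exact (B i).2.2
      · exact (B i).2.2.compl⟩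

lemma mem_atom {ι : Type*} [Finite ι] {B : ι → BddBorel d} {s : ι → Bool} {x : Pt d} :
    x ∈ (atom B s).1 ↔ (∃ i, x ∈ (B i).1) ∧ ∀ i, x ∈ (B i).1 ↔ s i = true := by
  simp only [atom, Set.mem_inter_iff, Set.mem_iUnion, Set.mem_iInter]
  refine and_congr_right fun _ => forall_congr' fun i => ?_
  cases s i <;> simp

lemma disjoint_atom {ι : Type*} [Finite ι] (B : ι → BddBorel d) {s t : ι → Bool} (h : s ≠ t) :
    Disjoint (atom B s).1 (atom B t).1 := by
  refine Set.disjoint_left.2 fun x hs ht => h (funext fun i => ?_)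
  have h1 := (mem_atom.1 hs).2 i
  have h2 := (mem_atom.1 ht).2 i
  exact Bool.eq_iff_iff.2 (h1.symm.trans h2)

lemma num_eq_sum_atom {ι : Type*} [Fintype ι] [DecidableEq ι] (B : ι → BddBorel d) (ξ : Config d) (i : ι) :
    ξ.num (B i) = ∑ s : ι → Bool, if s i then ξ.num (atom B s) else 0 := by
  have h : (B i).1 = ⋃ s ∈ Finset.univ.filter fun s : ι → Bool => s i = true, (atom B s).1 := by
    ext x
    simp only [Finset.mem_filter, Finset.mem_univ, true_and, Set.mem_iUnion, exists_prop]
    constructor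
    · intro hx
      classical
      exact ⟨fun j => decide (x ∈ (B j).1), by simpa using hx, mem_atom.2 ⟨⟨i, hx⟩, by simp⟩⟩
    · rintro ⟨s, hs, hx⟩
      exact ((mem_atom.1 hx).2 i).2 hs
  have h2 : (ξ.num (B i) : ℝ≥0∞) = ∑ s : ι → Bool, if s i then ξ.toMeasure (atom B s).1 else 0 := by
    rw [coe_num, h, measure_biUnion_finset (fun s _ t _ hst => disjoint_atom B hst)
      fun s _ => (atom B s).2.2, Finset.sum_filter]
  have h3 : (ξ.num (B i) : ℝ≥0∞)
      = ((∑ s : ι → Bool, if s i then ξ.num (atom B s) else 0 : ℕ) : ℝ≥0∞) := by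
    rw [h2]
    push_cast
    simp only [coe_num]
  exact_mod_cast h3

/-- A random point field is determined by the joint laws of the particle numbers in disjoint
sets. -/
lemma ext_of_map_disjoint {μ μ' : Measure (Config d)} [IsProbabilityMeasure μ]
    [IsProbabilityMeasure μ']
    (h : ∀ (m : ℕ) (B : Fin m → BddBorel d), (Pairwise fun i j => Disjoint (B i).1 (B j).1) →
      μ.map (fun ξ i => ξ.num (B i)) = μ'.map fun ξ i => ξ.num (B i)) : μ = μ' := by
  -- Counts in an arbitrary finite family are sums of counts in the disjoint atoms that it
  -- generates. The events defined by finitely many counts then form a generating π-system.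
  have h1 : ∀ (ι : Type) [Fintype ι] (B : ι → BddBorel d),
      μ.map (fun ξ i => ξ.num (B i)) = μ'.map fun ξ i => ξ.num (B i) := by
    intro ι _ B
    classical
    set e := Fintype.equivFin (ι → Bool)
    have h2 := h _ (fun a => atom B (e.symm a)) fun a b hab =>
      disjoint_atom B (e.symm.injective.ne hab)
    set g : (Fin (Fintype.card (ι → Bool)) → ℕ) → ι → ℕ := fun N i =>
      ∑ s : ι → Bool, if s i then N (e s) else 0
    have hg : Measurable g := measurable_of_countable g
    have h3 : (fun (ξ : Config d) i => ξ.num (B i))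
        = g ∘ fun ξ a => ξ.num (atom B (e.symm a)) := by
      funext ξ i
      simp [g, num_eq_sum_atom B ξ i]
    rw [h3, ← Measure.map_map hg (measurable_num_family _), h2,
      Measure.map_map hg (measurable_num_family _)]
  set π : BddBorel d → Set (Set (Config d)) := fun B =>
    {s | MeasurableSet[MeasurableSpace.comap (fun ξ : Config d => ξ.num B) ⊤] s}
  have hπ : ∀ B, IsPiSystem (π B) := fun B => @MeasurableSpace.isPiSystem_measurableSet _
    (MeasurableSpace.comap (fun ξ : Config d => ξ.num B) ⊤)
  refine ext_of_generate_finite (piiUnionInter π Set.univ) ?_ (isPiSystem_piiUnionInter π hπ _) ?_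
    (by simp)
  · refine Eq.trans ?_ (generateFrom_piiUnionInter_measurableSet
      (fun B : BddBorel d => MeasurableSpace.comap (fun ξ : Config d => ξ.num B) ⊤) Set.univ).symm
    simp [instMeasurableSpaceConfig]
  · rintro s ⟨t, -, f, hf, rfl⟩
    choose! u hu using hf
    have h4 : (⋂ B ∈ t, f B) = (fun (ξ : Config d) (B : t) => ξ.num B.1) ⁻¹'
        {N | ∀ B : t, N B ∈ u B.1} := by
      ext ξ
      simp only [Set.mem_iInter, Set.mem_preimage, Set.mem_ofPred_eq, Subtype.forall]
      refine forall₃_congr fun B hB hBt => ?_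
      rw [← (hu _ hBt).2]
      rfl
    have hm := measurable_num_family (fun B : t => B.1)
    have hms : MeasurableSet {N : t → ℕ | ∀ B : t, N B ∈ u B.1} := Set.to_countable _ |>.measurableSet
    have h5 := congrArg (fun ν => ν {N : t → ℕ | ∀ B : t, N B ∈ u B.1}) (h1 t fun B : t => B.1)
    rw [h4]
    simpa only [Measure.map_apply hm hms] using h5

lemma exists_card_fiber_eq {m : ℕ} (k : Fin m → ℕ) :
    ∃ a : Fin (∑ i, k i) → Fin m, ∀ i, (Finset.univ.filter fun j => a j = i).card = k i := by
  refine ⟨fun j => (finSigmaFinEquiv.symm j).1, fun i => ?_⟩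
  rw [Finset.card_filter, ← finSigmaFinEquiv.sum_comp, Fintype.sum_sigma]
  simp [Finset.sum_ite_eq']

variable {S : L2 d →L[ℂ] L2 d} {k : Pt d → Pt d → ℂ}

lemma lintegral_det_le (hk : IsTraceClassKernel S k) (n : ℕ) :
    ∫⁻ x : Fin n → Pt d, ENNReal.ofReal (Matrix.of fun i j => k (x i) (x j)).det.re
      ≤ ENNReal.ofReal (√((n : ℝ) ^ n) * (∫ x, diagSqrt k x ^ 2) ^ n) := by
  have hi := (integrable_prod_sq (m := n) hk.isDominated).const_mul (√((n : ℝ) ^ n))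
  refine (lintegral_mono fun x => ENNReal.ofReal_le_ofReal (det_re_le hk x)).trans ?_
  rw [← ofReal_integral_eq_lintegral_ofReal hi (Eventually.of_forall fun x => by positivity),
    integral_const_mul, volume_pi, integral_fintype_prod_eq_pow (fun x => diagSqrt k x ^ 2),
    Fintype.card_fin]

/-- Hadamard's square root is decisive: √(N^N) tᴺ with N = s + l is summable against 2^l / l!. -/
lemma tsum_moment_bound_ne_top (s : ℕ) {t : ℝ} (ht : 0 ≤ t) :
    ∑' l : ℕ, ((l ! : ℕ) : ℝ≥0∞)⁻¹ * 2 ^ l *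
      ENNReal.ofReal (√(((s + l : ℕ) : ℝ) ^ (s + l)) * t ^ (s + l)) ≠ ∞ := by
  have h := (summable_sqrt_pow_self s (2 * t) (by positivity)).mul_left (t ^ s)
  have h1 : ∀ l : ℕ, ((l ! : ℕ) : ℝ≥0∞)⁻¹ * 2 ^ l *
      ENNReal.ofReal (√(((s + l : ℕ) : ℝ) ^ (s + l)) * t ^ (s + l))
      = ENNReal.ofReal (t ^ s * (√(((s + l : ℕ) : ℝ) ^ (s + l)) * ((2 * t) ^ l / (l ! : ℝ)))) := by
    intro l
    rw [show (2 : ℝ≥0∞) ^ l = ENNReal.ofReal (2 ^ l) by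
      rw [ENNReal.ofReal_pow (by norm_num)]; simp,
      ← ENNReal.ofReal_natCast (l !), ← ENNReal.ofReal_inv_of_pos (by positivity),
      ← ENNReal.ofReal_mul (by positivity), ← ENNReal.ofReal_mul (by positivity)]
    congr 1
    rw [mul_pow, pow_add t]
    field_simp
  simp only [h1]
  exact h.tsum_ofReal_ne_top

/-- The two fields may come with different versions of the kernel; the determinants agree almost
everywhere, so all factorial moments agree. -/
theorem IsFermion.unique {μ μ' : Measure (Config d)} (h : IsFermion μ S) (h' : IsFermion μ' S) :
    μ = μ' := by
  obtain ⟨hμ, k, hk, hc⟩ := h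
  obtain ⟨hμ', k', hk', hc'⟩ := h'
  refine ext_of_map_disjoint fun m B hB => ?_
  -- The domain A is fixed before the measure and the kernel, so that both fields are integrated
  -- over the same set.
  have h1 : ∀ c : Fin m → ℕ, ∃ A : Set (Fin (∑ i, c i) → Pt d),
      ∀ (ν : Measure (Config d)) (κ : Pt d → Pt d → ℂ), (∀ n : ℕ, IsCorrelationFunction ν n
      fun x => (Matrix.det (Matrix.of fun i j => κ (x i) (x j))).re) →
      ∫⁻ ξ, ∏ i, ((ξ.num (B i)).descFactorial (c i) : ℝ≥0∞) ∂ν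
        = ∫⁻ x in A, ENNReal.ofReal (Matrix.det (Matrix.of fun i j => κ (x i) (x j))).re := by
    intro c
    obtain ⟨a, ha⟩ := exists_card_fiber_eq c
    refine ⟨{x | ∀ j, x j ∈ (B (a j)).1}, fun ν κ hν => ?_⟩
    have h := (hν _).factorial_moment m B hB a
    simp only [ha, Nat.cast_prod] at h
    exact h
  refine map_eq_of_moments μ μ' (measurable_num_family B) (fun c => ?_) fun c i => ?_
  · obtain ⟨A, hA⟩ := h1 c
    rw [hA μ k hc, hA μ' k' hc']
    refine lintegral_congr_ae (ae_restrict_of_ae ?_)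
    filter_upwards [det_kernel_ae_eq hk hk' (∑ i, c i)] with x hx
    rw [hx]
  · have ht : 0 ≤ ∫ x, diagSqrt k x ^ 2 := integral_nonneg fun x => sq_nonneg _
    refine ne_top_of_le_ne_top
      (tsum_moment_bound_ne_top (∑ j ∈ Finset.univ.erase i, c j) ht) ?_
    refine ENNReal.tsum_le_tsum fun l => mul_le_mul_right ?_ _
    obtain ⟨A, hA⟩ := h1 (Function.update c i l)
    rw [hA μ k hc]
    refine (setLIntegral_le_lintegral _ _).trans ((lintegral_det_le hk _).trans (le_of_eq ?_))
    have h2 : ∑ j, Function.update c i l j = (∑ j ∈ Finset.univ.erase i, c j) + l := by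
      rw [Finset.sum_update_of_mem (Finset.mem_univ i), add_comm, Finset.sdiff_singleton_eq_erase]
    rw [h2]

end Uniqueness

/-! ### The energy of finite configurations -/

section Energy

variable {d : ℕ}

open Config

lemma exists_restrict_ofPoints {n : ℕ} (w : Fin n → Pt d) {A : Set (Pt d)} (hA : MeasurableSet A) :
    ∃ (m : ℕ) (y : Fin m → Pt d), (ofPoints w).restrict A hA = ofPoints y := by
  classical
  refine exists_eq_ofPoints (∑ i, if w i ∈ A then 1 else 0) _ ?_
  simp [restrict, ofPoints_apply _ hA, Set.indicator_apply]

lemma restrict_eq_zero {ξ : Config d} {A : Set (Pt d)} (hA : MeasurableSet A)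
    (h : ξ.toMeasure A = 0) : ξ.restrict A hA = 0 :=
  ext (Measure.restrict_eq_zero.2 h)

lemma restrict_eq_self {ξ : Config d} {A : Set (Pt d)} (hA : MeasurableSet A)
    (h : ξ.toMeasure Aᶜ = 0) : ξ.restrict A hA = ξ := by
  have h1 := restrict_add_restrict_compl ξ hA
  rwa [restrict_eq_zero hA.compl h, add_zero] at h1

lemma ofPoints_apply_eq_zero {n : ℕ} {x : Fin n → Pt d} {A : Set (Pt d)} (hA : MeasurableSet A)
    (h : ∀ i, x i ∉ A) : (ofPoints x).toMeasure A = 0 := by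
  rw [ofPoints_apply _ hA]
  exact Finset.sum_eq_zero fun i _ => Set.indicator_of_notMem (h i) _

lemma isSimple_ofPoints {n : ℕ} {x : Fin n → Pt d} (hx : Function.Injective x) :
    (ofPoints x).IsSimple := by
  classical
  intro y
  rw [ofPoints_apply _ (measurableSet_singleton y)]
  simp only [Set.indicator_apply, Set.mem_singleton_iff, Pi.one_apply, Finset.sum_boole]
  have : (Finset.univ.filter fun i => x i = y).card ≤ 1 :=
    Finset.card_le_one.2 fun a ha b hb => hx (by
      rw [(Finset.mem_filter.1 ha).2, (Finset.mem_filter.1 hb).2])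
  exact_mod_cast this

/-- Once Δ contains the finitely many particles, enlarging it changes nothing, so the limit defining
the energy is eventually constant. -/
lemma restrict_diff_eventually_eq {n : ℕ} (w : Fin n → Pt d) (Λ : BddBorel d) :
    ∃ Δ₁ : BddBorel d, ∀ Δ : BddBorel d, Δ₁ ≤ Δ →
      (ofPoints w).restrict (Δ.1 \ Λ.1) (Δ.2.2.diff Λ.2.2)
        = (ofPoints w).restrict Λ.1ᶜ Λ.2.2.compl := by
  refine ⟨⟨Set.range w, (Set.finite_range w).isBounded, (Set.finite_range w).measurableSet⟩,
    fun Δ hΔ => ext ?_⟩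
  have hΔ' : ∀ i, w i ∈ Δ.1 := fun i => hΔ ⟨i, rfl⟩
  refine Measure.ext fun s hs => ?_
  simp only [restrict]
  rw [Measure.restrict_apply hs, Measure.restrict_apply hs,
    ofPoints_apply _ (hs.inter (Δ.2.2.diff Λ.2.2)), ofPoints_apply _ (hs.inter Λ.2.2.compl)]
  refine Finset.sum_congr rfl fun i _ => ?_
  classical
  simp [Set.indicator_apply, hΔ' i]

variable {T : L2 d →L[ℂ] L2 d} {J : Pt d → Pt d → ℂ}

lemma exists_detConfig (hJ : IsTraceClassKernel T J) {n : ℕ} (x : Fin n → Pt d) :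
    ∃ a : ℝ, 0 ≤ a ∧ configDet J (ofPoints x) = ENNReal.ofReal a ∧
      potential J (ofPoints x) = -ENNReal.log (ENNReal.ofReal a) :=
  ⟨_, (ofReal_detConfig hJ x).2, (ofReal_detConfig hJ x).1.symm, rfl⟩

lemma exp_neg_potential_add_mutualEnergy (hJ : IsTraceClassKernel T J) {n m : ℕ}
    (x : Fin n → Pt d) (y : Fin m → Pt d) (hy : configDet J (ofPoints y) ≠ 0) :
    EReal.exp (-(potential J (ofPoints x) + mutualEnergy J (ofPoints x) (ofPoints y)))
      = configDet J (ofPoints x + ofPoints y) / configDet J (ofPoints y) := by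
  obtain ⟨a, ha0, ha, hpa⟩ := exists_detConfig hJ x
  obtain ⟨c, hc0, hc, hpc⟩ := exists_detConfig hJ y
  obtain ⟨b, hb0, hb, hpb⟩ := exists_detConfig hJ (Fin.append x y)
  have hab : b ≠ 0 → a ≠ 0 := by
    intro h h0
    have h1 := configDet_ne_zero_of_add hJ y x
    rw [add_comm, ← ofPoints_append, hb, ha, h0] at h1
    exact h1 (ENNReal.ofReal_pos.2 (hb0.lt_of_ne' h)).ne' (by simp)
  have hcp : 0 < c := by
    rw [hc] at hy
    exact ENNReal.ofReal_pos.1 (pos_iff_ne_zero.2 hy)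
  rw [ofPoints_append] at hb hpb
  rw [mutualEnergy, add_eq, hpa, hpb, hpc, hb, hc]
  -- If det J vanishes on the union, the energy is +∞ and both sides are 0. Otherwise the three
  -- determinants are positive and the logarithms are real.
  rcases hb0.eq_or_lt with rfl | hbp
  · rw [if_pos (by simp)]
    have : -ENNReal.log (ENNReal.ofReal a) + ⊤ = ⊤ := by
      refine EReal.add_top_of_ne_bot ?_
      rw [Ne, EReal.neg_eq_bot_iff, ENNReal.log_eq_top_iff]
      exact ENNReal.ofReal_ne_top
    rw [this]
    simp
  · have hap : 0 < a := ha0.lt_of_ne' (hab hbp.ne')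
    rw [ENNReal.log_ofReal_of_pos hap, ENNReal.log_ofReal_of_pos hbp, ENNReal.log_ofReal_of_pos hcp,
      if_neg (by rw [← EReal.coe_neg]; exact EReal.coe_ne_top _)]
    norm_cast
    rw [EReal.exp_coe, ← ENNReal.ofReal_div_of_pos hcp]
    congr 1
    rw [show -(-Real.log a + (-Real.log b - -Real.log a - -Real.log c)) = Real.log b - Real.log c by
      ring, Real.exp_sub, Real.exp_log hbp, Real.exp_log hcp]

lemma atTop_bddBorel_neBot : (atTop : Filter (BddBorel d)).NeBot := by
  have : Nonempty (BddBorel d) := ⟨⟨∅, Bornology.isBounded_empty, MeasurableSet.empty⟩⟩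
  have : IsDirectedOrder (BddBorel d) := ⟨fun A B =>
    ⟨⟨A.1 ∪ B.1, A.2.1.union B.2.1, A.2.2.union B.2.2⟩, Set.subset_union_left,
      Set.subset_union_right⟩⟩
  infer_instance

lemma mem_possible (hJ : IsTraceClassKernel T J) {n : ℕ} (w : Fin n → Pt d)
    (hw : configDet J (ofPoints w) ≠ 0) (Λ : BddBorel d) : ofPoints w ∈ possible J Λ := by
  intro Δ _
  obtain ⟨p, u, hu⟩ := exists_restrict_ofPoints w Δ.2.2
  obtain ⟨q, v, hv⟩ := exists_restrict_ofPoints w Δ.2.2.compl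
  have h1 := restrict_add_restrict_compl (ofPoints w) Δ.2.2
  rw [← h1, hu, hv, add_comm] at hw
  have h2 := configDet_ne_zero_of_add hJ _ _ hw
  rw [hu]
  intro h0
  rw [← (ofReal_detConfig hJ u).1, h0] at h2
  simp at h2

/-- The Boltzmann weight and the specification density of finite configurations, in terms of
`det J`. -/
lemma exp_neg_energy (hJ : IsTraceClassKernel T J) {n m p : ℕ} {x : Fin n → Pt d}
    {w : Fin p → Pt d} {y : Fin m → Pt d} (hw : configDet J (ofPoints w) ≠ 0) {Λ : BddBorel d}
    (hx : ∀ i, x i ∈ Λ.1) (hy : (ofPoints w).restrict Λ.1ᶜ Λ.2.2.compl = ofPoints y)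
    (hy0 : configDet J (ofPoints y) ≠ 0) :
    EReal.exp (-energy J Λ (ofPoints x) (ofPoints w))
        = configDet J (ofPoints x + ofPoints y) / configDet J (ofPoints y) ∧
      specDensity J Λ (ofPoints x) (ofPoints w) = (partitionFn J Λ (ofPoints w))⁻¹ *
        (configDet J (ofPoints x + ofPoints y) / configDet J (ofPoints y)) := by
  by_cases hA : Admissible J Λ (ofPoints x) (ofPoints w)
  · have hE : energy J Λ (ofPoints x) (ofPoints w)
        = potential J (ofPoints x) + mutualEnergy J (ofPoints x) (ofPoints y) := by
      rw [energy, if_pos hA]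
      have := atTop_bddBorel_neBot (d := d)
      refine Tendsto.limUnder_eq (tendsto_const_nhds.congr' ?_)
      obtain ⟨Δ₁, hΔ₁⟩ := restrict_diff_eventually_eq w Λ
      filter_upwards [eventually_ge_atTop Δ₁] with Δ hΔ
      rw [hΔ₁ Δ hΔ, hy]
    have h1 := exp_neg_potential_add_mutualEnergy hJ x y hy0
    rw [specDensity, if_pos hA, hE, h1]
    exact ⟨rfl, rfl⟩
  -- The points lie in Λ and the boundary condition is possible, so admissibility fails only through
  -- coincident points. The determinant is then 0, in accordance with the convention for the
  -- density.
  · have h0 : configDet J (ofPoints x + ofPoints y) = 0 := by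
      by_contra h
      refine hA ⟨⟨isSimple_ofPoints ?_, ofPoints_apply_eq_zero Λ.2.2.compl fun i => by simpa using hx i⟩,
        mem_possible hJ w hw Λ⟩
      rw [← ofPoints_append] at h
      intro i j hij
      have h1 := injective_of_configDet_ne_zero _ h (a₁ := Fin.castAdd m i) (a₂ := Fin.castAdd m j)
        (by simpa using hij)
      exact Fin.castAdd_injective _ _ h1
    rw [specDensity, if_neg hA, energy, if_neg hA, h0]
    simp

end Energy

/-! ### The specification as a Markov kernel and the DLR equations -/

section Gibbs

variable {d : ℕ}

open Config ProbabilityTheory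

lemma ae_poisson {ν : Measure (Pt d)} {s : Set (Config d)} (hs : MeasurableSet s)
    (h : ∀ (n : ℕ) (x : Fin n → Pt d), ofPoints x ∈ s) : ∀ᵐ ξ ∂poisson ν, ξ ∈ s := by
  refine ae_iff.2 ?_
  change poisson ν sᶜ = 0
  have h1 : ∀ n, powConfig ν n sᶜ = 0 := by
    intro n
    rw [powConfig, Measure.map_apply (measurable_ofPoints n) hs.compl]
    convert measure_empty (μ := Measure.pi fun _ : Fin n => ν)
    ext x
    simp [h n x]
  rw [poisson, Measure.sum_apply _ hs.compl]
  simp [h1]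

lemma ae_poisson_exists_ofPoints (ν : Measure (Pt d)) :
    ∀ᵐ ξ ∂poisson ν, ∃ (n : ℕ) (x : Fin n → Pt d), ξ = ofPoints x := by
  have hs : MeasurableSet {ξ : Config d | ∃ n : ℕ, ξ.toMeasure Set.univ = n} := by
    have : {ξ : Config d | ∃ n : ℕ, ξ.toMeasure Set.univ = n}
        = ⋃ n : ℕ, {ξ : Config d | ξ.toMeasure Set.univ = n} := by
      ext ξ
      simp
    rw [this]
    exact MeasurableSet.iUnion fun n =>
      measurableSet_eq_fun (measurable_apply MeasurableSet.univ) measurable_const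
  filter_upwards [ae_poisson (ν := ν) hs fun n x => ⟨n, ofPoints_univ x⟩] with ξ ⟨n, hn⟩
  exact exists_eq_ofPoints n ξ hn

/-- Mecke's formula with F = 1 shows that the integral of the number of particles outside A is 0. -/
lemma ae_poisson_restrict_apply_compl (ν : Measure (Pt d)) [SigmaFinite ν] {A : Set (Pt d)}
    (hA : MeasurableSet A) : ∀ᵐ ξ ∂poisson (ν.restrict A), ξ.toMeasure Aᶜ = 0 := by
  have h := lintegral_poisson_mul_apply (ν.restrict A) (F := fun _ => 1) measurable_const hA.compl
  have h0 : (ν.restrict A) Aᶜ = 0 := by simp [Measure.restrict_apply hA.compl]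
  rw [Measure.restrict_eq_zero.2 h0, lintegral_zero_measure] at h
  simp only [mul_one] at h
  exact (lintegral_eq_zero_iff (measurable_apply hA.compl)).1 h

/-- The law of `ζ + η` given `η`, for the reference measure `poisson ν`. -/
def condKernelFun (J : Pt d → Pt d → ℂ) (ν : Measure (Pt d)) (η : Config d) : Measure (Config d) :=
  (∫⁻ ζ, configDet J (ζ + η) ∂poisson ν)⁻¹ •
    ((poisson ν).withDensity fun ζ => configDet J (ζ + η)).map (· + η)

variable {T : L2 d →L[ℂ] L2 d} {J : Pt d → Pt d → ℂ}

lemma measurable_configDet_add (hJ : IsTraceClassKernel T J) (η : Config d) :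
    Measurable fun ζ => configDet J (ζ + η) :=
  (measurable_configDet hJ.measurable).comp (measurable_add_const η)

lemma lintegral_condKernelFun (hJ : IsTraceClassKernel T J) (ν : Measure (Pt d)) (η : Config d)
    {F : Config d → ℝ≥0∞} (hF : Measurable F) :
    ∫⁻ ξ, F ξ ∂condKernelFun J ν η = (∫⁻ ζ, configDet J (ζ + η) ∂poisson ν)⁻¹ *
      ∫⁻ ζ, configDet J (ζ + η) * F (ζ + η) ∂poisson ν := by
  have hF' : Measurable fun ζ => F (ζ + η) := hF.comp (measurable_add_const η)
  rw [condKernelFun, lintegral_smul_measure, lintegral_map hF (measurable_add_const η),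
    lintegral_withDensity_eq_lintegral_mul _ (measurable_configDet_add hJ η) hF']
  rfl

/-- The specification of a set, as a kernel. -/
def gibbsKernel (hJ : IsTraceClassKernel T J) (Λ : BddBorel d) : Kernel (Config d) (Config d) where
  toFun ξ := condKernelFun J (volume.restrict Λ.1) (ξ.restrict Λ.1ᶜ Λ.2.2.compl)
  measurable' := by
    refine (Measure.measurable_of_measurable_coe (condKernelFun J (volume.restrict Λ.1))
      fun s hs => ?_).comp (measurable_restrict Λ.2.2.compl)
    have hF : Measurable (s.indicator (1 : Config d → ℝ≥0∞)) := measurable_one.indicator hs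
    simp only [← lintegral_indicator_one hs, lintegral_condKernelFun hJ _ _ hF]
    exact (measurable_lintegral_add (measurable_configDet hJ.measurable) _).inv.mul
      (measurable_lintegral_add ((measurable_configDet hJ.measurable).mul hF) _)

lemma gibbsKernel_apply (hJ : IsTraceClassKernel T J) (Λ : BddBorel d) (ξ : Config d) :
    gibbsKernel hJ Λ ξ = condKernelFun J (volume.restrict Λ.1) (ξ.restrict Λ.1ᶜ Λ.2.2.compl) := rfl

/-- Split the finite integral of `lintegral_poisson_configDet_add` between Λ and its complement and
keep the term with no particle outside. This gives finiteness for every y, not only almost every y.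
-/
lemma lintegral_configDet_add_ne_top (hJ : IsTraceClassKernel T J) (Λ : BddBorel d) {n : ℕ}
    (y : Fin n → Pt d) :
    ∫⁻ ζ, configDet J (ζ + ofPoints y) ∂poisson (volume.restrict Λ.1) ≠ ∞ := by
  have h := lintegral_poisson_configDet_add hJ y
  have hm : Measurable fun ζ => configDet J (ofPoints y + ζ) :=
    (measurable_configDet hJ.measurable).comp (measurable_const_add _)
  rw [← Measure.restrict_add_restrict_compl (μ := (volume : Measure (Pt d))) Λ.2.2,
    lintegral_poisson_add _ _ hm, lintegral_poisson] at h
  have hm2 := measurable_lintegral_add hm (poisson (volume.restrict Λ.1))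
  have h1 := ENNReal.le_tsum (f := fun n : ℕ => ((n ! : ℕ) : ℝ≥0∞)⁻¹ *
    ∫⁻ ξ, ∫⁻ ζ, configDet J (ofPoints y + (ζ + ξ)) ∂poisson (volume.restrict Λ.1)
      ∂powConfig (volume.restrict Λ.1ᶜ) n) 0
  rw [h, lintegral_powConfig_zero _ hm2] at h1
  refine ne_top_of_le_ne_top ENNReal.ofReal_ne_top (le_trans (le_of_eq ?_) h1)
  simp [add_comm]

/-- The fermion measure is invariant under the specification. -/
lemma comp_gibbsKernel (hJ : IsTraceClassKernel T J) (Λ : BddBorel d) :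
    gibbsKernel hJ Λ ∘ₘ fermionMeasure J = fermionMeasure J := by
  refine Measure.ext_of_lintegral _ fun F hF => ?_
  have hdm := measurable_configDet hJ.measurable
  have hK : Measurable fun ξ => ∫⁻ ξ', F ξ' ∂gibbsKernel hJ Λ ξ := hF.lintegral_kernel
  have hdK : Measurable fun ξ => configDet J ξ * ∫⁻ ξ', F ξ' ∂gibbsKernel hJ Λ ξ := hdm.mul hK
  have hdF : Measurable fun ξ => configDet J ξ * F ξ := hdm.mul hF
  rw [Measure.lintegral_bind (Kernel.aemeasurable _) hF.aemeasurable,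
    lintegral_fermionMeasure hJ hK, lintegral_fermionMeasure hJ hF]
  congr 1
  -- Fix the part η outside Λ. The kernel depends on η alone, so integrating the density over the
  -- inside part yields the total weight by which the kernel divides.
  rw [← Measure.restrict_add_restrict_compl (μ := (volume : Measure (Pt d))) Λ.2.2,
    lintegral_poisson_add _ _ hdK, lintegral_poisson_add _ _ hdF]
  refine lintegral_congr_ae ?_
  filter_upwards [ae_poisson_exists_ofPoints (volume.restrict Λ.1ᶜ),
    ae_poisson_restrict_apply_compl volume Λ.2.2.compl] with η ⟨n, y, hy⟩ hη
  have h1 : ∀ᵐ ζ ∂poisson ((volume : Measure (Pt d)).restrict Λ.1),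
      configDet J (ζ + η) * ∫⁻ ξ', F ξ' ∂gibbsKernel hJ Λ (ζ + η)
        = configDet J (ζ + η) * ∫⁻ ξ', F ξ' ∂condKernelFun J (volume.restrict Λ.1) η := by
    filter_upwards [ae_poisson_restrict_apply_compl volume Λ.2.2] with ζ hζ
    rw [gibbsKernel_apply, restrict_add, restrict_eq_zero _ hζ, zero_add, restrict_eq_self _ hη]
  rw [lintegral_congr_ae h1, lintegral_mul_const _ (measurable_configDet_add hJ η),
    lintegral_condKernelFun hJ _ _ hF, ← mul_assoc]
  -- If the total weight is 0, the density vanishes for almost every ζ and both sides are 0.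
  by_cases hA : ∫⁻ ζ, configDet J (ζ + η) ∂poisson ((volume : Measure (Pt d)).restrict Λ.1) = 0
  · rw [hA, zero_mul, zero_mul]
    have h2 := (lintegral_eq_zero_iff (measurable_configDet_add hJ η)).1 hA
    symm
    refine (lintegral_eq_zero_iff (hdF.comp (measurable_add_const η))).2 ?_
    filter_upwards [h2] with ζ hζ
    simp only [Pi.zero_apply] at hζ
    simp [hζ]
  · rw [ENNReal.mul_inv_cancel hA, one_mul]
    rw [hy]
    exact lintegral_configDet_add_ne_top hJ Λ y

lemma ae_fermionMeasure (hJ : IsTraceClassKernel T J) : ∀ᵐ ξ ∂fermionMeasure J,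
    ∃ (n : ℕ) (w : Fin n → Pt d), ξ = ofPoints w ∧ configDet J (ofPoints w) ≠ 0 := by
  refine Measure.ae_smul_measure ?_ _
  refine (ae_withDensity_iff (measurable_configDet hJ.measurable)).2 ?_
  filter_upwards [ae_poisson_exists_ofPoints volume] with ξ ⟨n, x, hx⟩ h0
  exact ⟨n, x, hx, hx ▸ h0⟩

lemma integral_poisson (ν : Measure (Pt d)) [SigmaFinite ν] {g : Config d → ℝ} (hg : Measurable g)
    (hi : Integrable g (poisson ν)) : ∫ ξ, g ξ ∂poisson ν
      = ∑' n : ℕ, (n ! : ℝ)⁻¹ * ∫ x : Fin n → Pt d, g (ofPoints x) ∂Measure.pi fun _ => ν := by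
  rw [poisson, integral_sum_measure hi]
  refine tsum_congr fun n => ?_
  rw [integral_smul_measure, powConfig, integral_map (measurable_ofPoints n).aemeasurable
    hg.aestronglyMeasurable]
  simp

lemma restrict_pi_eq (Λ : BddBorel d) (n : ℕ) :
    (volume : Measure (Fin n → Pt d)).restrict {x | ∀ i, x i ∈ Λ.1}
      = Measure.pi fun _ => volume.restrict Λ.1 := by
  rw [← Measure.restrict_pi_pi, volume_pi]
  congr 1
  ext x
  simp

lemma measurableSet_forall_mem (Λ : BddBorel d) (n : ℕ) :
    MeasurableSet {x : Fin n → Pt d | ∀ i, x i ∈ Λ.1} := by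
  have : {x : Fin n → Pt d | ∀ i, x i ∈ Λ.1} = Set.univ.pi fun _ => Λ.1 := by
    ext x
    simp
  rw [this]
  exact MeasurableSet.univ_pi fun _ => Λ.2.2

/-- The determinant of the boundary configuration divides both the Boltzmann weight and the
partition function and cancels; what remains is `configDet J (ζ + η)` over its total mass. -/
lemma spec_eq_integral_gibbsKernel (hJ : IsTraceClassKernel T J) (Λ : BddBorel d)
    {f : Config d → ℝ} (hf : Measurable f) {C : ℝ} (hC : ∀ ξ, |f ξ| ≤ C) {p : ℕ}
    (w : Fin p → Pt d) (hw : configDet J (ofPoints w) ≠ 0) :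
    spec J Λ f (ofPoints w) = ∫ ξ, f ξ ∂gibbsKernel hJ Λ (ofPoints w) := by
  obtain ⟨q, u, hu⟩ := exists_restrict_ofPoints w Λ.2.2
  obtain ⟨m, y, hy⟩ := exists_restrict_ofPoints w Λ.2.2.compl
  have hy0 : configDet J (ofPoints y) ≠ 0 := by
    rw [← restrict_add_restrict_compl (ofPoints w) Λ.2.2, hu, hy] at hw
    exact configDet_ne_zero_of_add hJ _ _ hw
  have hyt : configDet J (ofPoints y) ≠ ∞ := by
    rw [configDet_ofPoints]
    exact ENNReal.ofReal_ne_top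
  set A := ∫⁻ ζ, configDet J (ζ + ofPoints y) ∂poisson ((volume : Measure (Pt d)).restrict Λ.1)
    with hAdef
  have hA : A ≠ ∞ := lintegral_configDet_add_ne_top hJ Λ y
  have hdm := measurable_configDet_add hJ (ofPoints y)
  have hZ : partitionFn J Λ (ofPoints w) = A / configDet J (ofPoints y) := by
    rw [partitionFn, hAdef, lintegral_poisson, div_eq_mul_inv, ← ENNReal.tsum_mul_right]
    refine tsum_congr fun n => ?_
    rw [lintegral_powConfig _ _ hdm, mul_assoc, ← lintegral_mul_const' _ _
      (ENNReal.inv_ne_top.2 hy0), ← restrict_pi_eq]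
    congr 1
    refine setLIntegral_congr_fun (measurableSet_forall_mem Λ n) fun x hx => ?_
    exact (exp_neg_energy hJ hw hx hy hy0).1
  have hdens : ∀ (n : ℕ) (x : Fin n → Pt d), (∀ i, x i ∈ Λ.1) →
      specDensity J Λ (ofPoints x) (ofPoints w) = A⁻¹ * configDet J (ofPoints x + ofPoints y) := by
    intro n x hx
    rw [(exp_neg_energy hJ hw hx hy hy0).2, hZ, div_eq_mul_inv, div_eq_mul_inv,
      ENNReal.mul_inv (Or.inr (ENNReal.inv_ne_top.2 hy0)) (Or.inr (ENNReal.inv_ne_zero.2 hyt)),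
      inv_inv, mul_assoc, mul_left_comm (configDet J (ofPoints y)),
      ENNReal.mul_inv_cancel hy0 hyt, mul_one]
  have hfm : Measurable fun ζ => f (ζ + ofPoints y) := hf.comp (measurable_add_const _)
  have hlt : ∀ᵐ ζ ∂poisson ((volume : Measure (Pt d)).restrict Λ.1),
      configDet J (ζ + ofPoints y) < ∞ := ae_lt_top hdm hA
  have hgm : Measurable fun ζ => (configDet J (ζ + ofPoints y)).toReal * f (ζ + ofPoints y) :=
    hdm.ennreal_toReal.mul hfm
  have hgi : Integrable (fun ζ => (configDet J (ζ + ofPoints y)).toReal * f (ζ + ofPoints y))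
      (poisson (volume.restrict Λ.1)) := by
    refine (integrable_toReal_of_lintegral_ne_top hdm.aemeasurable hA).mul_bdd (c := C)
      hfm.aestronglyMeasurable (Eventually.of_forall fun ζ => hC _)
  rw [gibbsKernel_apply, hy, condKernelFun, integral_smul_measure,
    integral_map (measurable_add_const _).aemeasurable hf.aestronglyMeasurable,
    integral_withDensity_eq_integral_toReal_smul hdm hlt]
  simp only [smul_eq_mul]
  rw [integral_poisson _ hgm hgi, ← tsum_mul_left, spec]
  refine tsum_congr fun n => ?_
  rw [mul_left_comm]
  refine congrArg (fun r => (n ! : ℝ)⁻¹ * r) ?_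
  rw [← integral_const_mul, ← restrict_pi_eq]
  refine setIntegral_congr_fun (measurableSet_forall_mem Λ n) fun x hx => ?_
  rw [hdens n x hx, add_eq, hy, ENNReal.toReal_mul, mul_assoc]

/-- Almost surely ξ is finite with nonzero determinant, where `spec` is integration against
`gibbsKernel`; the DLR equation is then invariance tested on f. -/
theorem isGibbs_fermionMeasure (hJ : IsTraceClassKernel T J) : IsGibbs J (fermionMeasure J) := by
  have hP := isProbabilityMeasure_fermionMeasure hJ
  refine ⟨hP, fun Λ f hf ⟨C, hC⟩ => ?_⟩
  have h1 : spec J Λ f =ᵐ[fermionMeasure J] fun ξ => ∫ ξ', f ξ' ∂gibbsKernel hJ Λ ξ := by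
    filter_upwards [ae_fermionMeasure hJ] with ξ ⟨n, w, hξ, hw⟩
    rw [hξ, spec_eq_integral_gibbsKernel hJ Λ hf hC w hw]
  have hfi : Integrable f (gibbsKernel hJ Λ ∘ₘ fermionMeasure J) := by
    rw [comp_gibbsKernel hJ]
    exact Integrable.of_bound hf.aestronglyMeasurable C (Eventually.of_forall hC)
  have h2 := comp_gibbsKernel hJ Λ
  -- The measure is read as a constant kernel so that `Kernel.integral_comp` applies.
  rw [Measure.comp_eq_comp_const_apply] at h2 hfi
  have h3 := Kernel.integral_comp hfi
  have h4 : Integrable (fun ξ => ∫ ξ', f ξ' ∂gibbsKernel hJ Λ ξ) _ := hfi.integral_comp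
  rw [h2, Kernel.const_apply] at h3
  rw [Kernel.const_apply] at h4
  exact ⟨h4.congr h1.symm, h3.trans (integral_congr_ae h1.symm)⟩

end Gibbs

end DPP

end

/-- Let `T` be a positive trace class integral operator on `L²(ℝ^d)` whose kernel `J` is supported
on a compact set `Δ₀`. Then there is exactly one fermion random point field for
`T (I + T)⁻¹`, and it is a Gibbs measure for the specification `γ^(J)`. -/
theorem mainTheorem4 (d : ℕ) (Δ₀ : Set (DPP.Pt d)) (hΔ₀ : IsCompact Δ₀)
    (T : DPP.L2 d →L[ℂ] DPP.L2 d) (J : DPP.Pt d → DPP.Pt d → ℂ)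
    (hJ : DPP.IsTraceClassKernel T J)
    (hsupp : ∀ x y, ¬ (x ∈ Δ₀ ∧ y ∈ Δ₀) → J x y = 0) :
    (∃! μ : MeasureTheory.Measure (DPP.Config d), DPP.IsFermion μ (DPP.resolventOp T)) ∧
      ∀ μ : MeasureTheory.Measure (DPP.Config d),
        DPP.IsFermion μ (DPP.resolventOp T) → DPP.IsGibbs J μ := by
  have h := DPP.isFermion_fermionMeasure hJ
  exact ⟨⟨DPP.fermionMeasure J, h, fun μ hμ => hμ.unique h⟩,
    fun μ hμ => hμ.unique h ▸ DPP.isGibbs_fermionMeasure hJ⟩
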